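/- Let $n\in\mathbb N$, let $e_1,\dots,e_{2n}\in\mathbb C^n$ be linearly independent over $\mathbb R$, and let $\Gamma=\mathbb Z e_1+\dots+\mathbb Z e_{2n}$. Consider the map $$\mathrm{int}_\Gamma:\bigoplus_{1\le k<n}H_{2k}(\mathbb C^n/\Gamma,\mathbb Z)\to\bigoplus_{\substack{1\le k<n,\ p+q=2k\\ p>q\ge 0}}\bigl(H^{p,q}(\mathbb C^n/\Gamma,\mathbb C)\bigr)^*,\qquad \mathrm{int}_\Gamma(S)([\alpha])=\int_S\alpha ,$$ from singular homology to functionals on Dolbeault cohomology. Here $\alpha$ is a $d$-closed smooth $(p,q)$-form representing its Dolbeault class, $S$ is represented by a smooth singular cycle, and the component of $\mathrm{int}_\Gamma(S)$ on $H^{p,q}$, $p+q=2k$, is given by the component of $S$ in $H_{2k}$. For $0<k<n$ let $I_k$ be the set of strictly increasing multi-indices $i=(i_1<\dots<i_{2k})$ with entries in $\{1,\dots,2n\}$. For $i\in I_k$ and strictly increasing multi-indices $P=(P_1<\dots<P_p)$, $Q=(Q_1<\dots<Q_q)$ with entries in $\{1,\dots,n\}$ and $p+q=2k$, let $C^i_{P,Q}$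 be the determinant of the $2k\times 2k$ matrix whose $r$-th row is $$\bigl(e_{i_r,P_1},\dots,e_{i_r,P_p},\overline{e_{i_r,Q_1}},\dots,\overline{e_{i_r,Q_q}}\bigr),$$ where $e_{j,l}$ denotes the $l$-th coordinate of $e_j$. Then $\ker\mathrm{int}_\Gamma=0$ if and only if for every $0<k<n$ there is no family of integers $(a_i)_{i\in I_k}$, not all zero, such that $$\sum_{i\in I_k}a_i\,C^i_{P,Q}=0$$ for all strictly increasing $P$, $Q$ as above with $p+q=2k$ and $p>q$. -/

import Mathlib

open CategoryTheory MeasureTheory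
open scoped ContDiff DirectSum ComplexConjugate

noncomputable section

namespace ComplexTorus

variable {n : ℕ}

/-! ### The complex torus and its singular homology -/

/-- The additive subgroup of `ℂⁿ` generated by the vectors `e₁, …, e_{2n}`. -/
def lattice (e : Fin (2 * n) → Fin n → ℂ) : AddSubgroup (Fin n → ℂ) :=
  AddSubgroup.closure (Set.range e)

variable (Γ : AddSubgroup (Fin n → ℂ))

/-- The quotient `ℂⁿ / Γ` with the quotient topology. -/
abbrev Torus : TopCat.{0} := TopCat.of ((Fin n → ℂ) ⧸ Γ)

/-- The integral singular chain complex of `ℂⁿ / Γ`. -/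
abbrev singularChains : ChainComplex (ModuleCat.{0} ℤ) ℕ :=
  (TopCat.toSSet.obj (Torus Γ)).chainComplex (ModuleCat.of ℤ ℤ)

/-- The singular homology group `H_m(ℂⁿ / Γ, ℤ)`. -/
abbrev singularHomology (m : ℕ) : ModuleCat.{0} ℤ := (singularChains Γ).homology m

lemma singularHomology_eq (m : ℕ) : singularHomology Γ m =
    ((AlgebraicTopology.singularHomologyFunctor (ModuleCat.{0} ℤ) m).obj
      (ModuleCat.of ℤ ℤ)).obj (Torus Γ) := rfl

/-! ### Smooth singular chains

The standard `m`-simplex is parametrized by `{x ∈ ℝᵐ : x_j ≥ 0, ∑ x_j ≤ 1}`, the point `x` having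
barycentric coordinates `(1 - ∑ x_j, x₁, …, x_m)`. A smooth singular simplex of `ℂⁿ / Γ` lifts to
`ℂⁿ`, and a smooth map on the closed simplex extends smoothly to `ℝᵐ`; so every smooth singular
simplex is given by a smooth map `ℝᵐ → ℂⁿ`. -/

/-- A smooth map `ℝᵐ → ℂⁿ`, which represents a smooth singular simplex of `ℂⁿ / Γ`. -/
abbrev SmoothSimplex (n m : ℕ) : Type :=
  {f : (Fin m → ℝ) → (Fin n → ℂ) // ContDiff ℝ ∞ f}

/-- The singular simplex of `ℂⁿ / Γ` which is represented by a smooth map `ℝᵐ → ℂⁿ`. -/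
def SmoothSimplex.toSingular {m : ℕ} (f : SmoothSimplex n m) :
    (TopCat.toSSet.obj (Torus Γ)).obj (.op (SimplexCategory.mk m)) :=
  (TopCat.toSSetObjEquiv (Torus Γ) (.op (SimplexCategory.mk m))).symm
    { toFun := fun t => QuotientAddGroup.mk (f.1 fun j : Fin m => t.1 j.succ)
      continuous_toFun := by
        refine QuotientAddGroup.continuous_mk.comp (f.2.continuous.comp ?_)
        exact continuous_pi fun j => (continuous_apply _).comp continuous_subtype_val }

/-- Smooth singular `m`-chains with integral coefficients. -/
abbrev SmoothChain (n m : ℕ) : Type := SmoothSimplex n m →₀ ℤ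

/-- The singular chain of `ℂⁿ / Γ` given by the single smooth simplex `f`. -/
def SmoothSimplex.toChain {m : ℕ} (f : SmoothSimplex n m) : (singularChains Γ).X m :=
  ((TopCat.toSSet.obj (Torus Γ)).ιChainComplex (R := ModuleCat.of ℤ ℤ)
    (f.toSingular Γ)).hom (1 : ℤ)

/-- The singular chain of `ℂⁿ / Γ` underlying a smooth singular chain. -/
def SmoothChain.toSingular {m : ℕ} (c : SmoothChain n m) : (singularChains Γ).X m :=
  c.sum fun f a => a • f.toChain Γ

/-- The smooth singular chain `c` is a cycle in `ℂⁿ / Γ`, and its homology class is `S`. -/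
def SmoothChain.Represents {m : ℕ} (c : SmoothChain n m) (S : singularHomology Γ m) : Prop :=
  ∃ z : (singularChains Γ).cycles m,
    ((singularChains Γ).iCycles m).hom z = c.toSingular Γ ∧
    ((singularChains Γ).homologyπ m).hom z = S

/-! ### Differential forms and Dolbeault cohomology

A differential form on `ℂⁿ / Γ` is the same thing as a `Γ`-periodic form on `ℂⁿ`. -/

/-- Complex-valued differential forms of degree `m` on `ℂⁿ`. -/
abbrev Form (n m : ℕ) : Type := (Fin n → ℂ) → (Fin n → ℂ) [⋀^Fin m]→L[ℝ] ℂ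

/-- The form `w` (of degree `p + q`) is of type `(p, q)`: the `(p, q)`-part of the space of
alternating forms is the part on which the scalars `c ∈ ℂ` act by `c ^ p * (conj c) ^ q`. -/
def IsType {m : ℕ} (p q : ℕ) (w : Form n m) : Prop :=
  ∀ (x : Fin n → ℂ) (c : ℂ) (v : Fin m → Fin n → ℂ),
    w x (fun j => c • v j) = c ^ p * conj c ^ q * w x v

lemma IsType.zero {m : ℕ} (p q : ℕ) : IsType p q (0 : Form n m) := by
  intro x c v; simp

lemma IsType.add {m p q : ℕ} {w u : Form n m} (hw : IsType p q w) (hu : IsType p q u) :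
    IsType p q (w + u) := by
  intro x c v
  simp only [Pi.add_apply, ContinuousAlternatingMap.add_apply, hw x c v, hu x c v]
  ring

lemma IsType.smul {m p q : ℕ} {w : Form n m} (a : ℂ) (hw : IsType p q w) :
    IsType p q (a • w) := by
  intro x c v
  simp only [Pi.smul_apply, ContinuousAlternatingMap.smul_apply, hw x c v, smul_eq_mul]
  ring

/-- The smooth forms of degree `m` and of type `(p, q)` on `ℂⁿ / Γ` (where `m = p + q`). -/
def torusForms (m p q : ℕ) : Submodule ℂ (Form n m) where
  carrier := {w | ContDiff ℝ ∞ w ∧ (∀ γ ∈ Γ, ∀ x, w (x + γ) = w x) ∧ IsType p q w}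
  zero_mem' := ⟨contDiff_const, fun _ _ _ => rfl, IsType.zero p q⟩
  add_mem' := fun {w u} hw hu =>
    ⟨hw.1.add hu.1, fun γ hγ x => by simp [hw.2.1 γ hγ x, hu.2.1 γ hγ x], hw.2.2.add hu.2.2⟩
  smul_mem' := fun a w hw =>
    ⟨contDiff_const.smul hw.1, fun γ hγ x => by simp [hw.2.1 γ hγ x], hw.2.2.smul a⟩

lemma extDeriv_add_form {m : ℕ} {w u : Form n m} (hw : ContDiff ℝ ∞ w) (hu : ContDiff ℝ ∞ u) :
    extDeriv (w + u) = extDeriv w + extDeriv u := by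
  funext x
  exact extDeriv_add (hw.differentiable (by simp) x) (hu.differentiable (by simp) x)

lemma extDeriv_smul_form {m : ℕ} (a : ℂ) {w : Form n m} (hw : ContDiff ℝ ∞ w) :
    extDeriv (a • w) = a • extDeriv w := by
  funext x
  have h : fderiv ℝ (a • w) x = a • fderiv ℝ w x :=
    fderiv_const_smul (hw.differentiable (by simp) x) a
  ext v
  simp only [extDeriv, h, Pi.smul_apply, ContinuousAlternatingMap.smul_apply,
    ContinuousAlternatingMap.alternatizeUncurryFin_apply, _root_.smul_apply,
    Finset.smul_sum]
  exact Finset.sum_congr rfl fun i _ => smul_comm _ _ _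

lemma extDeriv_zero_form {m : ℕ} : extDeriv (0 : Form n m) = (0 : Form n (m + 1)) := by
  have h : ContDiff ℝ ∞ (0 : Form n m) := contDiff_const
  simpa only [add_zero, left_eq_add] using extDeriv_add_form h h

/-- The `∂̄`-closed smooth forms of type `(p, q)` on `ℂⁿ / Γ`. As `dw = ∂w + ∂̄w` with `∂w` of type
`(p + 1, q)` and `∂̄w` of type `(p, q + 1)`, one has `∂̄w = 0` if and only if `dw` is of type
`(p + 1, q)`. -/
def delbarClosed (m p q : ℕ) : Submodule ℂ (Form n m) where
  carrier := {w | w ∈ torusForms Γ m p q ∧ IsType (p + 1) q (extDeriv w)}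
  zero_mem' := ⟨zero_mem _, by rw [extDeriv_zero_form]; exact IsType.zero _ _⟩
  add_mem' := fun {w u} hw hu =>
    ⟨add_mem hw.1 hu.1, by rw [extDeriv_add_form hw.1.1 hu.1.1]; exact hw.2.add hu.2⟩
  smul_mem' := fun a w hw =>
    ⟨Submodule.smul_mem _ a hw.1, by rw [extDeriv_smul_form a hw.1.1]; exact hw.2.smul a⟩

/-- The `∂̄`-exact smooth forms of degree `m` and type `(p, q)` on `ℂⁿ / Γ` (where `m = p + q`).
A form `w` of type `(p, q + 1)` equals `∂̄u`, where `u` is of type `(p, q)`, if and only if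
`du - w` is of type `(p + 1, q)`. For `q = 0` only the zero form is exact. -/
def delbarExact (p : ℕ) : (m q : ℕ) → Submodule ℂ (Form n m)
  | m + 1, q + 1 =>
    { carrier := {w | w ∈ torusForms Γ (m + 1) p (q + 1) ∧
        ∃ u ∈ torusForms Γ m p q, IsType (p + 1) q (extDeriv u - w)}
      zero_mem' := ⟨zero_mem _, 0, zero_mem _, by
        rw [extDeriv_zero_form, sub_zero]; exact IsType.zero _ _⟩
      add_mem' := by
        rintro w w' ⟨h, u, hu, ht⟩ ⟨h', u', hu', ht'⟩
        refine ⟨add_mem h h', u + u', add_mem hu hu', ?_⟩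
        rw [extDeriv_add_form hu.1 hu'.1, add_sub_add_comm]
        exact ht.add ht'
      smul_mem' := by
        rintro a w ⟨h, u, hu, ht⟩
        refine ⟨Submodule.smul_mem _ a h, a • u, Submodule.smul_mem _ a hu, ?_⟩
        rw [extDeriv_smul_form a hu.1, ← smul_sub]
        exact ht.smul a }
  | _, _ => ⊥

/-- The Dolbeault cohomology group `H^{p,q}(ℂⁿ / Γ, ℂ)`, where `m = p + q`: the `∂̄`-closed forms
modulo the `∂̄`-exact forms, that is, the image of the space of `∂̄`-closed forms in the quotient of
the space of all forms by the space of `∂̄`-exact forms. -/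
abbrev Dolbeault (m p q : ℕ) : Submodule ℂ (Form n m ⧸ delbarExact Γ p m q) :=
  (delbarClosed Γ m p q).map (delbarExact Γ p m q).mkQ

/-! ### Integration -/

/-- The simplex `{x ∈ ℝᵐ : x_j ≥ 0, ∑ x_j ≤ 1}`. -/
def cornerSimplex (m : ℕ) : Set (Fin m → ℝ) := {x | (∀ j, 0 ≤ x j) ∧ ∑ j, x j ≤ 1}

/-- The integral of the pull-back of the form `α` along the smooth simplex `f`. -/
def SmoothSimplex.integral {m : ℕ} (f : SmoothSimplex n m) (α : Form n m) : ℂ :=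
  ∫ x in cornerSimplex m, α (f.1 x) fun j => fderiv ℝ f.1 x (Pi.single j 1)

/-- The integral of the form `α` over a smooth singular chain. -/
def SmoothChain.integral {m : ℕ} (c : SmoothChain n m) (α : Form n m) : ℂ :=
  c.sum fun f a => (a : ℂ) * f.integral α

/-- `v` is the integral over a smooth cycle in the homology class `S` of a `d`-closed form of type
`(p, q)` in the Dolbeault class `ξ`. The number `v` depends only on `S` and `ξ` (Stokes' theorem;
a `d`-closed and `∂̄`-exact form on a torus is `d`-exact). -/
def IsIntegral {m p q : ℕ} (S : singularHomology Γ m) (ξ : Dolbeault Γ m p q) (v : ℂ) : Prop :=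
  ∃ c : SmoothChain n m, c.Represents Γ S ∧
    ∃ α ∈ torusForms Γ m p q, extDeriv α = 0 ∧ (delbarExact Γ p m q).mkQ α = ξ ∧
      c.integral α = v

open Classical in
/-- The integral `∫_S ξ` of a Dolbeault class over a singular homology class: the integral of a
`d`-closed form of type `(p, q)` in the class `ξ` over a smooth cycle in the class `S`. (On a torus
each Dolbeault class contains such a form, and each homology class contains such a cycle.) -/
def integral {m p q : ℕ} (S : singularHomology Γ m) (ξ : Dolbeault Γ m p q) : ℂ :=
  if h : ∃ v, IsIntegral Γ S ξ v then h.choose else 0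

/-- The map `int_Γ` from `⨁_{1 ≤ k < n} H_{2k}(ℂⁿ / Γ, ℤ)` to the functionals on
`⨁_{p + q = 2k, 1 ≤ k < n, p > q} H^{p,q}(ℂⁿ / Γ, ℂ)`; the latter are written as the families, for
all such `k` and `t = (p, q)`, of their restrictions to the summands `H^{p,q}`. -/
def intMap (S : ⨁ k : {k : ℕ // 1 ≤ k ∧ k < n}, singularHomology Γ (2 * k.1))
    (k : {k : ℕ // 1 ≤ k ∧ k < n}) (t : {t : ℕ × ℕ // t.1 + t.2 = 2 * k.1 ∧ t.2 < t.1})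
    (ξ : Dolbeault Γ (2 * k.1) t.1.1 t.1.2) : ℂ :=
  integral Γ (S k) ξ

/-- The kernel of `int_Γ`. -/
def kerInt : Set (⨁ k : {k : ℕ // 1 ≤ k ∧ k < n}, singularHomology Γ (2 * k.1)) :=
  {S | intMap Γ S = 0}

/-! ### The determinants -/

/-- The determinant `C^i_{P,Q}` of the `2k × 2k`-matrix whose `r`-th row is
`(e_{i_r,P_1}, …, e_{i_r,P_p}, conj e_{i_r,Q_1}, …, conj e_{i_r,Q_q})`, where `p + q = 2k`. The
multi-indices `i`, `P`, `Q` are strictly increasing sequences. -/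
def latticeDet (e : Fin (2 * n) → Fin n → ℂ) {k p q : ℕ} (h : p + q = 2 * k)
    (i : Fin (2 * k) ↪o Fin (2 * n)) (P : Fin p ↪o Fin n) (Q : Fin q ↪o Fin n) : ℂ :=
  Matrix.det (Matrix.of fun r s : Fin (2 * k) =>
    Fin.append (fun a : Fin p => e (i r) (P a)) (fun b : Fin q => conj (e (i r) (Q b)))
      (Fin.cast h.symm s))

end ComplexTorus

end

noncomputable section

namespace ComplexTorus

section

variable {n : ℕ} {Γ : AddSubgroup (Fin n → ℂ)}

/-! ### Lifting singular simplices -/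

/-! Both sides reduce to linear algebra over the parallelepipeds spanned by lattice vectors.

Topology: every class in `H_m` of the torus is an integral combination of the parallelepipeds on the
`m`-subsets of `e` (`exists_boxSum_isCycleIn`). Singular simplices are lifted to `ℂⁿ` and deformed
linearly to affine simplices, so that a cycle becomes a chain of vertex tuples which is closed
modulo translations by `Γ`. Such chains are decomposed by adjoining the generators of the lattice
one at a time (`exists_boxSpan_of_isCycleMod`). A constant form `w` yields a cocycle on tuples,
whose value on the combination with coefficients `a i` is `± m! ∑ a i * w (e ∘ i)`
(`edgeCochain_boxSum`).

Analysis: the integral of a closed periodic form over a cycle is unchanged when the form is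
translated, so up to volume factors it is the period of the average of the form over a fundamental
domain (`integral_eq_average`). Averages of `∂̄`-exact forms vanish
(`average_eq_zero_of_mem_delbarExact`). Hence all integrals of type `(p, q)` over a class vanish
exactly when its periods against constant `(p, q)`-forms vanish (`integral_eq_zero_iff`).

Algebra: constant `(p, q)`-forms are combinations of the products `dz_P ∧ dz̄_Q`, whose values on `e
∘ i` are the determinants `C^i_{P,Q}` (`sum_mul_apply_eq_zero`, `isType_detForm`). Thus the class
with coefficients `a` lies in the kernel exactly when `a` satisfies the stated relations. A class
with `a ≠ 0` is nonzero, because the products of the real coordinates dual to `e` recover each `a i`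
(`sum_mul_detForm_coord`). -/

lemma isCoveringMap_mk (Γ : AddSubgroup (Fin n → ℂ)) [DiscreteTopology Γ] :
    IsCoveringMap (QuotientAddGroup.mk : (Fin n → ℂ) → (Fin n → ℂ) ⧸ Γ) := by
  exact (AddSubgroup.isAddQuotientCoveringMap_of_comm Γ ⟨inferInstance⟩).isCoveringMap

section Lifts

variable {ι κ : Type} [Fintype ι] [Fintype κ]

instance [Nonempty ι] : SimplyConnectedSpace (stdSimplex ℝ ι) := by
  have := (convex_stdSimplex ℝ ι).contractibleSpace ⟨_, (inferInstance : Nonempty (stdSimplex ℝ ι)).some.2⟩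
  infer_instance

instance : LocallyPathConnectedSpace (stdSimplex ℝ ι) :=
  (convex_stdSimplex ℝ ι).locallyPathConnectedSpace

lemma exists_lift [DiscreteTopology Γ] [Nonempty ι] (σ : C(stdSimplex ℝ ι, (Fin n → ℂ) ⧸ Γ)) :
    ∃ F : C(stdSimplex ℝ ι, Fin n → ℂ), ∀ t, (QuotientAddGroup.mk (F t) : (Fin n → ℂ) ⧸ Γ) = σ t := by
  obtain ⟨t₀⟩ : Nonempty (stdSimplex ℝ ι) := inferInstance
  obtain ⟨x, hx⟩ := QuotientAddGroup.mk_surjective (σ t₀)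
  obtain ⟨F, ⟨-, hF⟩, -⟩ := (isCoveringMap_mk Γ).existsUnique_continuousMap_lifts σ t₀ x hx
  exact ⟨F, fun t => congrFun hF t⟩

/-- The difference of the two lifts is a continuous map from a connected space to the discrete group
`Γ`, hence constant. -/
lemma exists_add_of_lifts_eq [DiscreteTopology Γ] {X : Type*} [TopologicalSpace X]
    [PreconnectedSpace X] [Nonempty X] {F G : X → Fin n → ℂ} (hF : Continuous F)
    (hG : Continuous G)
    (h : ∀ t, (QuotientAddGroup.mk (F t) : (Fin n → ℂ) ⧸ Γ) = QuotientAddGroup.mk (G t)) :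
    ∃ γ ∈ Γ, ∀ t, G t = F t + γ := by
  let g : X → Γ := fun t => ⟨-F t + G t, QuotientAddGroup.eq.1 (h t)⟩
  have hg : Continuous g := by
    refine Continuous.subtype_mk (hF.neg.add hG) _
  obtain ⟨t₀⟩ := ‹Nonempty X›
  refine ⟨g t₀, (g t₀).2, fun t => ?_⟩
  have : g t = g t₀ := PreconnectedSpace.constant inferInstance hg
  rw [← this]; simp [g]

/-- The point with barycentric coordinates `t` with respect to the points `x i`. -/
def baryPoint (x : ι → Fin n → ℂ) (t : stdSimplex ℝ ι) : Fin n → ℂ := ∑ i, t i • x i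

lemma continuous_stdSimplex_apply (i : ι) : Continuous fun t : stdSimplex ℝ ι => t i :=
  (continuous_apply i).comp continuous_subtype_val

lemma continuous_baryPoint (x : ι → Fin n → ℂ) : Continuous (baryPoint x) :=
  continuous_finsetSum _ fun i _ => (continuous_stdSimplex_apply i).smul continuous_const

lemma sum_map_smul {E : Type*} [AddCommGroup E] [Module ℝ E] (f : ι → κ) (t : stdSimplex ℝ ι)
    (x : κ → E) : ∑ j, (stdSimplex.map f t) j • x j = ∑ i, t i • x (f i) := by
  classical
  simp only [stdSimplex.map_coe, FunOnFinite.linearMap_apply_apply, Finset.sum_smul]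
  rw [← Finset.sum_fiberwise Finset.univ f]
  refine Finset.sum_congr rfl fun j _ => Finset.sum_congr rfl fun i hi => ?_
  rw [(Finset.mem_filter.1 hi).2]

lemma baryPoint_map (f : ι → κ) (x : κ → Fin n → ℂ) (t : stdSimplex ℝ ι) :
    baryPoint x (stdSimplex.map f t) = baryPoint (x ∘ f) t := sum_map_smul f t x

lemma baryPoint_add (x : ι → Fin n → ℂ) (γ : Fin n → ℂ) (t : stdSimplex ℝ ι) :
    baryPoint (fun i => x i + γ) t = baryPoint x t + γ := by
  simp only [baryPoint, smul_add, Finset.sum_add_distrib, ← Finset.sum_smul]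
  rw [show ∑ i, t i = 1 from t.2.2, one_smul]

end Lifts

/-- The continuous map underlying a singular simplex. -/
abbrev simplexMap {m : SimplexCategoryᵒᵖ} (σ : (TopCat.toSSet.obj (Torus Γ)).obj m) :
    C(stdSimplex ℝ (Fin (m.unop.len + 1)), (Fin n → ℂ) ⧸ Γ) :=
  TopCat.toSSetObjEquiv (Torus Γ) m σ

/-- The singular simplex of the torus covered by a continuous map to `ℂⁿ`. -/
def project (Γ : AddSubgroup (Fin n → ℂ)) (m : SimplexCategoryᵒᵖ)
    (F : C(stdSimplex ℝ (Fin (m.unop.len + 1)), Fin n → ℂ)) :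
    (TopCat.toSSet.obj (Torus Γ)).obj m :=
  (TopCat.toSSetObjEquiv (Torus Γ) m).symm
    ⟨fun t => QuotientAddGroup.mk (F t), QuotientAddGroup.continuous_mk.comp F.continuous⟩

@[simp] lemma simplexMap_project {m : SimplexCategoryᵒᵖ}
    (F : C(stdSimplex ℝ (Fin (m.unop.len + 1)), Fin n → ℂ)) (t) :
    simplexMap (project Γ m F) t = QuotientAddGroup.mk (F t) := by
  simp [simplexMap, project]

lemma simplex_ext {m : SimplexCategoryᵒᵖ} {σ τ : (TopCat.toSSet.obj (Torus Γ)).obj m}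
    (h : ∀ t, simplexMap σ t = simplexMap τ t) : σ = τ :=
  (TopCat.toSSetObjEquiv (Torus Γ) m).injective (ContinuousMap.ext h)

lemma simplexMap_map {m k : SimplexCategoryᵒᵖ} (f : m ⟶ k)
    (σ : (TopCat.toSSet.obj (Torus Γ)).obj m) (t) :
    simplexMap ((TopCat.toSSet.obj (Torus Γ)).map f σ) t
      = simplexMap σ (stdSimplex.map f.unop t) := rfl

lemma project_eq_iff [DiscreteTopology Γ] {m : SimplexCategoryᵒᵖ}
    {F G : C(stdSimplex ℝ (Fin (m.unop.len + 1)), Fin n → ℂ)} :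
    project Γ m F = project Γ m G ↔ ∃ γ ∈ Γ, ∀ t, G t = F t + γ := by
  constructor
  · intro h
    refine exists_add_of_lifts_eq F.continuous G.continuous fun t => ?_
    rw [← simplexMap_project, h, simplexMap_project]
  · rintro ⟨γ, hγ, h⟩
    refine simplex_ext fun t => ?_
    rw [simplexMap_project, simplexMap_project, h t]
    exact QuotientAddGroup.eq.2 (by simpa using hγ)

lemma map_project {m k : SimplexCategoryᵒᵖ} (f : m ⟶ k)
    (F : C(stdSimplex ℝ (Fin (m.unop.len + 1)), Fin n → ℂ)) :
    (TopCat.toSSet.obj (Torus Γ)).map f (project Γ m F) =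
      project Γ k (F.comp ⟨_, stdSimplex.continuous_map f.unop⟩) := by
  refine simplex_ext fun t => ?_
  rw [simplexMap_map, simplexMap_project, simplexMap_project]; rfl

section

variable [DiscreteTopology Γ]

lemma exists_project_eq {m : SimplexCategoryᵒᵖ} (σ : (TopCat.toSSet.obj (Torus Γ)).obj m) :
    ∃ F, project Γ m F = σ := by
  obtain ⟨F, hF⟩ := exists_lift (simplexMap σ)
  exact ⟨F, simplex_ext fun t => by rw [simplexMap_project, hF]⟩

/-- A lift to `ℂⁿ` of a singular simplex of the torus. -/
def simplexLift {m : SimplexCategoryᵒᵖ} (σ : (TopCat.toSSet.obj (Torus Γ)).obj m) :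
    C(stdSimplex ℝ (Fin (m.unop.len + 1)), Fin n → ℂ) :=
  (exists_project_eq σ).choose

@[simp] lemma project_simplexLift {m : SimplexCategoryᵒᵖ}
    (σ : (TopCat.toSSet.obj (Torus Γ)).obj m) : project Γ m (simplexLift σ) = σ :=
  (exists_project_eq σ).choose_spec

/-- Lifts are chosen simplex by simplex, so they respect the simplicial structure only up to lattice
vectors. Every later construction must therefore be equivariant under translation by `Γ`. -/
lemma simplexLift_map {m k : SimplexCategoryᵒᵖ} (f : m ⟶ k)
    (σ : (TopCat.toSSet.obj (Torus Γ)).obj m) :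
    ∃ γ ∈ Γ, ∀ t, simplexLift ((TopCat.toSSet.obj (Torus Γ)).map f σ) t =
      simplexLift σ (stdSimplex.map f.unop t) + γ := by
  have h : project Γ k ((simplexLift σ).comp ⟨_, stdSimplex.continuous_map f.unop⟩) =
      project Γ k (simplexLift ((TopCat.toSSet.obj (Torus Γ)).map f σ)) := by
    rw [← map_project, project_simplexLift, project_simplexLift]
  exact project_eq_iff.1 h

/-! ### Straightening -/

/-- The vertices of a singular simplex in `ℂⁿ`. -/
def vertices {ι : Type} [Fintype ι] [DecidableEq ι] (F : C(stdSimplex ℝ ι, Fin n → ℂ)) :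
    ι → Fin n → ℂ := fun i => F (stdSimplex.vertex i)

/-- The linear homotopy from a simplex in `ℂⁿ` to the affine simplex with the same vertices,
at the time given by a map to the `1`-simplex. -/
def straightenAt {m : SimplexCategoryᵒᵖ}
    (F : C(stdSimplex ℝ (Fin (m.unop.len + 1)), Fin n → ℂ))
    (θ : (SSet.stdSimplex.{0}.obj (SimplexCategory.mk 1)).obj m) :
    C(stdSimplex ℝ (Fin (m.unop.len + 1)), Fin n → ℂ) where
  toFun t := F t + stdSimplex.map (SSet.stdSimplex.objEquiv θ) t (1 : Fin 2) •
    (baryPoint (vertices F) t - F t)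
  continuous_toFun := F.continuous.add (((continuous_stdSimplex_apply _).comp
    (stdSimplex.continuous_map _)).smul ((continuous_baryPoint _).sub F.continuous))

open MonoidalCategory in
/-- The linear homotopy from the identity to straightening, on singular simplices. -/
def straightenMap : TopCat.toSSet.obj (Torus Γ) ⊗ SSet.stdSimplex.obj (SimplexCategory.mk 1) ⟶
    TopCat.toSSet.obj (Torus Γ) where
  app m := ↾fun x => project Γ m (straightenAt (simplexLift x.1) x.2)
  naturality m k f := by
    ext x
    obtain ⟨γ, hγ, h⟩ := simplexLift_map f x.1
    change project Γ k (straightenAt (simplexLift ((TopCat.toSSet.obj (Torus Γ)).map f x.1))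
      ((SSet.stdSimplex.obj (SimplexCategory.mk 1)).map f x.2)) =
      (TopCat.toSSet.obj (Torus Γ)).map f (project Γ m (straightenAt (simplexLift x.1) x.2))
    rw [map_project, eq_comm, project_eq_iff]
    -- Barycentric coordinates sum to one, so translating the lift by `γ` translates its affine
    -- replacement, and with it the whole linear homotopy, by the same `γ`.
    refine ⟨γ, hγ, fun t => ?_⟩
    have hv : vertices (simplexLift ((TopCat.toSSet.obj (Torus Γ)).map f x.1)) =
        fun i => (vertices (simplexLift x.1) ∘ f.unop) i + γ := by
      funext i
      simp only [vertices, h, stdSimplex.map_vertex, Function.comp_apply]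
    simp only [straightenAt, ContinuousMap.coe_mk, ContinuousMap.comp_apply, hv, baryPoint_add,
      h, baryPoint_map]
    have hs : stdSimplex.map (SSet.stdSimplex.objEquiv
        ((SSet.stdSimplex.{0}.obj (SimplexCategory.mk 1)).map f x.2)) t =
        stdSimplex.map (SSet.stdSimplex.objEquiv x.2) (stdSimplex.map f.unop t) := by
      rw [stdSimplex.map_comp_apply]
      rfl
    rw [hs, add_sub_add_right_eq_sub]
    abel

/-- The simplicial map which replaces a singular simplex of the torus by the affine simplex with
the same vertices. -/
def straighten (Γ : AddSubgroup (Fin n → ℂ)) [DiscreteTopology Γ] :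
    TopCat.toSSet.obj (Torus Γ) ⟶ TopCat.toSSet.obj (Torus Γ) :=
  SSet.ι₁ ≫ straightenMap

/-- The affine singular simplex with given vertices. -/
def affineSimplex (Γ : AddSubgroup (Fin n → ℂ)) (m : SimplexCategoryᵒᵖ)
    (x : Fin (m.unop.len + 1) → Fin n → ℂ) : (TopCat.toSSet.obj (Torus Γ)).obj m :=
  project Γ m ⟨baryPoint x, continuous_baryPoint x⟩

lemma stdSimplex_map_const {ι : Type} [Fintype ι] (b : Fin 2) (t : stdSimplex ℝ ι) :
    stdSimplex.map (fun _ => b) t (1 : Fin 2) = if b = 1 then 1 else 0 := by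
  classical
  rw [stdSimplex.map_coe, FunOnFinite.linearMap_apply_apply]
  split_ifs with h
  · simp [h]
  · simp [h]

lemma straighten_app {m : SimplexCategoryᵒᵖ} (σ : (TopCat.toSSet.obj (Torus Γ)).obj m) :
    (straighten Γ).app m σ = affineSimplex Γ m (vertices (simplexLift σ)) := by
  change project Γ m (straightenAt (simplexLift σ) (SSet.stdSimplex.const 1 1 m)) = _
  rw [affineSimplex]
  congr 1
  ext1 t
  simp only [straightenAt, ContinuousMap.coe_mk]
  have := stdSimplex_map_const 1 t
  rw [if_pos rfl] at this
  erw [this]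
  simp

/-- Straightening is homotopic to the identity. -/
def straightenHomotopy (Γ : AddSubgroup (Fin n → ℂ)) [DiscreteTopology Γ] :
    SSet.Homotopy (𝟙 (TopCat.toSSet.obj (Torus Γ))) (straighten Γ) where
  h := straightenMap
  h₀ := by
    ext m σ
    change project Γ m (straightenAt (simplexLift σ) (SSet.stdSimplex.const 1 0 m)) = σ
    conv_rhs => rw [← project_simplexLift σ]
    congr 1
    ext1 t
    simp only [straightenAt, ContinuousMap.coe_mk]
    have := stdSimplex_map_const 0 t
    rw [if_neg (by simp)] at this
    erw [this]
    simp
  h₁ := rfl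
  -- The homotopy is relative to the empty subcomplex, so the condition is vacuous.
  rel := by ext _ ⟨⟨_, ⟨⟩⟩, _⟩

end

end

section

/-! ### Chains of tuples

The augmented complex of finite integral combinations of tuples of points of an abelian group. -/

section TupleChains

variable {V : Type*}

/-- Integral combinations of `m`-tuples. -/
abbrev TupleChain (V : Type*) (m : ℕ) : Type _ := (Fin m → V) →₀ ℤ

/-- The chain given by one tuple. -/
abbrev tuple {m : ℕ} (x : Fin m → V) : TupleChain V m := Finsupp.single x 1

lemma tupleChain_hom_ext {m : ℕ} {M : Type*} [AddCommGroup M] [Module ℤ M] {f g : TupleChain V m →ₗ[ℤ] M}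
    (h : ∀ x, f (tuple x) = g (tuple x)) : f = g :=
  Finsupp.lhom_ext' fun x => LinearMap.ext_ring (h x)

lemma linearCombination_single_one {R X M : Type*} [Ring R] [AddCommGroup M] [Module R M]
    (f : X → M) (x : X) : Finsupp.linearCombination R f (Finsupp.single x 1) = f x := by
  simp

/-- The boundary of a chain of tuples. -/
def tupleBoundary (V : Type*) (m : ℕ) : TupleChain V (m + 1) →ₗ[ℤ] TupleChain V m :=
  Finsupp.linearCombination ℤ fun x => ∑ i : Fin (m + 1), (-1 : ℤ) ^ (i : ℕ) •
    tuple (x ∘ i.succAbove)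

/-- The chain obtained by prepending the point `a`. -/
def tupleCone (a : V) (m : ℕ) : TupleChain V m →ₗ[ℤ] TupleChain V (m + 1) :=
  Finsupp.lmapDomain ℤ ℤ fun x => (Fin.cons a x : Fin (m + 1) → V)

@[simp] lemma tupleBoundary_tuple {m : ℕ} (x : Fin (m + 1) → V) : tupleBoundary V m (tuple x) =
    ∑ i : Fin (m + 1), (-1 : ℤ) ^ (i : ℕ) • tuple (x ∘ i.succAbove) := by
  simp [tupleBoundary]

@[simp] lemma tupleCone_tuple {m : ℕ} (a : V) (x : Fin m → V) :
    tupleCone a m (tuple x) = tuple (Fin.cons a x : Fin (m + 1) → V) := by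
  simp [tupleCone]

lemma tupleBoundary_one (x : Fin 1 → V) (y : Fin 0 → V) :
    tupleBoundary V 0 (tuple x) = tuple y := by
  rw [tupleBoundary_tuple, Fin.sum_univ_one, Fin.val_zero, pow_zero, one_smul,
    Subsingleton.elim y]

/-- Deleting the first entry returns `x`. All other faces keep `a` in front and have their index,
hence their sign, shifted by one. -/
lemma tupleBoundary_cons {m : ℕ} (a : V) (x : Fin (m + 1) → V) :
    tupleBoundary V (m + 1) (tuple (Fin.cons a x : Fin (m + 2) → V)) =
      tuple x - tupleCone a m (tupleBoundary V m (tuple x)) := by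
  rw [tupleBoundary_tuple, Fin.sum_univ_succ, tupleBoundary_tuple, map_sum, sub_eq_add_neg,
    ← Finset.sum_neg_distrib]
  congr 1
  · simp only [Fin.val_zero, pow_zero, one_smul]
    congr 1
  · refine Finset.sum_congr rfl fun i _ => ?_
    rw [map_smul, tupleCone_tuple, Fin.val_succ, pow_succ, mul_neg_one, neg_smul]
    congr 3
    funext j
    refine Fin.cases ?_ (fun j => ?_) j <;> simp

lemma tupleBoundary_cone {m : ℕ} (a : V) (c : TupleChain V (m + 1)) :
    tupleBoundary V (m + 1) (tupleCone a (m + 1) c) = c - tupleCone a m (tupleBoundary V m c) := by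
  have : tupleBoundary V (m + 1) ∘ₗ tupleCone a (m + 1) =
      LinearMap.id - tupleCone a m ∘ₗ tupleBoundary V m :=
    tupleChain_hom_ext fun x => by
      simp only [LinearMap.comp_apply, tupleCone_tuple, tupleBoundary_cons, LinearMap.sub_apply,
        LinearMap.id_apply]
  exact LinearMap.congr_fun this c

lemma tupleChain_cons_ext {m : ℕ} {M : Type*} [AddCommGroup M]
    {f g : TupleChain V (m + 1) →ₗ[ℤ] M}
    (h : ∀ a (x : Fin m → V), f (tuple (Fin.cons a x : Fin (m + 1) → V)) =
      g (tuple (Fin.cons a x : Fin (m + 1) → V))) : f = g :=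
  tupleChain_hom_ext fun x => by
    simpa only [Fin.cons_self_tail] using h (x 0) (Fin.tail x)

/-- With the cone formula, `∂∂(a x) = ∂x - ∂(a ∂x) = a ∂∂x`, which vanishes by induction. -/
lemma tupleBoundary_boundary {m : ℕ} (c : TupleChain V (m + 2)) :
    tupleBoundary V m (tupleBoundary V (m + 1) c) = 0 := by
  suffices h : tupleBoundary V m ∘ₗ tupleBoundary V (m + 1) = 0 from LinearMap.congr_fun h c
  clear c
  induction m with
  | zero =>
    refine tupleChain_hom_ext fun x => ?_
    rw [LinearMap.comp_apply, tupleBoundary_tuple, Fin.sum_univ_two, map_add, map_smul, map_smul,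
      tupleBoundary_one _ Fin.elim0, tupleBoundary_one _ Fin.elim0]
    simp
  | succ m ih =>
    refine tupleChain_cons_ext fun a x => ?_
    have h := LinearMap.congr_fun ih (tuple x)
    simp only [LinearMap.comp_apply, LinearMap.zero_apply] at h
    simp only [LinearMap.comp_apply, tupleBoundary_cons, map_sub, tupleBoundary_cone, h,
      LinearMap.zero_apply, map_zero, sub_zero, sub_self]

variable [AddCommGroup V]

/-- Translation of chains of tuples. -/
def tupleShift (v : V) (m : ℕ) : TupleChain V m →ₗ[ℤ] TupleChain V m :=
  Finsupp.lmapDomain ℤ ℤ fun x i => x i + v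

/-- The prism over a tuple, in the direction `v`. -/
def prismTuple (v : V) : (m : ℕ) → (Fin m → V) → TupleChain V (m + 1)
  | 0, _ => 0
  | m + 1, x => tuple (Fin.cons (x 0) fun i => x i + v) -
      tupleCone (x 0) (m + 1) (prismTuple v m (Fin.tail x))

/-- The prism over a chain of tuples. -/
def prism (v : V) (m : ℕ) : TupleChain V m →ₗ[ℤ] TupleChain V (m + 1) :=
  Finsupp.linearCombination ℤ (prismTuple v m)

@[simp] lemma tupleShift_tuple {m : ℕ} (v : V) (x : Fin m → V) :
    tupleShift v m (tuple x) = tuple fun i => x i + v := by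
  simp [tupleShift]

@[simp] lemma prism_tuple {m : ℕ} (v : V) (x : Fin m → V) :
    prism v m (tuple x) = prismTuple v m x := by
  simp [prism]

lemma prism_zero (v : V) (c : TupleChain V 0) : prism v 0 c = 0 := by
  have : prism v 0 = 0 := tupleChain_hom_ext fun x => by simp [prismTuple]
  rw [this]; rfl

/-- Unwinding this recursion gives the usual prism `∑ (-1)^j (x₀, …, x_j, x_j + v, …, x_m + v)`. The
recursive form lets the cone identities replace the bookkeeping of indices. -/
lemma prism_cons {m : ℕ} (v a : V) (x : Fin m → V) :
    prism v (m + 1) (tuple (Fin.cons a x : Fin (m + 1) → V)) =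
      tupleCone a (m + 1) (tupleShift v (m + 1) (tuple (Fin.cons a x : Fin (m + 1) → V))) -
      tupleCone a (m + 1) (prism v m (tuple x)) := by
  simp [prismTuple]

lemma tupleBoundary_shift {m : ℕ} (v : V) (c : TupleChain V (m + 1)) :
    tupleBoundary V m (tupleShift v (m + 1) c) = tupleShift v m (tupleBoundary V m c) := by
  have : tupleBoundary V m ∘ₗ tupleShift v (m + 1) = tupleShift v m ∘ₗ tupleBoundary V m :=
    tupleChain_hom_ext fun x => by
      simp only [LinearMap.comp_apply, tupleShift_tuple, tupleBoundary_tuple, map_sum, map_smul]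
      rfl
  exact LinearMap.congr_fun this c

lemma tupleShift_cone {m : ℕ} (v a : V) (c : TupleChain V m) :
    tupleShift v (m + 1) (tupleCone a m c) = tupleCone (a + v) m (tupleShift v m c) := by
  have : tupleShift v (m + 1) ∘ₗ tupleCone a m = tupleCone (a + v) m ∘ₗ tupleShift v m :=
    tupleChain_hom_ext fun x => by
      simp only [LinearMap.comp_apply, tupleShift_tuple, tupleCone_tuple]
      congr 1
      funext i
      refine Fin.cases ?_ (fun i => ?_) i <;> simp
  exact LinearMap.congr_fun this c

lemma tupleShift_add {m : ℕ} (v w : V) (c : TupleChain V m) :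
    tupleShift v m (tupleShift w m c) = tupleShift (w + v) m c := by
  have : tupleShift v m ∘ₗ tupleShift w m = tupleShift (w + v) m :=
    tupleChain_hom_ext fun x => by simp [add_assoc]
  exact LinearMap.congr_fun this c

lemma tupleShift_zero {m : ℕ} (c : TupleChain V m) : tupleShift 0 m c = c := by
  have : tupleShift (0 : V) m = LinearMap.id :=
    tupleChain_hom_ext fun x => by simp
  exact LinearMap.congr_fun this c

lemma prism_shift {m : ℕ} (v w : V) (c : TupleChain V m) :
    prism v m (tupleShift w m c) = tupleShift w (m + 1) (prism v m c) := by
  suffices h : prism v m ∘ₗ tupleShift w m = tupleShift w (m + 1) ∘ₗ prism v m from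
    LinearMap.congr_fun h c
  clear c
  induction m with
  | zero => exact LinearMap.ext fun c => by simp [prism_zero]
  | succ m ih =>
    refine tupleChain_cons_ext fun a x => ?_
    have h := LinearMap.congr_fun ih (tuple x)
    simp only [LinearMap.comp_apply] at h
    simp only [LinearMap.comp_apply]
    rw [← tupleCone_tuple, tupleShift_cone, tupleShift_tuple, tupleCone_tuple, prism_cons,
      ← tupleShift_tuple, h, ← tupleCone_tuple, ← tupleShift_tuple, ← tupleShift_cone,
      tupleCone_tuple, prism_cons, map_sub, tupleShift_cone, tupleShift_cone, tupleShift_add,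
      tupleShift_add, add_comm v w]

lemma tupleBoundary_prism_one (v : V) (c : TupleChain V 1) :
    tupleBoundary V 1 (prism v 1 c) = tupleShift v 1 c - c := by
  suffices h : tupleBoundary V 1 ∘ₗ prism v 1 = tupleShift v 1 - LinearMap.id from
    LinearMap.congr_fun h c
  refine tupleChain_cons_ext fun a x => ?_
  rw [LinearMap.comp_apply, prism_cons, prism_zero, map_zero, sub_zero, tupleBoundary_cone,
    tupleShift_tuple, tupleBoundary_one _ x, tupleCone_tuple, LinearMap.sub_apply,
    LinearMap.id_apply, tupleShift_tuple]

/-- The prism is a chain homotopy from the identity to the translation by `v`. The induction on the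
length of tuples applies the cone formula to both terms of `prism_cons`. -/
lemma tupleBoundary_prism {m : ℕ} (v : V) (c : TupleChain V (m + 1)) :
    tupleBoundary V (m + 1) (prism v (m + 1) c) =
      tupleShift v (m + 1) c - c - prism v m (tupleBoundary V m c) := by
  induction m with
  | zero => rw [prism_zero, sub_zero]; exact tupleBoundary_prism_one v c
  | succ m ih =>
    suffices h : tupleBoundary V (m + 2) ∘ₗ prism v (m + 2) =
        tupleShift v (m + 2) - LinearMap.id - prism v (m + 1) ∘ₗ tupleBoundary V (m + 1) from
      LinearMap.congr_fun h c
    have hp (a : V) (y : TupleChain V m) : prism v (m + 1) (tupleCone a m y) =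
        tupleCone a (m + 1) (tupleShift v (m + 1) (tupleCone a m y)) -
          tupleCone a (m + 1) (prism v m y) := by
      have : prism v (m + 1) ∘ₗ tupleCone a m =
          tupleCone a (m + 1) ∘ₗ tupleShift v (m + 1) ∘ₗ tupleCone a m -
          tupleCone a (m + 1) ∘ₗ prism v m :=
        tupleChain_hom_ext fun x => by
          simp only [LinearMap.comp_apply, tupleCone_tuple, prism_cons, LinearMap.sub_apply]
      exact LinearMap.congr_fun this y
    refine tupleChain_cons_ext fun a x => ?_
    simp only [LinearMap.comp_apply, LinearMap.sub_apply, LinearMap.id_apply]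
    rw [prism_cons, map_sub, tupleBoundary_cone, tupleBoundary_cone, tupleBoundary_shift,
      tupleBoundary_cons, ih, map_sub (prism v (m + 1)), hp]
    simp only [map_sub]
    rw [← tupleCone_tuple]
    abel

end TupleChains

end

section

/-! ### Chains modulo a group of translations. -/

section TupleChains

variable {V : Type*} [AddCommGroup V]

/-- The chains which vanish after passing to the quotient by the translations in `H`. -/
def shiftRelations (H : AddSubgroup V) (m : ℕ) : Submodule ℤ (TupleChain V m) :=
  Submodule.span ℤ {c | ∃ γ ∈ H, ∃ x : Fin m → V, c = tupleShift γ m (tuple x) - tuple x}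

lemma shift_sub_mem (H : AddSubgroup V) {m : ℕ} {γ : V} (hγ : γ ∈ H) (c : TupleChain V m) :
    tupleShift γ m c - c ∈ shiftRelations H m := by
  induction c using Finsupp.induction_linear with
  | zero => simp
  | add f g hf hg => rw [map_add, add_sub_add_comm]; exact add_mem hf hg
  | single x a =>
    have : (Finsupp.single x a : TupleChain V m) = a • tuple x := by simp
    rw [this, map_smul, ← smul_sub]
    exact Submodule.smul_mem _ _ (Submodule.subset_span ⟨γ, hγ, x, rfl⟩)

lemma shiftRelations_mono {H K : AddSubgroup V} (h : H ≤ K) (m : ℕ) :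
    shiftRelations H m ≤ shiftRelations K m :=
  Submodule.span_mono fun _ ⟨γ, hγ, x, hx⟩ => ⟨γ, h hγ, x, hx⟩

lemma map_mem_shiftRelations (H : AddSubgroup V) {m k : ℕ}
    (f : TupleChain V m →ₗ[ℤ] TupleChain V k)
    (hf : ∀ γ c, f (tupleShift γ m c) = tupleShift γ k (f c)) {c : TupleChain V m}
    (hc : c ∈ shiftRelations H m) : f c ∈ shiftRelations H k := by
  induction hc using Submodule.span_induction with
  | mem c hc =>
    obtain ⟨γ, hγ, x, rfl⟩ := hc
    rw [map_sub, hf]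
    exact shift_sub_mem H hγ _
  | zero => simp
  | add x y _ _ hx hy => rw [map_add]; exact add_mem hx hy
  | smul a x _ hx => rw [map_smul]; exact Submodule.smul_mem _ _ hx

lemma boundary_mem_shiftRelations {H : AddSubgroup V} {m : ℕ} {c : TupleChain V (m + 1)}
    (hc : c ∈ shiftRelations H (m + 1)) : tupleBoundary V m c ∈ shiftRelations H m :=
  map_mem_shiftRelations H _ (fun _ _ => tupleBoundary_shift _ _) hc

lemma prism_mem_shiftRelations {H : AddSubgroup V} {m : ℕ} (v : V) {c : TupleChain V m}
    (hc : c ∈ shiftRelations H m) : prism v m c ∈ shiftRelations H (m + 1) :=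
  map_mem_shiftRelations H _ (fun _ _ => prism_shift _ _ _) hc

lemma shift_mem_shiftRelations {H : AddSubgroup V} {m : ℕ} (v : V) {c : TupleChain V m}
    (hc : c ∈ shiftRelations H m) : tupleShift v m c ∈ shiftRelations H m :=
  map_mem_shiftRelations H _ (fun _ _ => by rw [tupleShift_add, tupleShift_add, add_comm]) hc

lemma map_eq_zero_of_mem_shiftRelations {H : AddSubgroup V} {m : ℕ} {M : Type*} [AddCommGroup M]
    [Module ℤ M] (f : TupleChain V m →ₗ[ℤ] M) (hf : ∀ γ ∈ H, ∀ x, f (tuple fun i => x i + γ) = f (tuple x))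
    {c : TupleChain V m} (hc : c ∈ shiftRelations H m) : f c = 0 := by
  induction hc using Submodule.span_induction with
  | mem c hc =>
    obtain ⟨γ, hγ, x, rfl⟩ := hc
    rw [map_sub, tupleShift_tuple, hf γ hγ, sub_self]
  | zero => simp
  | add x y _ _ hx hy => rw [map_add, hx, hy, add_zero]
  | smul a x _ hx => exact (map_zsmul f a x).trans (by rw [hx, zsmul_zero])

/-- The diagonal translations of `m`-tuples by elements of `H`. -/
def diagonal (H : AddSubgroup V) (m : ℕ) : AddSubgroup (Fin m → V) :=
  H.map (AddMonoidHom.mk' (fun v _ => v) fun _ _ => rfl)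

lemma mem_diagonal {H : AddSubgroup V} {m : ℕ} {x : Fin m → V} :
    x ∈ diagonal H m ↔ ∃ γ ∈ H, (fun _ => γ) = x := Iff.rfl

/-- Reduction of chains modulo translations by elements of `H`. -/
def reduceChain (H : AddSubgroup V) (m : ℕ) :
    TupleChain V m →ₗ[ℤ] (((Fin m → V) ⧸ diagonal H m) →₀ ℤ) :=
  Finsupp.lmapDomain ℤ ℤ QuotientAddGroup.mk

/-- For the converse, replace each tuple by a fixed representative of its class. The change is a sum
of relations, and a chain with zero reduction is replaced by zero. -/
lemma mem_shiftRelations_iff {H : AddSubgroup V} {m : ℕ} {c : TupleChain V m} :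
    c ∈ shiftRelations H m ↔ reduceChain H m c = 0 := by
  constructor
  · refine map_eq_zero_of_mem_shiftRelations _ fun γ hγ x => ?_
    simp only [reduceChain, Finsupp.lmapDomain_apply, Finsupp.mapDomain_single]
    congr 1
    refine (QuotientAddGroup.eq.2 ⟨-γ, neg_mem hγ, ?_⟩)
    funext i
    simp
  · intro h
    have key : ∀ c : TupleChain V m, c - Finsupp.lmapDomain ℤ ℤ Quotient.out (reduceChain H m c) ∈
        shiftRelations H m := by
      intro c
      induction c using Finsupp.induction_linear with
      | zero => simp
      | add f g hf hg => rw [map_add, map_add, add_sub_add_comm]; exact add_mem hf hg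
      | single x a =>
        have : (Finsupp.single x a : TupleChain V m) = a • tuple x := by simp
        rw [this, map_smul, map_smul, ← smul_sub]
        refine Submodule.smul_mem _ _ ?_
        simp only [reduceChain, Finsupp.lmapDomain_apply, Finsupp.mapDomain_single]
        obtain ⟨γ, hγ, hx⟩ := mem_diagonal.1 (QuotientAddGroup.eq.1
          (QuotientAddGroup.out_eq' (QuotientAddGroup.mk x : (Fin m → V) ⧸ diagonal H m)))
        refine Submodule.subset_span ⟨γ, hγ, Quotient.out (QuotientAddGroup.mk x :
          (Fin m → V) ⧸ diagonal H m), ?_⟩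
        rw [tupleShift_tuple]
        congr 2
        funext i
        have := congrFun hx i
        rw [this]
        simp
    simpa [h] using key c

/-- A translation of infinite order modulo `H` acts without fixed points on chains modulo `H`. -/
lemma mem_shiftRelations_of_shift_sub_mem {H : AddSubgroup V} {m : ℕ} {t : V}
    (ht : ∀ k : ℤ, k • t ∈ H → k = 0) {c : TupleChain V (m + 1)}
    (hc : tupleShift t (m + 1) c - c ∈ shiftRelations H (m + 1)) :
    c ∈ shiftRelations H (m + 1) := by
  rw [mem_shiftRelations_iff] at hc ⊢
  set u := reduceChain H (m + 1) c
  let s : (Fin (m + 1) → V) ⧸ diagonal H (m + 1) := QuotientAddGroup.mk fun _ => t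
  have hcomm : reduceChain H (m + 1) ∘ₗ tupleShift t (m + 1) =
      Finsupp.lmapDomain ℤ ℤ (· + s) ∘ₗ reduceChain H (m + 1) :=
    tupleChain_hom_ext fun x => by
      simp only [LinearMap.comp_apply, tupleShift_tuple, reduceChain, Finsupp.lmapDomain_apply,
        Finsupp.mapDomain_single]
      rfl
  have hu : Finsupp.mapDomain (· + s) u = u := by
    have := LinearMap.congr_fun hcomm c
    simp only [LinearMap.comp_apply] at this
    rw [map_sub, this, sub_eq_zero] at hc
    exact hc
  have hstep : ∀ y, u (y + s) = u y := fun y => by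
    conv_lhs => rw [← hu]
    exact Finsupp.mapDomain_apply (add_left_injective s) u y
  have hnat : ∀ (k : ℕ) y, u (y + k • s) = u y := by
    intro k
    induction k with
    | zero => simp
    | succ k ih => intro y; rw [succ_nsmul, ← add_assoc, hstep, ih]
  ext y
  by_contra hy
  -- The reduced chain is invariant under `s`; if it is nonzero at `y`, it is nonzero on the orbit
  -- `y + k • s`. That orbit is infinite, whereas the support is finite.
  refine Set.infinite_of_injective_forall_mem (f := fun k : ℕ => y + k • s)
    (fun k l hkl => ?_) (fun k => ?_) u.support.finite_toSet
  · have h1 : k • s = l • s := add_left_cancel hkl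
    have h2 : ((k : ℤ) - l) • s = 0 := by rw [sub_smul, natCast_zsmul, natCast_zsmul, h1, sub_self]
    have h3 : (QuotientAddGroup.mk (((k : ℤ) - l) • fun _ : Fin (m + 1) => t) :
      (Fin (m + 1) → V) ⧸ diagonal H (m + 1)) = 0 := h2
    obtain ⟨γ, hγ, hx⟩ := mem_diagonal.1 ((QuotientAddGroup.eq_zero_iff _).1 h3)
    -- Reading off entry `0` requires nonempty tuples, whence the length `m + 1`.
    have := ht ((k : ℤ) - l) (by have := congrFun hx 0; simp only [Pi.smul_apply] at this; rwa [← this])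
    omega
  · simp only [Finset.mem_coe, Finsupp.mem_support_iff, hnat]
    exact hy

/-- For every integer `k`, of either sign, the operator `T^k - 1` factors through `T - 1`, where `T`
is the translation by `t`. A relation for `a + k • t` splits into one for `a` and one for `k • t`.
-/
lemma exists_of_mem_shiftRelations_sup {H : AddSubgroup V} {m : ℕ} (t : V) {c : TupleChain V m}
    (hc : c ∈ shiftRelations (H ⊔ AddSubgroup.zmultiples t) m) :
    ∃ y, c - (tupleShift t m y - y) ∈ shiftRelations H m := by
  suffices h : shiftRelations (H ⊔ AddSubgroup.zmultiples t) m ≤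
      shiftRelations H m ⊔ LinearMap.range (tupleShift t m - LinearMap.id) by
    obtain ⟨a, ha, b, ⟨y, rfl⟩, rfl⟩ := Submodule.mem_sup.1 (h hc)
    exact ⟨y, by simpa using ha⟩
  have hz : ∀ (k : ℤ) (c : TupleChain V m), tupleShift (k • t) m c - c ∈
      LinearMap.range (tupleShift t m - LinearMap.id) := by
    intro k
    induction k using Int.induction_on with
    | zero => intro c; rw [zero_smul, tupleShift_zero, sub_self]; exact zero_mem _
    | succ k ih =>
      intro c
      have : tupleShift (((k : ℤ) + 1) • t) m c - c =
        (tupleShift t m - LinearMap.id : _ →ₗ[ℤ] _) (tupleShift ((k : ℤ) • t) m c) +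
          (tupleShift ((k : ℤ) • t) m c - c) := by
        rw [LinearMap.sub_apply, tupleShift_add, add_smul, one_smul, LinearMap.id_apply]; abel
      rw [this]
      exact add_mem ⟨_, rfl⟩ (ih c)
    | pred k ih =>
      intro c
      have : tupleShift ((-(k : ℤ) - 1) • t) m c - c =
        -(tupleShift t m - LinearMap.id : _ →ₗ[ℤ] _) (tupleShift ((-(k : ℤ) - 1) • t) m c) +
          (tupleShift ((-(k : ℤ)) • t) m c - c) := by
        rw [LinearMap.sub_apply, tupleShift_add, sub_smul, one_smul, LinearMap.id_apply,
          sub_add_cancel]; abel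
      rw [this]
      exact add_mem (neg_mem ⟨_, rfl⟩) (ih c)
  refine Submodule.span_le.2 ?_
  rintro _ ⟨γ, hγ, x, rfl⟩
  obtain ⟨a, ha, b, ⟨k, rfl⟩, rfl⟩ := AddSubgroup.mem_sup.1 hγ
  have : tupleShift (a + k • t) m (tuple x) - tuple x =
    (tupleShift a m (tupleShift (k • t) m (tuple x)) - tupleShift (k • t) m (tuple x)) +
      (tupleShift (k • t) m (tuple x) - tuple x) := by
    rw [tupleShift_add, add_comm a]; abel
  change tupleShift (a + k • t) m (tuple x) - tuple x ∈ _
  rw [this]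
  exact Submodule.add_mem_sup (shift_sub_mem H ha _) (hz k _)

/-! ### Cycles modulo translations -/

/-- A chain of `m + 1`-tuples, that is, of `m`-simplices, is a cycle modulo `H`. -/
def IsCycleMod (H : AddSubgroup V) : (m : ℕ) → TupleChain V (m + 1) → Prop
  | 0, _ => True
  | m + 1, c => tupleBoundary V (m + 1) c ∈ shiftRelations H (m + 1)

/-- The chain of simplices of the parallelepiped spanned by a sequence of vectors. -/
def boxChain : (m : ℕ) → (Fin m → V) → TupleChain V (m + 1)
  | 0, _ => tuple 0
  | m + 1, v => prism (v (Fin.last m)) (m + 1) (boxChain m (Fin.init v))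

/-- The second assertion is what the induction needs, since `∂P = T - 1 - P∂` involves the prism
over the boundary. In degree zero the augmented boundary of a point is not zero, but the prism over
the empty tuple is. -/
lemma isCycleMod_boxChain {H : AddSubgroup V} {m : ℕ} {v : Fin m → V} (hv : ∀ i, v i ∈ H) :
    IsCycleMod H m (boxChain m v) ∧
      ∀ t, prism t m (tupleBoundary V m (boxChain m v)) ∈ shiftRelations H (m + 1) := by
  induction m with
  | zero => exact ⟨trivial, fun t => by rw [prism_zero]; exact zero_mem _⟩
  | succ m ih =>
    have h : tupleBoundary V (m + 1) (boxChain (m + 1) v) ∈ shiftRelations H (m + 1) := by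
      rw [boxChain, tupleBoundary_prism]
      exact sub_mem (shift_sub_mem H (hv _) _) ((ih fun i => hv _).2 _)
    exact ⟨h, fun t => prism_mem_shiftRelations t h⟩

variable {N : ℕ} (e : Fin N → V)

/-- The subgroup generated by the vectors `e i` with `i < j`. -/
def partialLattice (j : ℕ) : AddSubgroup V := AddSubgroup.closure (e '' {i | (i : ℕ) < j})

/-- The span of the parallelepipeds on the `m`-subsets of the `e i` with `i < j`. -/
def boxSpan (j m : ℕ) : Submodule ℤ (TupleChain V (m + 1)) :=
  Submodule.span ℤ {c | ∃ I : Fin m → Fin N, StrictMono I ∧ (∀ r, (I r : ℕ) < j) ∧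
    c = boxChain m (e ∘ I)}

variable {e}

lemma mem_partialLattice {j : ℕ} {i : Fin N} (h : (i : ℕ) < j) : e i ∈ partialLattice e j :=
  AddSubgroup.subset_closure ⟨i, h, rfl⟩

lemma partialLattice_succ (j : Fin N) : partialLattice e (j + 1) =
    partialLattice e j ⊔ AddSubgroup.zmultiples (e j) := by
  rw [partialLattice, partialLattice, AddSubgroup.zmultiples_eq_closure,
    ← AddSubgroup.closure_union]
  congr 1
  ext x
  simp only [Set.mem_image, Set.mem_ofPred_eq, Set.mem_union, Set.mem_singleton_iff]
  constructor
  · rintro ⟨i, hi, rfl⟩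
    rcases Nat.lt_succ_iff_lt_or_eq.1 hi with h | h
    · exact Or.inl ⟨i, h, rfl⟩
    · exact Or.inr (by rw [Fin.ext h])
  · rintro (⟨i, hi, rfl⟩ | rfl)
    · exact ⟨i, by omega, rfl⟩
    · exact ⟨j, by omega, rfl⟩

lemma zsmul_notMem_partialLattice (he : LinearIndependent ℤ e) (j : Fin N) (k : ℤ)
    (hk : k • e j ∈ partialLattice e j) : k = 0 := by
  refine he.eq_zero_of_smul_mem_span j k
    (Submodule.span_mono (s := e '' {i | (i : ℕ) < j}) (Set.image_mono fun i hi => ?_) ?_)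
  · exact ⟨trivial, fun h => lt_irrefl _ (show (j : ℕ) < j from (congrArg Fin.val h) ▸ hi)⟩
  · rw [← Submodule.mem_toAddSubgroup, Submodule.span_int_eq_addSubgroupClosure]; exact hk

lemma boxSpan_mono {j m : ℕ} : boxSpan e j m ≤ boxSpan e (j + 1) m :=
  Submodule.span_mono fun _ ⟨I, h1, h2, h3⟩ => ⟨I, h1, fun r => (h2 r).trans (Nat.lt_succ_self j), h3⟩

/-- All indices in use are smaller than `j`, so appending `j` at the end keeps the sequence strictly
increasing. -/
lemma prism_mem_boxSpan (j : Fin N) {m : ℕ} {c : TupleChain V (m + 1)} (hc : c ∈ boxSpan e j m) :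
    prism (e j) (m + 1) c ∈ boxSpan e (j + 1) (m + 1) := by
  induction hc using Submodule.span_induction with
  | mem c hc =>
    obtain ⟨I, h1, h2, rfl⟩ := hc
    refine Submodule.subset_span ⟨Fin.snoc I j, ?_, ?_, ?_⟩
    · intro a b hab
      refine Fin.lastCases ?_ (fun b hab => ?_) b hab
      · intro hab
        obtain ⟨a, rfl⟩ := Fin.exists_castSucc_eq.2 hab.ne
        simpa using h2 a
      · obtain ⟨a, rfl⟩ := Fin.exists_castSucc_eq.2 (hab.trans (Fin.castSucc_lt_last b)).ne
        simpa using h1 (Fin.castSucc_lt_castSucc_iff.1 hab)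
    · intro r
      refine Fin.lastCases ?_ (fun r => ?_) r
      · simp
      · simpa using (h2 r).trans (Nat.lt_succ_self _)
    · rw [boxChain]
      congr 2
      · simp
      · congr 1
        funext r
        simp
  | zero => simp
  | add x y _ _ hx hy => rw [map_add]; exact add_mem hx hy
  | smul a x _ hx => rw [map_smul]; exact Submodule.smul_mem _ _ hx

lemma prism_boundary_mem {j m : ℕ} {c : TupleChain V (m + 1)} (hc : c ∈ boxSpan e j m) (t : V) :
    prism t m (tupleBoundary V m c) ∈ shiftRelations (partialLattice e j) (m + 1) := by
  induction hc using Submodule.span_induction with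
  | mem c hc =>
    obtain ⟨I, h1, h2, rfl⟩ := hc
    exact (isCycleMod_boxChain fun i => mem_partialLattice (h2 i)).2 t
  | zero => simp
  | add x y _ _ hx hy => simp only [map_add]; exact add_mem hx hy
  | smul a x _ hx => simp only [map_smul]; exact Submodule.smul_mem _ _ hx

/-- Modulo boundaries and translations in the lattice, each cycle is a combination of
parallelepipeds. -/
theorem exists_boxSpan_of_isCycleMod (he : LinearIndependent ℤ e) {j : ℕ} (hj : j ≤ N) {m : ℕ}
    {z : TupleChain V (m + 1)} (hz : IsCycleMod (partialLattice e j) m z) :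
    ∃ g ∈ boxSpan e j m, ∃ u, z - g - tupleBoundary V (m + 1) u ∈
      shiftRelations (partialLattice e j) (m + 1) := by
  induction j generalizing m z with
  | zero =>
    have hbot : ∀ m, shiftRelations (partialLattice e 0) m = ⊥ := by
      intro m
      rw [shiftRelations, Submodule.span_eq_bot]
      rintro _ ⟨γ, hγ, x, rfl⟩
      have : γ = 0 := by simpa [partialLattice] using hγ
      rw [this, tupleShift_zero, sub_self]
    -- With no translations, the cone over `z` from the origin bounds `z` up to the cone over `∂z`.
    -- The latter vanishes in positive degree; in degree zero it is a multiple of the point `0`, the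
    -- parallelepiped of dimension zero.
    refine ⟨tupleCone 0 m (tupleBoundary V m z), ?_, tupleCone 0 (m + 1) z, ?_⟩
    · cases m with
      | zero =>
        have : ∀ c : TupleChain V 0, tupleCone (0 : V) 0 c ∈ boxSpan e 0 0 := by
          intro c
          induction c using Finsupp.induction_linear with
          | zero => simp
          | add f g hf hg => rw [map_add]; exact add_mem hf hg
          | single x a =>
            have : (Finsupp.single x a : TupleChain V 0) = a • tuple x := by simp
            rw [this, map_smul]
            refine Submodule.smul_mem _ _ (Submodule.subset_span
              ⟨Fin.elim0, fun i => i.elim0, fun i => i.elim0, ?_⟩)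
            rw [tupleCone_tuple, boxChain]
            congr 1
            funext i
            refine Fin.cases ?_ (fun i => i.elim0) i
            simp
        exact this _
      | succ m =>
        have : tupleBoundary V (m + 1) z ∈ shiftRelations (partialLattice e 0) (m + 1) := hz
        have h0 : tupleBoundary V (m + 1) z = 0 := by
          rwa [hbot, Submodule.mem_bot] at this
        rw [h0, map_zero]
        exact zero_mem _
    · rw [tupleBoundary_cone, sub_self]
      exact zero_mem _
  | succ j ih =>
    have hj' : j < N := hj
    have hP : partialLattice e (j + 1) = _ := partialLattice_succ ⟨j, hj'⟩
    simp only at hP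
    cases m with
    | zero =>
      obtain ⟨g, hg, u, h⟩ := ih hj'.le (m := 0) (z := z) trivial
      refine ⟨g, boxSpan_mono hg, u, shiftRelations_mono ?_ _ h⟩
      rw [hP]; exact le_sup_left
    | succ m =>
      rw [hP] at hz
      -- Modulo the smaller lattice, `∂z = (T - 1) y` with `T` the translation by the new generator.
      -- The chain `y` plays the role of the factor of `z` transverse to that generator, as in the
      -- Wang sequence of a circle direction.
      obtain ⟨y, hy⟩ := exists_of_mem_shiftRelations_sup _ hz
      have hyc : IsCycleMod (partialLattice e j) m y := by
        cases m with
        | zero => trivial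
        | succ m =>
          -- Applying `∂` gives `(T - 1) ∂y = 0` modulo the smaller lattice, and `T - 1` is
          -- injective there because no nonzero multiple of the new generator lies in that lattice.
          refine mem_shiftRelations_of_shift_sub_mem
            (zsmul_notMem_partialLattice he ⟨j, hj'⟩) ?_
          have := boundary_mem_shiftRelations hy
          rw [map_sub, tupleBoundary_boundary, zero_sub, map_sub, tupleBoundary_shift] at this
          exact (neg_mem_iff.1 this)
      obtain ⟨g, hg, u, hr⟩ := ih hj'.le hyc
      set t := e ⟨j, hj'⟩
      -- Here `y = g + ∂u` modulo the smaller lattice. Subtracting the prism over `g` and `(T - 1)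
      -- u` from `z` removes the boundary `(T - 1) y`, so induction applies again. The term `(T - 1)
      -- u` is itself a relation for the larger lattice.
      have hz' : IsCycleMod (partialLattice e j) (m + 1)
          (z - prism t (m + 1) g - (tupleShift t (m + 2) u - u)) := by
        change tupleBoundary V (m + 1) _ ∈ _
        rw [map_sub, map_sub, tupleBoundary_prism, map_sub, tupleBoundary_shift]
        have h1 := prism_boundary_mem hg t
        have h2 := sub_mem (shift_mem_shiftRelations t hr) hr
        have h3 := add_mem (add_mem hy h2) h1
        convert h3 using 1
        simp only [map_sub]
        abel
      obtain ⟨g', hg', u', hr'⟩ := ih hj'.le hz'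
      refine ⟨prism t (m + 1) g + g', add_mem (prism_mem_boxSpan ⟨j, hj'⟩ hg) (boxSpan_mono hg'),
        u', ?_⟩
      have h1 := shiftRelations_mono (show partialLattice e j ≤ partialLattice e (j + 1) by
        rw [hP]; exact le_sup_left) _ hr'
      have h2 := shift_sub_mem (partialLattice e (j + 1))
        (mem_partialLattice (e := e) (i := ⟨j, hj'⟩) (Nat.lt_succ_self j)) u
      convert add_mem h1 h2 using 1
      abel

end TupleChains

end

section

/-! ### The cocycle of an alternating form -/

section Cocycle

variable {V : Type*} [AddCommGroup V] [Module ℝ V]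

/-- The value of an alternating form on the edge vectors of simplices. -/
def edgeCochain {m : ℕ} (w : V [⋀^Fin m]→ₗ[ℝ] ℂ) : TupleChain V (m + 1) →ₗ[ℤ] ℂ :=
  Finsupp.linearCombination ℤ fun x => w fun i => x i.succ - x i.castSucc

@[simp] lemma edgeCochain_tuple {m : ℕ} (w : V [⋀^Fin m]→ₗ[ℝ] ℂ) (x : Fin (m + 1) → V) :
    edgeCochain w (tuple x) = w fun i => x i.succ - x i.castSucc := by
  simp [edgeCochain]

lemma edgeCochain_add_const {m : ℕ} (w : V [⋀^Fin m]→ₗ[ℝ] ℂ) (x : Fin (m + 1) → V) (γ : V) :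
    edgeCochain w (tuple fun i => x i + γ) = edgeCochain w (tuple x) := by
  simp

lemma edgeCochain_cons {m : ℕ} (w : V [⋀^Fin (m + 1)]→ₗ[ℝ] ℂ) (a : V) (x : Fin (m + 1) → V) :
    edgeCochain w (tuple (Fin.cons a x : Fin (m + 2) → V)) =
      edgeCochain (w.curryLeft (x 0 - a)) (tuple x) := by
  rw [edgeCochain_tuple, edgeCochain_tuple, AlternatingMap.curryLeft_apply_apply]
  congr 1
  funext i
  refine Fin.cases ?_ (fun i => ?_) i
  · simp
  · simp

lemma edgeCochain_cone_cone {m : ℕ} (w : V [⋀^Fin (m + 1)]→ₗ[ℝ] ℂ) (a b : V)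
    (c : TupleChain V m) : edgeCochain w (tupleCone a (m + 1) (tupleCone b m c)) =
      edgeCochain (w.curryLeft (b - a)) (tupleCone b m c) := by
  have : edgeCochain w ∘ₗ tupleCone a (m + 1) ∘ₗ tupleCone b m =
      edgeCochain (w.curryLeft (b - a)) ∘ₗ tupleCone b m :=
    tupleChain_hom_ext fun x => by
      rw [LinearMap.comp_apply, LinearMap.comp_apply, LinearMap.comp_apply, tupleCone_tuple,
        tupleCone_tuple, edgeCochain_cons, Fin.cons_zero]
  exact LinearMap.congr_fun this c

lemma edgeCochain_add {m : ℕ} (w u : V [⋀^Fin m]→ₗ[ℝ] ℂ) (c : TupleChain V (m + 1)) :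
    edgeCochain (w + u) c = edgeCochain w c + edgeCochain u c := by
  have : edgeCochain (w + u) = edgeCochain w + edgeCochain u :=
    tupleChain_hom_ext fun x => by simp
  exact LinearMap.congr_fun this c

lemma edgeCochain_neg {m : ℕ} (w : V [⋀^Fin m]→ₗ[ℝ] ℂ) (c : TupleChain V (m + 1)) :
    edgeCochain (-w) c = -edgeCochain w c := by
  have : edgeCochain (-w) = -edgeCochain w := tupleChain_hom_ext fun x => by simp
  exact LinearMap.congr_fun this c

/-- Splitting off the first two vertices `a`, `b` and using induction for the form contracted with
`b - a`, the claim becomes additivity in the first edge: `y 0 - a = (y 0 - b) + (b - a)`. -/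
lemma edgeCochain_boundary {m : ℕ} (w : V [⋀^Fin m]→ₗ[ℝ] ℂ) (c : TupleChain V (m + 2)) :
    edgeCochain w (tupleBoundary V (m + 1) c) = 0 := by
  suffices h : edgeCochain w ∘ₗ tupleBoundary V (m + 1) = 0 from LinearMap.congr_fun h c
  clear c
  induction m with
  | zero =>
    refine tupleChain_hom_ext fun x => ?_
    rw [LinearMap.comp_apply, tupleBoundary_tuple, Fin.sum_univ_two, map_add, map_smul, map_smul,
      edgeCochain_tuple, edgeCochain_tuple]
    rw [Subsingleton.elim (fun i : Fin 0 => _ - _) (Fin.elim0 : Fin 0 → V)]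
    rw [Subsingleton.elim (fun i : Fin 0 => (x ∘ Fin.succAbove 1) _ - _) (Fin.elim0 : Fin 0 → V)]
    simp
  | succ m ih =>
    refine tupleChain_cons_ext fun a x => ?_
    obtain ⟨b, y, rfl⟩ : ∃ b, ∃ y : Fin (m + 1) → V, x = Fin.cons b y :=
      ⟨x 0, Fin.tail x, (Fin.cons_self_tail x).symm⟩
    have h := LinearMap.congr_fun (ih (w.curryLeft (b - a))) (tuple (Fin.cons b y : Fin (m + 2) → V))
    rw [LinearMap.comp_apply, tupleBoundary_cons, map_sub, LinearMap.zero_apply, sub_eq_zero] at h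
    rw [LinearMap.comp_apply, tupleBoundary_cons, tupleBoundary_cons, map_sub, map_sub, map_sub,
      edgeCochain_cone_cone, ← h, tupleCone_tuple, edgeCochain_cons, edgeCochain_cons,
      ← sub_add_sub_cancel (y 0) b a, map_add, edgeCochain_add]
    simp

lemma curryLeft_swap {m : ℕ} (w : V [⋀^Fin (m + 2)]→ₗ[ℝ] ℂ) (a b : V) :
    (w.curryLeft a).curryLeft b = -(w.curryLeft b).curryLeft a := by
  have h := AlternatingMap.curryLeft_same w (a + b)
  rw [map_add w.curryLeft, AlternatingMap.curryLeft_add, LinearMap.add_apply, map_add, map_add,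
    AlternatingMap.curryLeft_same, AlternatingMap.curryLeft_same, zero_add, add_zero] at h
  exact eq_neg_of_add_eq_zero_left h

/-- The prism consists of `m + 1` signed simplices, each with `v` among its edges. Moving `v` to the
front cancels the sign, so all of them contribute equally. -/
lemma edgeCochain_prism {m : ℕ} (w : V [⋀^Fin (m + 1)]→ₗ[ℝ] ℂ) (v : V)
    (c : TupleChain V (m + 1)) : edgeCochain w (prism v (m + 1) c) =
      (m + 1 : ℂ) * edgeCochain (w.curryLeft v) c := by
  have hcone : ∀ (m : ℕ) (w : V [⋀^Fin (m + 1)]→ₗ[ℝ] ℂ) (a : V) (x : Fin m → V),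
      edgeCochain w (tupleCone a (m + 1) (tupleShift v (m + 1)
        (tuple (Fin.cons a x : Fin (m + 1) → V)))) =
      edgeCochain (w.curryLeft v) (tuple (Fin.cons a x : Fin (m + 1) → V)) := by
    intro m w a x
    rw [tupleShift_tuple, tupleCone_tuple, edgeCochain_cons, edgeCochain_add_const]
    simp
  induction m with
  | zero =>
    suffices h : edgeCochain w ∘ₗ prism v 1 = edgeCochain (w.curryLeft v) by
      have := LinearMap.congr_fun h c
      simpa using this
    refine tupleChain_cons_ext fun a x => ?_
    rw [LinearMap.comp_apply, prism_cons, map_sub, prism_zero, map_zero, map_zero, sub_zero, hcone]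
  | succ m ih =>
    suffices h : edgeCochain w ∘ₗ prism v (m + 2) =
        LinearMap.lsmul ℤ ℂ (m + 2 : ℤ) ∘ₗ edgeCochain (w.curryLeft v) by
      have := LinearMap.congr_fun h c
      simp only [LinearMap.comp_apply, LinearMap.lsmul_apply, zsmul_eq_mul] at this
      rw [this]
      push_cast
      ring
    refine tupleChain_cons_ext fun a x => ?_
    obtain ⟨b, y, rfl⟩ : ∃ b, ∃ y : Fin m → V, x = Fin.cons b y :=
      ⟨x 0, Fin.tail x, (Fin.cons_self_tail x).symm⟩
    rw [LinearMap.comp_apply, prism_cons, map_sub, hcone]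
    have h1 : ∃ c, prism v (m + 1) (tuple (Fin.cons b y : Fin (m + 1) → V)) =
        tupleCone b (m + 1) c := ⟨_, by rw [prism_cons, ← map_sub]⟩
    obtain ⟨c', hc'⟩ := h1
    rw [hc', edgeCochain_cone_cone, ← hc', ih, curryLeft_swap, edgeCochain_neg,
      LinearMap.comp_apply, LinearMap.lsmul_apply, edgeCochain_cons, Fin.cons_zero, zsmul_eq_mul]
    push_cast
    ring

/-- The outermost prism is in the direction of the last vector and puts it in the first slot; this
accounts for the reversal. The factors of the successive prisms multiply to `m!`. -/
lemma edgeCochain_boxChain {m : ℕ} (w : V [⋀^Fin m]→ₗ[ℝ] ℂ) (v : Fin m → V) :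
    edgeCochain w (boxChain m v) = (m.factorial : ℂ) * w (v ∘ Fin.rev) := by
  induction m with
  | zero =>
    rw [boxChain, edgeCochain_tuple, Nat.factorial_zero, Nat.cast_one, one_mul]
    congr 1
    funext i
    exact i.elim0
  | succ m ih =>
    rw [boxChain, edgeCochain_prism, ih, Nat.factorial_succ, Nat.cast_mul, ← mul_assoc,
      AlternatingMap.curryLeft_apply_apply]
    push_cast
    congr 2
    funext i
    refine Fin.cases ?_ (fun i => ?_) i
    · simp
    · simp [Fin.rev_succ, Fin.init]

end Cocycle

end

section

/-! ### Chains and homology of simplicial sets -/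

section SimplicialChains

open Simplicial

variable (S : SSet.{0})

/-- The integral chain given by one simplex. -/
def simplexChain {m : ℕ} (x : S _⦋m⦌) : (S.chainComplex (ModuleCat.of ℤ ℤ)).X m :=
  (S.ιChainComplex (R := ModuleCat.of ℤ ℤ) x).hom (1 : ℤ)

variable {S}

lemma modChain_hom_ext {m : ℕ} {M : ModuleCat.{0} ℤ}
    {f g : (S.chainComplex (ModuleCat.of ℤ ℤ)).X m →ₗ[ℤ] M}
    (h : ∀ x : S _⦋m⦌, f (simplexChain S x) = g (simplexChain S x)) : f = g := by
  have : ModuleCat.ofHom f = (ModuleCat.ofHom g :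
      (S.chainComplex (ModuleCat.of ℤ ℤ)).X m ⟶ M) := by
    refine SSet.chainComplex_hom_ext fun x => ?_
    refine ModuleCat.hom_ext (LinearMap.ext_ring ?_)
    exact h x
  exact congrArg ModuleCat.Hom.hom this

lemma chain_hom_ext {m : ℕ} {M : Type} [AddCommGroup M]
    {f g : (S.chainComplex (ModuleCat.of ℤ ℤ)).X m →ₗ[ℤ] M}
    (h : ∀ x : S _⦋m⦌, f (simplexChain S x) = g (simplexChain S x)) : f = g :=
  modChain_hom_ext (M := ModuleCat.of ℤ M) h

/-- The linear map on chains with given values on simplices. -/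
def chainDesc {m : ℕ} {M : Type} [AddCommGroup M] (f : S _⦋m⦌ → M) :
    (S.chainComplex (ModuleCat.of ℤ ℤ)).X m →ₗ[ℤ] M :=
  (Limits.Cofan.IsColimit.desc (S.isColimitChainComplexXCofan (ModuleCat.of ℤ ℤ) m)
    (fun x => (ModuleCat.ofHom (LinearMap.toSpanSingleton ℤ M (f x)) :
      ModuleCat.of ℤ ℤ ⟶ ModuleCat.of ℤ M))).hom

@[simp] lemma chainDesc_simplexChain {m : ℕ} {M : Type} [AddCommGroup M] (f : S _⦋m⦌ → M)
    (x : S _⦋m⦌) : chainDesc f (simplexChain S x) = f x := by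
  have := Limits.Cofan.IsColimit.fac (S.isColimitChainComplexXCofan (ModuleCat.of ℤ ℤ) m)
    (fun x => (ModuleCat.ofHom (LinearMap.toSpanSingleton ℤ M (f x)) :
      ModuleCat.of ℤ ℤ ⟶ ModuleCat.of ℤ M)) x
  have h := LinearMap.congr_fun (congrArg ModuleCat.Hom.hom this) (1 : ℤ)
  refine Eq.trans h ?_
  simp

lemma d_simplexChain {m : ℕ} (x : S _⦋m + 1⦌) :
    ((S.chainComplex (ModuleCat.of ℤ ℤ)).d (m + 1) m).hom (simplexChain S x) =
      ∑ i : Fin (m + 2), (-1 : ℤ) ^ (i : ℕ) • simplexChain S (S.δ i x) := by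
  have h := LinearMap.congr_fun (congrArg ModuleCat.Hom.hom
    (SSet.ιChainComplex_d S (R := ModuleCat.of ℤ ℤ) x)) (1 : ℤ)
  refine Eq.trans h ?_
  simp only [ModuleCat.hom_sum, LinearMap.sum_apply, ModuleCat.hom_smul, LinearMap.smul_apply]
  rfl

lemma chainComplexMap_simplexChain {T : SSet.{0}} (f : S ⟶ T) {m : ℕ} (x : S _⦋m⦌) :
    ((SSet.chainComplexMap f (ModuleCat.of ℤ ℤ)).f m).hom (simplexChain S x) =
      simplexChain T (f.app _ x) :=
  LinearMap.congr_fun (congrArg ModuleCat.Hom.hom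
    (SSet.ι_chainComplexMap_f S T f (ModuleCat.of ℤ ℤ) x)) (1 : ℤ)

end SimplicialChains

/-! ### Cycles, homology classes and cocycles of a chain complex. -/

section Homology

variable {K : ChainComplex (ModuleCat.{0} ℤ) ℕ} {m : ℕ}

/-- The chain `w` is a cycle in the homology class `S`. -/
def IsCycleIn (w : K.X m) (S : K.homology m) : Prop :=
  ∃ z : K.cycles m, (K.iCycles m).hom z = w ∧ (K.homologyπ m).hom z = S

lemma exists_isCycleIn (S : K.homology m) : ∃ w, IsCycleIn w S := by
  obtain ⟨z, hz⟩ := (ModuleCat.epi_iff_surjective (K.homologyπ m)).1 inferInstance S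
  exact ⟨_, z, rfl, hz⟩

lemma IsCycleIn.d_eq_zero {w : K.X m} {S : K.homology m} (h : IsCycleIn w S) (j : ℕ) :
    (K.d m j).hom w = 0 := by
  obtain ⟨z, rfl, -⟩ := h
  exact LinearMap.congr_fun (congrArg ModuleCat.Hom.hom (K.iCycles_d m j)) z

lemma exists_isCycleIn_of_d_eq_zero {w : K.X m} (h : (K.d m (m - 1)).hom w = 0) :
    ∃ S, IsCycleIn w S := by
  let k : ModuleCat.of ℤ ℤ ⟶ K.X m := ModuleCat.ofHom (LinearMap.toSpanSingleton ℤ _ w)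
  have hk : k ≫ K.d m (m - 1) = 0 := by
    refine ModuleCat.hom_ext (LinearMap.ext_ring ?_)
    simpa [k] using h
  -- Truncated subtraction is correct in degree zero as well, since there the next index is by
  -- convention `0` itself.
  have hm : (ComplexShape.down ℕ).next m = m - 1 := by
    cases m with
    | zero => exact ChainComplex.next_nat_zero
    | succ m => exact ChainComplex.next_nat_succ m
  refine ⟨_, (K.liftCycles k (m - 1) hm hk).hom (1 : ℤ), ?_, rfl⟩
  refine (LinearMap.congr_fun (congrArg ModuleCat.Hom.hom
    (K.liftCycles_i k (m - 1) hm hk)) (1 : ℤ)).trans ?_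
  exact LinearMap.toSpanSingleton_apply_one ℤ _ w

lemma IsCycleIn.zero : IsCycleIn (0 : K.X m) 0 := ⟨0, map_zero _, map_zero _⟩

lemma IsCycleIn.eq_of_sub_eq_d {w w' : K.X m} {S S' : K.homology m} (h : IsCycleIn w S)
    (h' : IsCycleIn w' S') (b : K.X (m + 1)) (hb : w - w' = (K.d (m + 1) m).hom b) : S = S' := by
  obtain ⟨z, rfl, rfl⟩ := h
  obtain ⟨z', rfl, rfl⟩ := h'
  have h1 : z - z' = (K.toCycles (m + 1) m).hom b := by
    refine (ModuleCat.mono_iff_injective (K.iCycles m)).1 inferInstance ?_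
    refine (map_sub _ _ _).trans (hb.trans ?_)
    exact (LinearMap.congr_fun (congrArg ModuleCat.Hom.hom (K.toCycles_i (m + 1) m)) b).symm
  have h2 : (K.homologyπ m).hom (z - z') = 0 := by
    rw [h1]
    exact LinearMap.congr_fun (congrArg ModuleCat.Hom.hom
      (K.toCycles_comp_homologyπ (m + 1) m)) b
  rwa [map_sub, sub_eq_zero] at h2

/-- The functional on homology induced by a cocycle. -/
def homologyDesc {M : Type} [AddCommGroup M] (φ : K.X m →ₗ[ℤ] M)
    (hφ : ∀ b, φ ((K.d (m + 1) m).hom b) = 0) : K.homology m →ₗ[ℤ] M :=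
  (K.homologyι m ≫ K.descOpcycles (ModuleCat.ofHom φ : K.X m ⟶ ModuleCat.of ℤ M) (m + 1)
    (by simp) (ModuleCat.hom_ext (LinearMap.ext hφ))).hom

lemma homologyDesc_eq {M : Type} [AddCommGroup M] (φ : K.X m →ₗ[ℤ] M)
    (hφ : ∀ b, φ ((K.d (m + 1) m).hom b) = 0) {w : K.X m} {S : K.homology m}
    (h : IsCycleIn w S) : homologyDesc φ hφ S = φ w := by
  obtain ⟨z, rfl, rfl⟩ := h
  have : K.homologyπ m ≫ K.homologyι m ≫ K.descOpcycles (ModuleCat.ofHom φ :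
      K.X m ⟶ ModuleCat.of ℤ M) (m + 1) (by simp) (ModuleCat.hom_ext (LinearMap.ext hφ)) =
      K.iCycles m ≫ ModuleCat.ofHom φ := by simp
  exact LinearMap.congr_fun (congrArg ModuleCat.Hom.hom this) z

end Homology

end

section

open Simplicial

variable {n : ℕ} {Γ : AddSubgroup (Fin n → ℂ)}

/-! ### Vertices and affine simplices on chains of the torus -/

/-- The affine singular chain of a chain of tuples. -/
def affineChain (Γ : AddSubgroup (Fin n → ℂ)) (m : ℕ) :
    TupleChain (Fin n → ℂ) (m + 1) →ₗ[ℤ] (singularChains Γ).X m :=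
  Finsupp.linearCombination ℤ fun x =>
    simplexChain (TopCat.toSSet.obj (Torus Γ)) (affineSimplex Γ (.op ⦋m⦌) x)

@[simp] lemma affineChain_tuple {m : ℕ} (x : Fin (m + 1) → Fin n → ℂ) :
    affineChain Γ m (tuple x) =
      simplexChain (TopCat.toSSet.obj (Torus Γ)) (affineSimplex Γ (.op ⦋m⦌) x) := by
  exact linearCombination_single_one _ x

lemma δ_affineSimplex {m : ℕ} (x : Fin (m + 2) → Fin n → ℂ) (i : Fin (m + 2)) :
    (TopCat.toSSet.obj (Torus Γ)).δ i (affineSimplex Γ (.op ⦋m + 1⦌) x) =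
      affineSimplex Γ (.op ⦋m⦌) (x ∘ i.succAbove) := by
  refine (map_project _ _).trans ?_
  congr 1
  ext1 t
  exact baryPoint_map (SimplexCategory.δ i) x t

lemma d_affineChain {m : ℕ} (c : TupleChain (Fin n → ℂ) (m + 2)) :
    ((singularChains Γ).d (m + 1) m).hom (affineChain Γ (m + 1) c) =
      affineChain Γ m (tupleBoundary _ (m + 1) c) := by
  have : ((singularChains Γ).d (m + 1) m).hom ∘ₗ affineChain Γ (m + 1) =
      affineChain Γ m ∘ₗ tupleBoundary _ (m + 1) := by
    refine tupleChain_hom_ext fun x => ?_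
    rw [LinearMap.comp_apply, LinearMap.comp_apply, affineChain_tuple, d_simplexChain,
      tupleBoundary_tuple, map_sum]
    refine Finset.sum_congr rfl fun i _ => ?_
    rw [δ_affineSimplex, map_zsmul, affineChain_tuple]
  exact LinearMap.congr_fun this c

lemma affineChain_add_const {m : ℕ} (x : Fin (m + 1) → Fin n → ℂ) {γ : Fin n → ℂ} (hγ : γ ∈ Γ) :
    affineSimplex Γ (.op ⦋m⦌) (fun i => x i + γ) = affineSimplex Γ (.op ⦋m⦌) x := by
  refine simplex_ext fun t => ?_
  rw [affineSimplex, simplexMap_project, affineSimplex, simplexMap_project]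
  change QuotientAddGroup.mk (baryPoint _ t) = QuotientAddGroup.mk (baryPoint x t)
  rw [baryPoint_add]
  exact QuotientAddGroup.eq.2 (by simpa using neg_mem hγ)

lemma affineChain_eq_zero {m : ℕ} {c : TupleChain (Fin n → ℂ) (m + 1)}
    (hc : c ∈ shiftRelations Γ (m + 1)) : affineChain Γ m c = 0 :=
  map_eq_zero_of_mem_shiftRelations (affineChain Γ m) (fun γ hγ x => by
    rw [affineChain_tuple, affineChain_tuple, affineChain_add_const x hγ]) hc

variable [DiscreteTopology Γ]

/-- The vertices in `ℂⁿ` of the lifts of singular simplices. -/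
def vertexChain (Γ : AddSubgroup (Fin n → ℂ)) [DiscreteTopology Γ] (m : ℕ) :
    (singularChains Γ).X m →ₗ[ℤ] TupleChain (Fin n → ℂ) (m + 1) :=
  chainDesc fun σ => tuple (vertices (simplexLift σ))

@[simp] lemma vertexChain_simplexChain {m : ℕ} (σ : (TopCat.toSSet.obj (Torus Γ)) _⦋m⦌) :
    vertexChain Γ m (simplexChain _ σ) = tuple (vertices (simplexLift σ)) :=
  chainDesc_simplexChain _ _

lemma vertices_simplexLift_δ {m : ℕ} (σ : (TopCat.toSSet.obj (Torus Γ)) _⦋m + 1⦌)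
    (i : Fin (m + 2)) : ∃ γ ∈ Γ, vertices (simplexLift ((TopCat.toSSet.obj (Torus Γ)).δ i σ)) =
      fun j => vertices (simplexLift σ) (i.succAbove j) + γ := by
  obtain ⟨γ, hγ, h⟩ := simplexLift_map (SimplexCategory.δ i).op σ
  refine ⟨γ, hγ, funext fun j => ?_⟩
  refine (h _).trans ?_
  rw [stdSimplex.map_vertex]
  rfl

/-- Taking vertices is a chain map only modulo translations, because the lift of a face need not be
the face of the lift. -/
lemma boundary_vertexChain {m : ℕ} (z : (singularChains Γ).X (m + 1)) :
    tupleBoundary _ (m + 1) (vertexChain Γ (m + 1) z) -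
      vertexChain Γ m (((singularChains Γ).d (m + 1) m).hom z) ∈ shiftRelations Γ (m + 1) := by
  rw [mem_shiftRelations_iff, map_sub, sub_eq_zero]
  have : reduceChain Γ (m + 1) ∘ₗ tupleBoundary _ (m + 1) ∘ₗ vertexChain Γ (m + 1) =
      reduceChain Γ (m + 1) ∘ₗ vertexChain Γ m ∘ₗ ((singularChains Γ).d (m + 1) m).hom := by
    refine chain_hom_ext fun σ => ?_
    simp only [LinearMap.comp_apply]
    rw [vertexChain_simplexChain, d_simplexChain, tupleBoundary_tuple]
    simp only [map_sum, map_zsmul]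
    refine Finset.sum_congr rfl fun i _ => ?_
    congr 1
    obtain ⟨γ, hγ, h⟩ := vertices_simplexLift_δ σ i
    rw [vertexChain_simplexChain, h, eq_comm, ← sub_eq_zero, ← map_sub, ← mem_shiftRelations_iff,
      ← tupleShift_tuple γ (fun j => vertices (simplexLift σ) (i.succAbove j))]
    exact shift_sub_mem Γ hγ _
  exact LinearMap.congr_fun this z

/-- Taking vertices and spanning affine simplices is the chain map induced by `straighten`. Its
simplicial homotopy to the identity gives a chain homotopy, whose term through `∂z` drops out. -/
lemma exists_sub_affineChain_eq_d {m : ℕ} {z : (singularChains Γ).X m}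
    (hz : ((singularChains Γ).d m (m - 1)).hom z = 0) :
    ∃ b, z - affineChain Γ m (vertexChain Γ m z) = ((singularChains Γ).d (m + 1) m).hom b := by
  let H := (straightenHomotopy Γ).chainComplexMap (ModuleCat.of ℤ ℤ)
  have hst : ((SSet.chainComplexMap (straighten Γ) (ModuleCat.of ℤ ℤ)).f m).hom =
      affineChain Γ m ∘ₗ vertexChain Γ m := by
    refine modChain_hom_ext fun σ => ?_
    rw [chainComplexMap_simplexChain, LinearMap.comp_apply, vertexChain_simplexChain,
      affineChain_tuple, straighten_app]
  have h1 := H.comm m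
  have hid : (SSet.chainComplexMap (𝟙 (TopCat.toSSet.obj (Torus Γ))) (ModuleCat.of ℤ ℤ)).f m =
      𝟙 _ := by
    rw [SSet.chainComplexMap, CategoryTheory.Functor.map_id]; rfl
  rw [hid] at h1
  have h2 := LinearMap.congr_fun (congrArg ModuleCat.Hom.hom h1) z
  rw [prevD_eq H.hom (j := m) (j' := m + 1) rfl] at h2
  have h3 : (dNext m H.hom).hom z = 0 := by
    cases m with
    | zero => rw [dNext_eq_zero _ _ (by simp)]; rfl
    | succ m =>
      rw [dNext_eq H.hom (i' := m) rfl]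
      exact (congrArg (H.hom m (m + 1)).hom hz).trans (map_zero _)
  refine ⟨(H.hom m (m + 1)).hom z, ?_⟩
  rw [sub_eq_iff_eq_add]
  refine h2.trans ?_
  change (dNext m H.hom).hom z + ((singularChains Γ).d (m + 1) m).hom ((H.hom m (m + 1)).hom z) +
    ((SSet.chainComplexMap (straighten Γ) (ModuleCat.of ℤ ℤ)).f m).hom z = _
  rw [h3, zero_add, hst]
  rfl

end

section

open Simplicial

variable {n : ℕ} {Γ : AddSubgroup (Fin n → ℂ)} {N : ℕ}

/-! ### Periods of constant forms -/

lemma edgeCochain_eq_zero {m : ℕ} (w : (Fin n → ℂ) [⋀^Fin m]→ₗ[ℝ] ℂ)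
    {c : TupleChain (Fin n → ℂ) (m + 1)} (hc : c ∈ shiftRelations Γ (m + 1)) :
    edgeCochain w c = 0 :=
  map_eq_zero_of_mem_shiftRelations (edgeCochain w) (fun γ _ x => edgeCochain_add_const w x γ) hc

/-- The chain of tuples of an integral combination of parallelepipeds. -/
def boxSum (e : Fin N → Fin n → ℂ) {m : ℕ} (a : (Fin m ↪o Fin N) → ℤ) :
    TupleChain (Fin n → ℂ) (m + 1) := ∑ i, a i • boxChain m (e ∘ i)

lemma edgeCochain_boxSum (e : Fin N → Fin n → ℂ) {m : ℕ} (a : (Fin m ↪o Fin N) → ℤ)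
    (w : (Fin n → ℂ) [⋀^Fin m]→ₗ[ℝ] ℂ) : edgeCochain w (boxSum e a) =
      (m.factorial * (Equiv.Perm.sign (Fin.revPerm : Equiv.Perm (Fin m)) : ℤ) : ℂ) *
        ∑ i, (a i : ℂ) * w (e ∘ i) := by
  rw [boxSum, map_sum, Finset.mul_sum]
  refine Finset.sum_congr rfl fun i _ => ?_
  have := AlternatingMap.map_perm w (e ∘ i) Fin.revPerm
  rw [map_zsmul, edgeCochain_boxChain, show (e ∘ i) ∘ Fin.rev = (e ∘ i) ∘ Fin.revPerm from rfl, this,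
    zsmul_eq_mul, Units.smul_def, zsmul_eq_mul]
  ring

lemma exists_isCycleIn_boxSum {e : Fin N → Fin n → ℂ} (he : ∀ i, e i ∈ Γ) {m : ℕ}
    (a : (Fin m ↪o Fin N) → ℤ) :
    ∃ S : singularHomology Γ m, IsCycleIn (affineChain Γ m (boxSum e a)) S := by
  refine exists_isCycleIn_of_d_eq_zero ?_
  cases m with
  | zero =>
    rw [(singularChains Γ).shape _ _ (by simp)]
    rfl
  | succ m =>
    refine (d_affineChain _).trans (affineChain_eq_zero ?_)
    rw [boxSum, map_sum]
    refine Submodule.sum_mem _ fun i _ => ?_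
    rw [map_zsmul]
    exact Submodule.smul_mem _ _ (isCycleMod_boxChain fun r => he (i r)).1

variable [DiscreteTopology Γ]

/-- The chosen lift of an affine simplex differs from the obvious one by a lattice vector. -/
lemma vertexChain_affineChain_sub_mem {m : ℕ} (c : TupleChain (Fin n → ℂ) (m + 1)) :
    vertexChain Γ m (affineChain Γ m c) - c ∈ shiftRelations Γ (m + 1) := by
  rw [mem_shiftRelations_iff, map_sub, sub_eq_zero]
  have : reduceChain Γ (m + 1) ∘ₗ vertexChain Γ m ∘ₗ affineChain Γ m = reduceChain Γ (m + 1) := by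
    refine tupleChain_hom_ext fun x => ?_
    rw [LinearMap.comp_apply, LinearMap.comp_apply, affineChain_tuple, vertexChain_simplexChain]
    obtain ⟨γ, hγ, h⟩ := project_eq_iff.1 (project_simplexLift (affineSimplex Γ (.op ⦋m⦌) x)).symm
    have hv : vertices (simplexLift (affineSimplex Γ (.op ⦋m⦌) x)) = fun i => x i + γ := by
      funext i
      refine (h _).trans ?_
      congr 1
      change baryPoint x (stdSimplex.vertex i) = x i
      rw [baryPoint, Finset.sum_eq_single i]
      · simp
      · intro j _ hj
        simp [hj.symm]
      · simp
    rw [hv, ← sub_eq_zero, ← map_sub, ← mem_shiftRelations_iff, ← tupleShift_tuple]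
    exact shift_sub_mem Γ hγ _
  exact LinearMap.congr_fun this c

/-- The singular cochain of a constant form. -/
def periodCochain (Γ : AddSubgroup (Fin n → ℂ)) [DiscreteTopology Γ] {m : ℕ}
    (w : (Fin n → ℂ) [⋀^Fin m]→ₗ[ℝ] ℂ) : (singularChains Γ).X m →ₗ[ℤ] ℂ :=
  edgeCochain w ∘ₗ vertexChain Γ m

lemma periodCochain_simplexChain {m : ℕ} (w : (Fin n → ℂ) [⋀^Fin m]→ₗ[ℝ] ℂ)
    (F : C(stdSimplex ℝ (Fin (m + 1)), Fin n → ℂ)) :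
    periodCochain Γ w (simplexChain _ (project Γ (.op ⦋m⦌) F)) =
      w fun i => F (stdSimplex.vertex i.succ) - F (stdSimplex.vertex i.castSucc) := by
  obtain ⟨γ, hγ, h⟩ := project_eq_iff.1 (project_simplexLift (project Γ (.op ⦋m⦌) F)).symm
  have hv : vertices (simplexLift (project Γ (.op ⦋m⦌) F)) = fun i => vertices F i + γ :=
    funext fun i => h _
  rw [periodCochain, LinearMap.comp_apply, vertexChain_simplexChain, hv, edgeCochain_add_const,
    edgeCochain_tuple]
  rfl

lemma periodCochain_affineChain {m : ℕ} (w : (Fin n → ℂ) [⋀^Fin m]→ₗ[ℝ] ℂ)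
    (c : TupleChain (Fin n → ℂ) (m + 1)) :
    periodCochain Γ w (affineChain Γ m c) = edgeCochain w c := by
  rw [periodCochain, LinearMap.comp_apply, ← sub_eq_zero, ← map_sub]
  exact edgeCochain_eq_zero w (vertexChain_affineChain_sub_mem c)

/-- The edge cochain kills boundaries of tuples and is translation invariant, so it does not see the
failure of `vertexChain` to be a chain map. -/
lemma periodCochain_d {m : ℕ} (w : (Fin n → ℂ) [⋀^Fin m]→ₗ[ℝ] ℂ)
    (b : (singularChains Γ).X (m + 1)) :
    periodCochain Γ w (((singularChains Γ).d (m + 1) m).hom b) = 0 := by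
  have h := edgeCochain_eq_zero w (boundary_vertexChain b)
  rw [map_sub, edgeCochain_boundary, zero_sub, neg_eq_zero] at h
  exact h

/-- The period of a constant form over a homology class, normalized such that the standard simplex
has volume one. -/
def period (Γ : AddSubgroup (Fin n → ℂ)) [DiscreteTopology Γ] {m : ℕ}
    (w : (Fin n → ℂ) [⋀^Fin m]→ₗ[ℝ] ℂ) : singularHomology Γ m →ₗ[ℤ] ℂ :=
  homologyDesc (periodCochain Γ w) (periodCochain_d w)

lemma period_eq {m : ℕ} (w : (Fin n → ℂ) [⋀^Fin m]→ₗ[ℝ] ℂ) {c : (singularChains Γ).X m}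
    {S : singularHomology Γ m} (h : IsCycleIn c S) : period Γ w S = periodCochain Γ w c :=
  homologyDesc_eq _ _ h

/-- The vertices of a singular cycle form a cycle modulo `Γ`, which the decomposition theorem writes
as parallelepipeds plus a boundary. Affine simplices carry this back to the torus, where the
translation relations become zero and straightening supplies the remaining boundary. -/
theorem exists_boxSum_isCycleIn {e : Fin N → Fin n → ℂ} (he : LinearIndependent ℤ e)
    (hΓ : Γ = AddSubgroup.closure (Set.range e)) {m : ℕ} (S : singularHomology Γ m) :
    ∃ a : (Fin m ↪o Fin N) → ℤ, IsCycleIn (affineChain Γ m (boxSum e a)) S := by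
  have hP : partialLattice e N = Γ := by
    rw [hΓ, partialLattice]
    congr 1
    ext x
    simp
  obtain ⟨z, hz⟩ := exists_isCycleIn S
  have hc : IsCycleMod (partialLattice e N) m (vertexChain Γ m z) := by
    cases m with
    | zero => trivial
    | succ m =>
      rw [hP]
      have h := boundary_vertexChain z
      rw [hz.d_eq_zero, map_zero, sub_zero] at h
      exact h
  obtain ⟨g, hg, u, hu⟩ := exists_boxSpan_of_isCycleMod he le_rfl hc
  rw [hP] at hu
  have hspan : ∃ a : (Fin m ↪o Fin N) → ℤ, boxSum e a = g := by
    refine (Submodule.mem_span_range_iff_exists_fun ℤ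
      (v := fun i : Fin m ↪o Fin N => boxChain m (e ∘ i))).1 ?_
    refine Submodule.span_mono ?_ hg
    rintro _ ⟨I, h1, -, rfl⟩
    exact ⟨OrderEmbedding.ofStrictMono I h1, rfl⟩
  obtain ⟨a, rfl⟩ := hspan
  refine ⟨a, ?_⟩
  obtain ⟨S', hS'⟩ := exists_isCycleIn_boxSum (Γ := Γ) (e := e) (fun i => by
    rw [hΓ]; exact AddSubgroup.subset_closure ⟨i, rfl⟩) a
  obtain ⟨b, hb⟩ := exists_sub_affineChain_eq_d (hz.d_eq_zero (m - 1))
  have h2 := affineChain_eq_zero hu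
  rw [map_sub, map_sub, ← d_affineChain, sub_eq_zero] at h2
  have : S = S' := by
    refine hz.eq_of_sub_eq_d hS' (b + affineChain Γ (m + 1) u) ?_
    rw [map_add, ← hb, ← h2]
    abel
  rwa [this]

end

section

/-! ### Integration over the corner simplex -/

section CornerSimplex

lemma isClosed_cornerSimplex (m : ℕ) : IsClosed (cornerSimplex m) := by
  have h1 : IsClosed {x : Fin m → ℝ | ∀ j, 0 ≤ x j} := by
    simp only [Set.ofPred_forall]
    exact isClosed_iInter fun j => isClosed_le continuous_const (continuous_apply j)
  exact h1.inter (isClosed_le (continuous_finsetSum _ fun j _ => continuous_apply j)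
    continuous_const)

lemma cornerSimplex_le_one {m : ℕ} {x : Fin m → ℝ} (hx : x ∈ cornerSimplex m) (j : Fin m) :
    x j ≤ 1 :=
  (Finset.single_le_sum (fun i _ => hx.1 i) (Finset.mem_univ j)).trans hx.2

lemma isCompact_cornerSimplex (m : ℕ) : IsCompact (cornerSimplex m) :=
  (isCompact_Icc (a := (0 : Fin m → ℝ)) (b := 1)).of_isClosed_subset (isClosed_cornerSimplex m)
    fun _ hx => ⟨fun j => hx.1 j, fun j => cornerSimplex_le_one hx j⟩

lemma measurableSet_cornerSimplex (m : ℕ) : MeasurableSet (cornerSimplex m) :=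
  (isClosed_cornerSimplex m).measurableSet

lemma convex_cornerSimplex (m : ℕ) : Convex ℝ (cornerSimplex m) := by
  intro x hx y hy a b ha hb hab
  refine ⟨fun j => add_nonneg (mul_nonneg ha (hx.1 j)) (mul_nonneg hb (hy.1 j)), ?_⟩
  simp only [Pi.add_apply, Pi.smul_apply, smul_eq_mul, Finset.sum_add_distrib, ← Finset.mul_sum]
  nlinarith [hx.2, hy.2]

lemma volume_cornerSimplex_pos (m : ℕ) : 0 < volume (cornerSimplex m) := by
  have hopen : IsOpen {x : Fin m → ℝ | (∀ j, 0 < x j) ∧ ∑ j, x j < 1} := by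
    have h1 : IsOpen {x : Fin m → ℝ | ∀ j, 0 < x j} := by
      simp only [Set.ofPred_forall]
      exact isOpen_iInter_of_finite fun j => isOpen_lt continuous_const (continuous_apply j)
    exact h1.inter (isOpen_lt (continuous_finsetSum _ fun j _ => continuous_apply j)
      continuous_const)
  refine (hopen.measure_pos volume ⟨fun _ => 1 / (m + 1 : ℝ), fun j => by positivity, ?_⟩).trans_le
    (measure_mono fun x hx => ⟨fun j => (hx.1 j).le, hx.2.le⟩)
  rw [Finset.sum_const, Finset.card_univ, Fintype.card_fin, nsmul_eq_mul, mul_one_div,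
    div_lt_one (by positivity)]
  exact lt_add_one _

lemma volume_cornerSimplex_lt_top (m : ℕ) : volume (cornerSimplex m) < ⊤ :=
  (isCompact_cornerSimplex m).measure_lt_top

lemma insertNth_mem_cornerSimplex {m : ℕ} (j : Fin (m + 1)) (t : ℝ) (y : Fin m → ℝ) :
    (j.insertNth t y : Fin (m + 1) → ℝ) ∈ cornerSimplex (m + 1) ↔
      y ∈ cornerSimplex m ∧ t ∈ Set.Icc 0 (1 - ∑ i, y i) := by
  simp only [cornerSimplex, Set.mem_ofPred_eq, Fin.forall_iff_succAbove j, Fin.insertNth_apply_same,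
    Fin.insertNth_apply_succAbove, Fin.sum_univ_succAbove _ j, Set.mem_Icc]
  constructor
  · rintro ⟨⟨h1, h2⟩, h3⟩
    exact ⟨⟨h2, by linarith⟩, h1, by linarith⟩
  · rintro ⟨⟨h1, h2⟩, h3, h4⟩
    exact ⟨⟨h3, h1⟩, by linarith⟩

lemma setIntegral_cornerSimplex_succ {m : ℕ} (j : Fin (m + 1)) {g : (Fin (m + 1) → ℝ) → ℂ}
    (hg : Continuous g) : ∫ x in cornerSimplex (m + 1), g x =
      ∫ y in cornerSimplex m, ∫ t in (0 : ℝ)..(1 - ∑ i, y i), g (j.insertNth t y) := by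
  have hmp := volume_preserving_piFinSuccAbove (fun _ : Fin (m + 1) => ℝ) j
  have hint : Integrable ((cornerSimplex (m + 1)).indicator g) volume :=
    (integrable_indicator_iff (measurableSet_cornerSimplex _)).2
      (hg.continuousOn.integrableOn_compact (isCompact_cornerSimplex _))
  rw [← integral_indicator (measurableSet_cornerSimplex _),
    ← (hmp.symm).integral_comp' (g := (cornerSimplex (m + 1)).indicator g), Measure.volume_eq_prod]
  have hint2 := (hmp.symm).integrable_comp_of_integrable hint
  rw [Measure.volume_eq_prod] at hint2
  refine (integral_prod_symm _ hint2).trans ?_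
  rw [← integral_indicator (measurableSet_cornerSimplex _)]
  refine integral_congr_ae (Filter.Eventually.of_forall fun y => ?_)
  simp only [MeasurableEquiv.piFinSuccAbove_symm_apply]
  by_cases hy : y ∈ cornerSimplex m
  · rw [Set.indicator_of_mem hy, intervalIntegral.integral_of_le (by linarith [hy.2]),
      ← integral_Icc_eq_integral_Ioc, ← integral_indicator measurableSet_Icc]
    refine integral_congr_ae (Filter.Eventually.of_forall fun t => ?_)
    by_cases ht : t ∈ Set.Icc 0 (1 - ∑ i, y i)
    · have := (insertNth_mem_cornerSimplex j t y).2 ⟨hy, ht⟩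
      simp only [Set.indicator_of_mem ht]
      exact Set.indicator_of_mem this g
    · have : ¬ _ := fun h => ht ((insertNth_mem_cornerSimplex j t y).1 h).2
      simp only [Set.indicator_of_notMem ht]
      exact Set.indicator_of_notMem this g
  · rw [Set.indicator_of_notMem hy]
    refine integral_eq_zero_of_ae (Filter.Eventually.of_forall fun t => ?_)
    have : ¬ _ := fun h => hy ((insertNth_mem_cornerSimplex j t y).1 h).1
    exact Set.indicator_of_notMem this g

lemma hasDerivAt_insertNth {m : ℕ} (j : Fin (m + 1)) (y : Fin m → ℝ) (t : ℝ) :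
    HasDerivAt (fun t : ℝ => (j.insertNth t y : Fin (m + 1) → ℝ)) (Pi.single j 1) t := by
  rw [hasDerivAt_pi]
  intro i
  refine Fin.succAboveCases j ?_ (fun i => ?_) i
  · simpa using hasDerivAt_id' t
  · simpa using hasDerivAt_const t (y i)

/-- The fundamental theorem of calculus in one coordinate direction on the corner simplex. -/
lemma setIntegral_cornerSimplex_fderiv {m : ℕ} (j : Fin (m + 1)) {h : (Fin (m + 1) → ℝ) → ℂ}
    (hh : ContDiff ℝ 1 h) : ∫ x in cornerSimplex (m + 1), fderiv ℝ h x (Pi.single j 1) =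
      ∫ y in cornerSimplex m, (h (j.insertNth (1 - ∑ i, y i) y) - h (j.insertNth 0 y)) := by
  have hc : Continuous fun x => fderiv ℝ h x (Pi.single j 1) :=
    (hh.continuous_fderiv one_ne_zero).clm_apply continuous_const
  rw [setIntegral_cornerSimplex_succ j hc]
  refine setIntegral_congr_fun (measurableSet_cornerSimplex _) fun y _ => ?_
  refine intervalIntegral.integral_eq_sub_of_hasDerivAt (f := fun t => h (j.insertNth t y))
    (fun t _ => ?_) ?_
  · exact ((hh.differentiable one_ne_zero _).hasFDerivAt).comp_hasDerivAt t
      (hasDerivAt_insertNth j y t)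
  · refine (hc.comp ?_).intervalIntegrable _ _
    exact continuous_iff_continuousAt.2 fun t => (hasDerivAt_insertNth j y t).continuousAt

/-- The linear part of the exchange of the barycentric coordinates `0` and `j + 1`. -/
def exchangeLinear {m : ℕ} (j : Fin m) : (Fin m → ℝ) →ₗ[ℝ] (Fin m → ℝ) where
  toFun y := Function.update y j (-∑ i, y i)
  map_add' x y := by
    ext i
    rcases eq_or_ne i j with rfl | h
    · simp [Finset.sum_add_distrib]; ring
    · simp [h]
  map_smul' a x := by
    ext i
    rcases eq_or_ne i j with rfl | h
    · simp [Finset.mul_sum]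
    · simp [h]

lemma sum_update {m : ℕ} (j : Fin m) (y : Fin m → ℝ) (a : ℝ) :
    ∑ i, Function.update y j a i = a + (∑ i, y i - y j) := by
  rw [Finset.sum_update_of_mem (Finset.mem_univ j), ← Finset.sum_erase_eq_sub (Finset.mem_univ j),
    Finset.sdiff_singleton_eq_erase]

lemma exchangeLinear_involutive {m : ℕ} (j : Fin m) :
    exchangeLinear j ∘ₗ exchangeLinear j = LinearMap.id := by
  refine LinearMap.ext fun y => ?_
  simp only [LinearMap.comp_apply, exchangeLinear, LinearMap.coe_mk, AddHom.coe_mk, sum_update,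
    Function.update_idem, LinearMap.id_apply]
  rw [Function.update_eq_iff]
  exact ⟨by ring, fun _ _ => rfl⟩

/-- The exchange of the barycentric coordinates `0` and `j + 1`. -/
def exchange {m : ℕ} (j : Fin m) (y : Fin m → ℝ) : Fin m → ℝ :=
  Function.update y j (1 - ∑ i, y i)

lemma exchange_eq {m : ℕ} (j : Fin m) (y : Fin m → ℝ) :
    exchange j y = exchangeLinear j y + Pi.single j 1 := by
  ext i
  rcases eq_or_ne i j with rfl | h
  · simp [exchange, exchangeLinear]; ring
  · simp [exchange, exchangeLinear, h]

lemma exchange_exchange {m : ℕ} (j : Fin m) (y : Fin m → ℝ) : exchange j (exchange j y) = y := by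
  simp only [exchange, sum_update, Function.update_idem]
  rw [Function.update_eq_iff]
  exact ⟨by ring, fun _ _ => rfl⟩

lemma continuous_exchange {m : ℕ} (j : Fin m) : Continuous (exchange j) :=
  continuous_id.update j (continuous_const.sub (continuous_finsetSum _ fun i _ => continuous_apply i))

/-- The linear part is an involution, so its determinant is `±1`. -/
lemma measurePreserving_exchange {m : ℕ} (j : Fin m) :
    MeasurePreserving (exchange j) volume volume := by
  have hdet : LinearMap.det (exchangeLinear j) * LinearMap.det (exchangeLinear j) = 1 := by
    rw [← LinearMap.det_comp, exchangeLinear_involutive, LinearMap.det_id]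
  have habs : |(LinearMap.det (exchangeLinear j))⁻¹| = 1 := by
    rw [abs_inv]
    rcases mul_self_eq_one_iff.1 hdet with h | h <;> simp [h]
  have h1 : MeasurePreserving (exchangeLinear j) volume volume := by
    refine ⟨(exchangeLinear j).continuous_of_finiteDimensional.measurable, ?_⟩
    rw [Real.map_linearMap_volume_pi_eq_smul_volume_pi (left_ne_zero_of_mul_eq_one hdet), habs]
    simp
  have := (measurePreserving_add_right volume (Pi.single j (1 : ℝ))).comp h1
  convert this using 1
  exact funext fun y => exchange_eq j y

lemma exchange_mem {m : ℕ} (j : Fin m) {y : Fin m → ℝ} (hy : y ∈ cornerSimplex m) :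
    exchange j y ∈ cornerSimplex m := by
  refine ⟨fun i => ?_, ?_⟩
  · rcases eq_or_ne i j with rfl | h
    · simp [exchange]; exact hy.2
    · simp [exchange, h]; exact hy.1 i
  · rw [exchange, sum_update]; linarith [hy.1 j]

lemma setIntegral_exchange {m : ℕ} (j : Fin m) (g : (Fin m → ℝ) → ℂ) :
    ∫ y in cornerSimplex m, g (exchange j y) = ∫ y in cornerSimplex m, g y := by
  have hpre : exchange j ⁻¹' cornerSimplex m = cornerSimplex m := by
    ext y
    exact ⟨fun h => exchange_exchange j y ▸ exchange_mem j h, exchange_mem j⟩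
  have hemb : MeasurableEmbedding (exchange j) :=
    (MeasurableEquiv.mk (Equiv.mk (exchange j) (exchange j) (exchange_exchange j)
      (exchange_exchange j)) (continuous_exchange j).measurable
      (continuous_exchange j).measurable).measurableEmbedding
  have := (measurePreserving_exchange j).setIntegral_preimage_emb hemb g (cornerSimplex m)
  rwa [hpre] at this

/-- Two parametrizations of the slanted face which eliminate neighbouring coordinates differ by an
exchange, which preserves volume. -/
lemma insertNth_exchange {m : ℕ} (j : Fin m) (y : Fin m → ℝ) :
    (j.castSucc.insertNth (1 - ∑ i, exchange j y i) (exchange j y) : Fin (m + 1) → ℝ) =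
      j.succ.insertNth (1 - ∑ i, y i) y := by
  have h1 : 1 - ∑ i, exchange j y i = y j := by rw [exchange, sum_update]; ring
  rw [h1, Fin.insertNth_eq_iff]
  have hj : j.castSucc = j.succ.succAbove j := by
    rw [Fin.succAbove_of_castSucc_lt _ _ j.castSucc_lt_succ]
  refine ⟨by rw [hj, Fin.insertNth_apply_succAbove], funext fun i => ?_⟩
  rw [Fin.removeNth]
  rcases eq_or_ne i j with rfl | h
  · rw [Fin.succAbove_castSucc_self, Fin.insertNth_apply_same]
    simp [exchange]
  · have : j.castSucc.succAbove i = j.succ.succAbove i := by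
      have h' : (i : ℕ) ≠ j := fun h' => h (Fin.ext h')
      simp only [Fin.succAbove, Fin.lt_def, Fin.val_castSucc, Fin.val_succ]
      split_ifs <;> first | rfl | omega
    rw [this, Fin.insertNth_apply_succAbove, exchange, Function.update_of_ne h]

/-- The integral over the slanted face of the corner simplex does not depend on the coordinate
which is eliminated. -/
lemma setIntegral_slanted_face {m : ℕ} (j : Fin (m + 1)) (h : (Fin (m + 1) → ℝ) → ℂ) :
    ∫ y in cornerSimplex m, h (j.insertNth (1 - ∑ i, y i) y) =
      ∫ y in cornerSimplex m, h (Fin.cons (1 - ∑ i, y i) y) := by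
  induction j using Fin.induction with
  | zero => simp only [Fin.insertNth_zero]; rfl
  | succ j ih =>
    rw [← ih, ← setIntegral_exchange j fun y => h (j.castSucc.insertNth (1 - ∑ i, y i) y)]
    simp only [insertNth_exchange]

end CornerSimplex

end

section

/-! ### Alternating maps on the edges and faces of a simplex -/

section AlternatingIdentities

variable {W : Type*} [AddCommGroup W] [Module ℝ W] {m : ℕ}

lemma map_sub_of_forall_eq_zero (w : W [⋀^Fin m]→ₗ[ℝ] ℂ) (p : W)
    (hw : ∀ v, (∃ i, v i = p) → w v = 0) (v : Fin m → W) : w (fun i => v i - p) = w v := by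
  classical
  suffices h : ∀ s : Finset (Fin m), w (s.piecewise (fun i => v i - p) v) = w v by
    simpa using h Finset.univ
  intro s
  induction s using Finset.induction_on with
  | empty => simp
  | insert a s ha ih =>
    rw [Finset.piecewise_insert, AlternatingMap.map_update_sub, hw (Function.update _ a p)
      ⟨a, by simp⟩, sub_zero, ← ih]
    congr 1
    rw [Function.update_eq_self_iff, Finset.piecewise_eq_of_notMem _ _ _ ha]

lemma map_cons_sub (w : W [⋀^Fin (m + 1)]→ₗ[ℝ] ℂ) (p : W) (v : Fin m → W) :
    w (Fin.cons p fun i => v i - p) = w (Fin.cons p v) := by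
  refine map_sub_of_forall_eq_zero (w.curryLeft p) p ?_ v
  rintro v ⟨i, hi⟩
  refine w.map_eq_zero_of_eq (i := 0) (j := i.succ) _ ?_ (Fin.succ_ne_zero i).symm
  simp [hi]

/-- Consecutive edges and edges from the first vertex are related by a unitriangular change of
vectors. -/
lemma map_edges_eq (w : W [⋀^Fin m]→ₗ[ℝ] ℂ) (x : Fin (m + 1) → W) :
    (w fun i => x i.succ - x i.castSucc) = w fun i => x i.succ - x 0 := by
  induction m with
  | zero => congr 1; funext i; exact i.elim0
  | succ m ih =>
    have h1 : (fun i : Fin (m + 1) => x i.succ - x i.castSucc) =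
        Fin.cons (x 1 - x 0) fun i : Fin m => x i.succ.succ - x i.succ.castSucc := by
      funext i
      refine Fin.cases ?_ (fun i => ?_) i <;> simp
    have h2 : (fun i : Fin (m + 1) => x i.succ - x 0) =
        Fin.cons (x 1 - x 0) fun i : Fin m => x i.succ.succ - x 0 := by
      funext i
      refine Fin.cases ?_ (fun i => ?_) i <;> simp
    rw [h1, h2, ← map_cons_sub w _ fun i : Fin m => x i.succ.succ - x 0]
    have := ih (w.curryLeft (x 1 - x 0)) (Fin.tail x)
    simp only [AlternatingMap.curryLeft_apply_apply] at this
    refine Eq.trans ?_ (this.trans ?_)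
    · rfl
    · congr 2
      funext i
      exact (sub_sub_sub_cancel_right _ _ _).symm

/-- In the multilinear expansion only terms containing `x 0` at most once survive. The identity
expresses a form on the slanted face through its coordinate components. -/
lemma map_edges_eq_sum_faces (w : W [⋀^Fin m]→ₗ[ℝ] ℂ) (x : Fin (m + 1) → W) :
    (w fun i => x i.succ - x 0) = ∑ j : Fin (m + 1), (-1 : ℂ) ^ (j : ℕ) * w (x ∘ j.succAbove) := by
  induction m with
  | zero =>
    simp only [Fin.sum_univ_succ, Fin.val_zero, pow_zero, one_mul, Finset.univ_eq_empty,
      Finset.sum_empty, add_zero]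
    congr 1; funext i; exact i.elim0
  | succ m ih =>
    have hx := ih (w.curryLeft (x 0)) (Fin.tail x)
    rw [Fin.sum_univ_succ]
    have h1 : ∀ j : Fin (m + 1), x ∘ j.succ.succAbove = Fin.cons (x 0) (Fin.tail x ∘ j.succAbove) := by
      intro j
      funext i
      refine Fin.cases ?_ (fun i => ?_) i <;> simp [Fin.tail]
    have h2 : ∑ j : Fin (m + 1), (-1 : ℂ) ^ (j.succ : ℕ) * w (x ∘ j.succ.succAbove) =
        - w (Fin.cons (x 0) fun i : Fin m => x i.succ.succ - x 1) := by
      rw [AlternatingMap.curryLeft_apply_apply] at hx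
      refine Eq.trans ?_ (congrArg Neg.neg hx.symm)
      rw [← Finset.sum_neg_distrib]
      refine Finset.sum_congr rfl fun j _ => ?_
      rw [h1, AlternatingMap.curryLeft_apply_apply, Fin.val_succ, pow_succ]
      simp [Matrix.vecCons]
    rw [h2, Fin.val_zero, pow_zero, one_mul]
    have h3 : (fun i : Fin (m + 1) => x i.succ - x 0) =
        Fin.cons (x 1 - x 0) fun i : Fin m => x i.succ.succ - x 0 := by
      funext i
      refine Fin.cases ?_ (fun i => ?_) i <;> simp
    have h4 : (x ∘ Fin.succAbove 0) = Fin.cons (x 1) fun i : Fin m => x i.succ.succ := by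
      funext i
      refine Fin.cases ?_ (fun i => ?_) i <;> simp
    rw [h3, h4, ← map_cons_sub w (x 1 - x 0), ← map_cons_sub w (x 1)]
    simp only [sub_sub_sub_cancel_right]
    have h5 := (w.curryLeft).map_sub (x 1) (x 0)
    exact DFunLike.congr_fun h5 fun i : Fin m => x i.succ.succ - x 1

end AlternatingIdentities

/-! ### Integrals of pulled back forms -/

section Smoothness

variable {n m k : ℕ}

lemma contDiff_form_eval (r : ℕ∞) :
    ContDiff ℝ r fun p : ((Fin n → ℂ) [⋀^Fin m]→L[ℝ] ℂ) × (Fin m → Fin n → ℂ) => p.1 p.2 := by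
  have h : AnalyticOnNhd ℝ (fun p : ((Fin n → ℂ) [⋀^Fin m]→L[ℝ] ℂ) × (Fin m → Fin n → ℂ) =>
      p.1 p.2) Set.univ :=
    ContinuousLinearMap.analyticOnNhd_uncurry_of_multilinear
      (ContinuousAlternatingMap.toContinuousMultilinearMapCLM ℝ :
        ((Fin n → ℂ) [⋀^Fin m]→L[ℝ] ℂ) →L[ℝ]
          ContinuousMultilinearMap ℝ (fun _ : Fin m => Fin n → ℂ) ℂ) (s := Set.univ)
  exact h.contDiff

lemma contDiff_form_apply {X : Type*} [NormedAddCommGroup X] [NormedSpace ℝ X] {r : ℕ∞}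
    {α : X → (Fin n → ℂ) [⋀^Fin m]→L[ℝ] ℂ} {v : Fin m → X → Fin n → ℂ} (hα : ContDiff ℝ r α)
    (hv : ∀ i, ContDiff ℝ r (v i)) : ContDiff ℝ r fun u => α u fun i => v i u :=
  (contDiff_form_eval r).comp (hα.prodMk (contDiff_pi.2 hv))

/-- The value of the pull-back of a form on coordinate vectors. -/
def pullbackCoord (α : Form n m) (F : (Fin k → ℝ) → Fin n → ℂ) (I : Fin m → Fin k)
    (u : Fin k → ℝ) : ℂ :=
  α (F u) fun r => fderiv ℝ F u (Pi.single (I r) 1)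

lemma contDiff_pullbackCoord {α : Form n m} (hα : ContDiff ℝ ∞ α) {F : (Fin k → ℝ) → Fin n → ℂ}
    (hF : ContDiff ℝ ∞ F) (I : Fin m → Fin k) : ContDiff ℝ ∞ (pullbackCoord α F I) :=
  contDiff_form_apply (r := ⊤) (hα.comp hF) fun i =>
    (hF.fderiv_right (m := ∞) (by simp)).clm_apply contDiff_const

/-- The integral of the pull-back of a form of top degree over the standard simplex. -/
def simplexIntegral (α : Form n m) (f : (Fin m → ℝ) → Fin n → ℂ) : ℂ :=
  ∫ x in cornerSimplex m, pullbackCoord α f id x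

/-- The integral of the pull-back of a form of top degree over the product of the unit interval and
the standard simplex. -/
def prismIntegral (α : Form n (m + 1)) (G : (Fin (m + 1) → ℝ) → Fin n → ℂ) : ℂ :=
  ∫ s in (0 : ℝ)..1, ∫ y in cornerSimplex m, pullbackCoord α G id (Fin.cons s y)

/-- The faces of the corner simplex. -/
def faceMap (i : Fin (m + 2)) (y : Fin m → ℝ) : Fin (m + 1) → ℝ :=
  Fin.cases (motive := fun _ => Fin (m + 1) → ℝ) (Fin.cons (1 - ∑ i, y i) y)
    (fun j => j.insertNth 0 y) i

/-- The product of the identity of the line and a face of the corner simplex. -/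
def prismFace (i : Fin (m + 2)) (u : Fin (m + 1) → ℝ) : Fin (m + 2) → ℝ :=
  Fin.cons (u 0) (faceMap i (Fin.tail u))

lemma fderiv_comp_affine {l : ℕ} {F : (Fin k → ℝ) → Fin n → ℂ} (hF : Differentiable ℝ F)
    {P : (Fin l → ℝ) → Fin k → ℝ} (L : (Fin l → ℝ) →ₗ[ℝ] (Fin k → ℝ)) (c : Fin k → ℝ)
    (hP : ∀ u, P u = L u + c) (u v : Fin l → ℝ) :
    fderiv ℝ (F ∘ P) u v = fderiv ℝ F (P u) (L v) := by
  have h : HasFDerivAt P (LinearMap.toContinuousLinearMap L) u := by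
    have := (LinearMap.toContinuousLinearMap L).hasFDerivAt (x := u) |>.add_const c
    exact this.congr_of_eventuallyEq (Filter.Eventually.of_forall fun u => hP u)
  rw [((hF _).hasFDerivAt.comp u h).fderiv]
  rfl

/-- Insertion of a zero coordinate. -/
def insertZero (j : Fin (k + 1)) : (Fin k → ℝ) →ₗ[ℝ] (Fin (k + 1) → ℝ) where
  toFun u := j.insertNth 0 u
  map_add' u v := by
    funext i
    refine Fin.succAboveCases j ?_ (fun i => ?_) i <;> simp
  map_smul' a v := by
    funext i
    refine Fin.succAboveCases j ?_ (fun i => ?_) i <;> simp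

lemma insertZero_single (j : Fin (k + 1)) (r : Fin k) :
    insertZero j (Pi.single r 1) = Pi.single (j.succAbove r) 1 := by
  funext i
  refine Fin.succAboveCases j ?_ (fun i => ?_) i
  · simp [insertZero]
  · simp only [insertZero, LinearMap.coe_mk, AddHom.coe_mk, Fin.insertNth_apply_succAbove]
    simp [Pi.single_apply]

lemma prismFace_succ (j : Fin (m + 1)) (u : Fin (m + 1) → ℝ) :
    prismFace j.succ u = insertZero j.succ u := by
  simp only [prismFace, faceMap, Fin.cases_succ, insertZero, LinearMap.coe_mk, AddHom.coe_mk]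
  funext i
  refine Fin.succAboveCases j.succ ?_ (fun i => ?_) i
  · simp
  · rw [Fin.insertNth_apply_succAbove]
    refine Fin.cases ?_ (fun i => ?_) i <;> simp [Fin.tail]

/-- The linear part of the product of the line and the slanted face. -/
def slantedLinear (m : ℕ) : (Fin (m + 1) → ℝ) →ₗ[ℝ] (Fin (m + 2) → ℝ) where
  toFun u := Fin.cons (u 0) (Fin.cons (-∑ i, Fin.tail u i) (Fin.tail u) : Fin (m + 1) → ℝ)
  map_add' u v := by
    funext i
    refine Fin.cases ?_ (fun i => Fin.cases ?_ (fun i => ?_) i) i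
    · simp
    · simp [Fin.tail, Finset.sum_add_distrib]; ring
    · simp [Fin.tail]
  map_smul' a v := by
    funext i
    refine Fin.cases ?_ (fun i => Fin.cases ?_ (fun i => ?_) i) i
    · simp
    · simp [Fin.tail, Finset.mul_sum]
    · simp [Fin.tail]

lemma prismFace_zero (u : Fin (m + 1) → ℝ) :
    prismFace 0 u = slantedLinear m u + Pi.single 1 1 := by
  simp only [prismFace, faceMap, Fin.cases_zero, slantedLinear, LinearMap.coe_mk, AddHom.coe_mk]
  funext i
  refine Fin.cases ?_ (fun i => Fin.cases ?_ (fun i => ?_) i) i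
  · simp
  · simp; ring
  · simp [Fin.ext_iff]

lemma slantedLinear_single_zero : slantedLinear m (Pi.single 0 1) = Pi.single 0 1 := by
  funext i
  refine Fin.cases ?_ (fun i => Fin.cases ?_ (fun i => ?_) i) i <;> simp [slantedLinear, Fin.tail]

lemma slantedLinear_single_succ (r : Fin m) :
    slantedLinear m (Pi.single r.succ 1) = Pi.single r.succ.succ 1 - Pi.single 1 1 := by
  funext i
  refine Fin.cases ?_ (fun i => Fin.cases ?_ (fun i => ?_) i) i
  · simp [slantedLinear, Fin.ext_iff]
  · have h : (Fin.tail (Pi.single r.succ 1 : Fin (m + 1) → ℝ) : Fin m → ℝ) = Pi.single r 1 := by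
      funext i
      simp [Fin.tail, Pi.single_apply]
    simp [slantedLinear, h, Fin.ext_iff]
  · simp [slantedLinear, Fin.tail, Pi.single_apply, Fin.ext_iff]

lemma contDiff_prismFace (i : Fin (m + 2)) : ContDiff ℝ ∞ (prismFace i) := by
  refine Fin.cases ?_ (fun j => ?_) i
  · rw [funext prismFace_zero]
    exact (LinearMap.toContinuousLinearMap (slantedLinear m)).contDiff.add contDiff_const
  · rw [funext (prismFace_succ j)]
    exact (LinearMap.toContinuousLinearMap (insertZero j.succ)).contDiff

lemma pullbackCoord_prismFace_succ {α : Form n (m + 1)} {F : (Fin (m + 2) → ℝ) → Fin n → ℂ}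
    (hF : Differentiable ℝ F) (j : Fin (m + 1)) (u : Fin (m + 1) → ℝ) :
    pullbackCoord α (F ∘ prismFace j.succ) id u =
      pullbackCoord α F j.succ.succAbove (prismFace j.succ u) := by
  simp only [pullbackCoord, Function.comp_apply]
  congr 1
  funext r
  rw [fderiv_comp_affine hF (insertZero j.succ) 0 (fun u => by rw [prismFace_succ, add_zero]),
    insertZero_single]
  rfl

/-- The tangent vectors of the slanted face are differences of coordinate vectors, so
`map_edges_eq_sum_faces` applies after contraction with the time direction. -/
lemma pullbackCoord_prismFace_zero {α : Form n (m + 1)} {F : (Fin (m + 2) → ℝ) → Fin n → ℂ}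
    (hF : Differentiable ℝ F) (u : Fin (m + 1) → ℝ) :
    pullbackCoord α (F ∘ prismFace 0) id u =
      ∑ j : Fin (m + 1), (-1 : ℂ) ^ (j : ℕ) *
        pullbackCoord α F j.succ.succAbove (prismFace 0 u) := by
  set p := prismFace 0 u with hp
  set v : Fin (m + 2) → Fin n → ℂ := fun i => fderiv ℝ F p (Pi.single i 1) with hv
  have h := map_edges_eq_sum_faces ((α (F p)).toAlternatingMap.curryLeft (v 0)) (Fin.tail v)
  simp only [AlternatingMap.curryLeft_apply_apply] at h
  refine Eq.trans ?_ (h.trans ?_)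
  · simp only [pullbackCoord, Function.comp_apply, ← hp]
    refine congrArg (α (F p)) ?_
    funext r
    rw [fderiv_comp_affine hF (slantedLinear m) (Pi.single 1 1) prismFace_zero, ← hp]
    refine Fin.cases ?_ (fun r => ?_) r
    · simp [slantedLinear_single_zero, hv]
    · simp [slantedLinear_single_succ, hv, Fin.tail]
  · refine Finset.sum_congr rfl fun j _ => ?_
    congr 1
    simp only [pullbackCoord]
    refine congrArg (α (F p)) ?_
    funext r
    refine Fin.cases ?_ (fun r => ?_) r <;> simp [hv, Fin.tail]

end Smoothness

end

section

/-! ### The homotopy formula -/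

section Homotopy

variable {n m : ℕ}

lemma cons_eq_insertZero_add {k : ℕ} (s : ℝ) (x : Fin k → ℝ) :
    (Fin.cons s x : Fin (k + 1) → ℝ) = insertZero 0 x + Pi.single 0 s := by
  funext i
  refine Fin.cases ?_ (fun i => ?_) i <;> simp [insertZero, Fin.insertNth_zero']

lemma hasDerivAt_cons {k : ℕ} (x : Fin k → ℝ) (s : ℝ) :
    HasDerivAt (fun s : ℝ => (Fin.cons s x : Fin (k + 1) → ℝ)) (Pi.single 0 1) s := by
  simpa only [Fin.insertNth_zero'] using hasDerivAt_insertNth 0 x s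

lemma continuous_cons {k : ℕ} :
    Continuous fun p : ℝ × (Fin k → ℝ) => (Fin.cons p.1 p.2 : Fin (k + 1) → ℝ) := by
  refine continuous_pi fun i => Fin.cases ?_ (fun i => ?_) i
  · simpa using continuous_fst
  · simp only [Fin.cons_succ]
    exact (continuous_apply i).comp continuous_snd

/-- This is `d(F^*α) = F^*(dα) = 0` evaluated on coordinate vectors. -/
lemma sum_fderiv_pullbackCoord {k : ℕ} {α : Form n m} (hα : ContDiff ℝ ∞ α)
    (hd : extDeriv α = 0) {F : (Fin k → ℝ) → Fin n → ℂ} (hF : ContDiff ℝ ∞ F)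
    (I : Fin (m + 1) → Fin k) (u : Fin k → ℝ) :
    ∑ i : Fin (m + 1), (-1 : ℂ) ^ (i : ℕ) *
      fderiv ℝ (pullbackCoord α F (I ∘ i.succAbove)) u (Pi.single (I i) 1) = 0 := by
  have h := extDeriv_pullback (hα.differentiable (by simp) (F u)) (hF.contDiffAt (x := u))
    (by simpa [minSmoothness_of_isRCLikeNormedField] using WithTop.coe_le_coe.2 (le_top (a := (2 : ℕ∞))))
  have h2 := DFunLike.congr_fun h fun i => Pi.single (I i) (1 : ℝ)
  have hsm : DifferentiableAt ℝ (fun x => (α (F x)).compContinuousLinearMap (fderiv ℝ F x)) u :=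
    ((hα.comp hF).differentiable (by simp) u).continuousAlternatingMapCompContinuousLinearMap
      ((hF.fderiv_right (m := ∞) (by simp)).differentiable (by simp) u)
  rw [extDeriv_apply (hsm)] at h2
  rw [hd] at h2
  refine Eq.trans (Finset.sum_congr rfl fun i _ => ?_) h2
  rw [zsmul_eq_mul]
  push_cast
  rfl

lemma fderiv_cons_right {k : ℕ} {G : (Fin (k + 1) → ℝ) → ℂ} (hG : Differentiable ℝ G) (s : ℝ)
    (x : Fin k → ℝ) (j : Fin k) :
    fderiv ℝ (fun x => G (Fin.cons s x)) x (Pi.single j 1) =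
      fderiv ℝ G (Fin.cons s x) (Pi.single j.succ 1) := by
  have h : HasFDerivAt (fun x : Fin k → ℝ => (Fin.cons s x : Fin (k + 1) → ℝ))
      (LinearMap.toContinuousLinearMap (insertZero 0)) x := by
    rw [funext (cons_eq_insertZero_add s)]
    exact (LinearMap.toContinuousLinearMap (insertZero 0)).hasFDerivAt.add_const _
  have h' : HasFDerivAt (fun x => G (Fin.cons s x)) _ x := (hG _).hasFDerivAt.comp x h
  rw [h'.fderiv]
  exact congrArg _ (insertZero_single 0 j)

lemma contDiff_cons_right {k : ℕ} (s : ℝ) :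
    ContDiff ℝ ∞ (fun x : Fin k → ℝ => (Fin.cons s x : Fin (k + 1) → ℝ)) := by
  rw [funext (cons_eq_insertZero_add s)]
  exact (LinearMap.toContinuousLinearMap (insertZero 0)).contDiff.add contDiff_const

lemma pullbackCoord_comp_cons {k : ℕ} {α : Form n k} {F : (Fin (k + 1) → ℝ) → Fin n → ℂ}
    (hF : Differentiable ℝ F) (s : ℝ) (x : Fin k → ℝ) :
    pullbackCoord α (fun x => F (Fin.cons s x)) id x =
      pullbackCoord α F Fin.succ (Fin.cons s x) := by
  simp only [pullbackCoord]
  congr 1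
  funext r
  have := fderiv_comp_affine (P := fun x => (Fin.cons s x : Fin (k + 1) → ℝ)) hF
    (insertZero 0) (Pi.single 0 s) (cons_eq_insertZero_add s) x (Pi.single r 1)
  rw [insertZero_single] at this
  exact this

lemma continuous_integral_cons {g : (Fin (m + 1) → ℝ) → ℂ} (hg : Continuous g) :
    Continuous fun s : ℝ => ∫ y in cornerSimplex m, g (Fin.cons s y) :=
  continuous_parametric_integral_of_continuous
    (f := fun (s : ℝ) (y : Fin m → ℝ) => g (Fin.cons s y)) (hg.comp continuous_cons)
    (isCompact_cornerSimplex m)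

lemma setIntegral_cons_sub {g : (Fin (m + 1) → ℝ) → ℂ} (hg : ContDiff ℝ 1 g) :
    ∫ x in cornerSimplex m, (g (Fin.cons 1 x) - g (Fin.cons 0 x)) =
      ∫ s in (0 : ℝ)..1, ∫ x in cornerSimplex m, fderiv ℝ g (Fin.cons s x) (Pi.single 0 1) := by
  have hc : Continuous fun x => fderiv ℝ g x (Pi.single 0 1) :=
    (hg.continuous_fderiv one_ne_zero).clm_apply continuous_const
  have hc2 := hc.comp (continuous_cons (k := m))
  rw [intervalIntegral_integral_swap]
  · refine setIntegral_congr_fun (measurableSet_cornerSimplex _) fun x _ => ?_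
    refine (intervalIntegral.integral_eq_sub_of_hasDerivAt (f := fun t => g (Fin.cons t x))
      (fun t _ => ?_) ?_).symm
    · exact ((hg.differentiable one_ne_zero _).hasFDerivAt).comp_hasDerivAt t
        (hasDerivAt_cons x t)
    · exact (hc2.comp (continuous_id.prodMk continuous_const)).intervalIntegrable _ _
  · rw [Measure.prod_restrict, ← Measure.volume_eq_prod]
    refine IntegrableOn.mono_set (t := Set.uIcc (0 : ℝ) 1 ×ˢ cornerSimplex m) ?_
      (Set.prod_mono Set.uIoc_subset_uIcc subset_rfl)
    exact hc2.continuousOn.integrableOn_compact (isCompact_uIcc.prod (isCompact_cornerSimplex m))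

/-- Closedness trades the time derivative for derivatives along the simplex. Each of these
integrates to a slanted face minus a coordinate face, and the slanted contributions of all
directions combine into the single face `0`. -/
lemma setIntegral_fderiv_cons {α : Form n (m + 1)} (hα : ContDiff ℝ ∞ α) (hd : extDeriv α = 0)
    {F : (Fin (m + 2) → ℝ) → Fin n → ℂ} (hF : ContDiff ℝ ∞ F) (s : ℝ) :
    ∫ x in cornerSimplex (m + 1), fderiv ℝ (pullbackCoord α F Fin.succ) (Fin.cons s x)
        (Pi.single 0 1) =
      ∑ i : Fin (m + 2), (-1 : ℂ) ^ (i : ℕ) *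
        ∫ y in cornerSimplex m, pullbackCoord α (F ∘ prismFace i) id (Fin.cons s y) := by
  have hFd : Differentiable ℝ F := hF.differentiable (by simp)
  have hg : ∀ j : Fin (m + 1), ContDiff ℝ ∞ (pullbackCoord α F j.succ.succAbove) := fun j =>
    contDiff_pullbackCoord hα hF _
  have hgs : ∀ j : Fin (m + 1), ContDiff ℝ 1 fun x => pullbackCoord α F j.succ.succAbove
      (Fin.cons s x) := fun j => ((hg j).comp (contDiff_cons_right s)).of_le (by simp)
  have h1 : ∀ x : Fin (m + 1) → ℝ, fderiv ℝ (pullbackCoord α F Fin.succ) (Fin.cons s x)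
      (Pi.single 0 1) = ∑ j : Fin (m + 1), (-1 : ℂ) ^ (j : ℕ) *
        fderiv ℝ (fun x => pullbackCoord α F j.succ.succAbove (Fin.cons s x)) x
          (Pi.single j 1) := by
    intro x
    have h := sum_fderiv_pullbackCoord hα hd hF id (Fin.cons s x)
    rw [Fin.sum_univ_succ] at h
    simp only [Fin.val_zero, pow_zero, one_mul, Function.id_comp, Fin.succAbove_zero, id] at h
    rw [eq_neg_of_add_eq_zero_left h, ← Finset.sum_neg_distrib]
    refine Finset.sum_congr rfl fun j _ => ?_
    rw [fderiv_cons_right ((hg j).differentiable (by simp)), Fin.val_succ, pow_succ]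
    ring
  have hint : ∀ {f : (Fin m → ℝ) → ℂ}, Continuous f → IntegrableOn f (cornerSimplex m) :=
    fun hf => hf.continuousOn.integrableOn_compact (isCompact_cornerSimplex _)
  have hslant : Continuous fun y : Fin m → ℝ => (Fin.cons (1 - ∑ i, y i) y : Fin (m + 1) → ℝ) :=
    continuous_cons.comp ((continuous_const.sub
      (continuous_finsetSum _ fun i _ => continuous_apply i)).prodMk continuous_id)
  have hins : ∀ j : Fin (m + 1), Continuous fun y : Fin m → ℝ =>
      (j.insertNth 0 y : Fin (m + 1) → ℝ) := fun j =>
    (LinearMap.toContinuousLinearMap (insertZero j)).continuous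
  simp only [h1]
  rw [integral_finsetSum, Fin.sum_univ_succ (n := m + 1)]
  · have h2 : ∀ y : Fin m → ℝ, pullbackCoord α (F ∘ prismFace 0) id (Fin.cons s y) =
        ∑ j : Fin (m + 1), (-1 : ℂ) ^ (j : ℕ) * pullbackCoord α F j.succ.succAbove
          (Fin.cons s (Fin.cons (1 - ∑ i, y i) y : Fin (m + 1) → ℝ)) := fun y =>
      pullbackCoord_prismFace_zero hFd (Fin.cons s y)
    have h3 : ∀ (j : Fin (m + 1)) (y : Fin m → ℝ),
        pullbackCoord α (F ∘ prismFace j.succ) id (Fin.cons s y) =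
          pullbackCoord α F j.succ.succAbove (Fin.cons s (j.insertNth 0 y)) := fun j y =>
      pullbackCoord_prismFace_succ hFd j (Fin.cons s y)
    simp only [h2, h3, Fin.val_zero, pow_zero, one_mul, Fin.val_succ]
    rw [integral_finsetSum, ← Finset.sum_add_distrib]
    · refine Finset.sum_congr rfl fun j _ => ?_
      rw [integral_const_mul, integral_const_mul, setIntegral_cornerSimplex_fderiv j (hgs j),
        integral_sub, setIntegral_slanted_face j fun x => pullbackCoord α F j.succ.succAbove
          (Fin.cons s x), pow_succ]
      · ring
      · exact hint ((hgs j).continuous.comp (Continuous.finInsertNth j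
          (continuous_const.sub (continuous_finsetSum _ fun i _ => continuous_apply i))
          continuous_id))
      · exact hint ((hgs j).continuous.comp (hins j))
    · exact fun j _ => (hint ((hgs j).continuous.comp hslant)).const_mul _
  · exact fun j _ => (((hgs j).continuous_fderiv one_ne_zero).clm_apply
      continuous_const).continuousOn.integrableOn_compact (isCompact_cornerSimplex _) |>.const_mul _

/-- The homotopy formula for closed forms. -/
lemma simplexIntegral_sub {α : Form n (m + 1)} (hα : ContDiff ℝ ∞ α) (hd : extDeriv α = 0)
    {F : (Fin (m + 2) → ℝ) → Fin n → ℂ} (hF : ContDiff ℝ ∞ F) :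
    simplexIntegral α (fun x => F (Fin.cons 1 x)) - simplexIntegral α (fun x => F (Fin.cons 0 x)) =
      ∑ i : Fin (m + 2), (-1 : ℂ) ^ (i : ℕ) * prismIntegral α (F ∘ prismFace i) := by
  have hFd : Differentiable ℝ F := hF.differentiable (by simp)
  have hg := contDiff_pullbackCoord hα hF Fin.succ
  have hint : ∀ s : ℝ, IntegrableOn (fun x => pullbackCoord α F Fin.succ (Fin.cons s x))
      (cornerSimplex (m + 1)) := fun s =>
    (hg.comp (contDiff_cons_right s)).continuous.continuousOn.integrableOn_compact
      (isCompact_cornerSimplex _)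
  simp only [simplexIntegral, pullbackCoord_comp_cons hFd]
  rw [← integral_sub (hint 1) (hint 0), setIntegral_cons_sub (hg.of_le (by simp))]
  simp only [setIntegral_fderiv_cons hα hd hF, prismIntegral]
  rw [intervalIntegral.integral_finsetSum]
  · simp only [intervalIntegral.integral_const_mul]
  · exact fun i _ => (continuous_const.mul (continuous_integral_cons
      (contDiff_pullbackCoord hα (hF.comp (contDiff_prismFace i)) id).continuous)).intervalIntegrable
        _ _

end Homotopy

end

section

open Simplicial

variable {n m : ℕ}

/-! ### Barycentric coordinates on the corner simplex -/

/-- The barycentric coordinates of a point of the corner simplex. -/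
def baryCoords (y : Fin m → ℝ) : Fin (m + 1) → ℝ := Fin.cons (1 - ∑ i, y i) y

@[simp] lemma baryCoords_succ (y : Fin m → ℝ) (j : Fin m) : baryCoords y j.succ = y j := rfl

lemma sum_baryCoords (y : Fin m → ℝ) : ∑ i, baryCoords y i = 1 := by
  simp [baryCoords, Fin.sum_univ_succ]

lemma baryCoords_mem {y : Fin m → ℝ} (hy : y ∈ cornerSimplex m) :
    baryCoords y ∈ stdSimplex ℝ (Fin (m + 1)) :=
  ⟨fun i => Fin.cases (sub_nonneg.2 hy.2) (fun j => hy.1 j) i, sum_baryCoords y⟩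

lemma baryCoords_tail {t : Fin (m + 1) → ℝ} (ht : ∑ i, t i = 1) :
    baryCoords (fun j => t j.succ) = t := by
  funext i
  refine Fin.cases ?_ (fun j => rfl) i
  rw [Fin.sum_univ_succ] at ht
  simp only [baryCoords, Fin.cons_zero]
  linarith

lemma baryCoords_faceMap (i : Fin (m + 2)) (y : Fin m → ℝ) :
    baryCoords (faceMap i y) = i.insertNth 0 (baryCoords y) := by
  refine Fin.cases ?_ (fun j => ?_) i
  · have h : faceMap 0 y = baryCoords y := rfl
    rw [h, baryCoords, sum_baryCoords, sub_self, Fin.insertNth_zero']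
  · have h : faceMap j.succ y = j.insertNth 0 y := rfl
    rw [h]
    funext l
    refine Fin.succAboveCases j.succ ?_ (fun l => ?_) l
    · simp
    · rw [Fin.insertNth_apply_succAbove]
      refine Fin.cases ?_ (fun l => ?_) l
      · simp [baryCoords, Fin.sum_univ_succAbove _ j]
      · simp

lemma stdSimplex_map_succAbove (i : Fin (m + 2)) (t : stdSimplex ℝ (Fin (m + 1)))
    (l : Fin (m + 2)) : (stdSimplex.map i.succAbove t) l =
      (i.insertNth 0 (fun j => t j) : Fin (m + 2) → ℝ) l := by
  classical
  rw [stdSimplex.map_coe, FunOnFinite.linearMap_apply_apply]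
  refine Fin.succAboveCases i ?_ (fun l => ?_) l
  · simp [Fin.succAbove_ne]
  · simp [Finset.sum_filter]

/-- The affine map from the corner simplex with given images of the vertices. -/
def affineParam (x : Fin (m + 1) → Fin n → ℂ) (y : Fin m → ℝ) : Fin n → ℂ :=
  ∑ i, baryCoords y i • x i

lemma affineParam_faceMap (x : Fin (m + 2) → Fin n → ℂ) (i : Fin (m + 2)) (y : Fin m → ℝ) :
    affineParam x (faceMap i y) = affineParam (x ∘ i.succAbove) y := by
  simp [affineParam, baryCoords_faceMap, Fin.sum_univ_succAbove _ i]

lemma affineParam_add (x : Fin (m + 1) → Fin n → ℂ) (γ : Fin n → ℂ) (y : Fin m → ℝ) :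
    affineParam (fun i => x i + γ) y = affineParam x y + γ := by
  simp only [affineParam, smul_add, Finset.sum_add_distrib, ← Finset.sum_smul, sum_baryCoords,
    one_smul]

lemma affineParam_eq (x : Fin (m + 1) → Fin n → ℂ) (y : Fin m → ℝ) :
    affineParam x y = ∑ j, y j • (x j.succ - x 0) + x 0 := by
  simp only [affineParam, Fin.sum_univ_succ, baryCoords_succ, smul_sub, Finset.sum_sub_distrib,
    ← Finset.sum_smul]
  simp only [baryCoords, Fin.cons_zero, sub_smul, one_smul]
  abel

/-- The linear part of `affineParam`. -/
def affineParamLinear (x : Fin (m + 1) → Fin n → ℂ) : (Fin m → ℝ) →ₗ[ℝ] (Fin n → ℂ) :=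
  Fintype.linearCombination ℝ fun j => x j.succ - x 0

lemma affineParam_eq_linear (x : Fin (m + 1) → Fin n → ℂ) (y : Fin m → ℝ) :
    affineParam x y = LinearMap.toContinuousLinearMap (affineParamLinear x) y + x 0 :=
  affineParam_eq x y

lemma contDiff_affineParam (x : Fin (m + 1) → Fin n → ℂ) : ContDiff ℝ ∞ (affineParam x) := by
  rw [funext (affineParam_eq_linear x)]
  exact (ContinuousLinearMap.contDiff _).add contDiff_const

lemma fderiv_affineParam (x : Fin (m + 1) → Fin n → ℂ) (y : Fin m → ℝ) (j : Fin m) :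
    fderiv ℝ (affineParam x) y (Pi.single j 1) = x j.succ - x 0 := by
  rw [funext (affineParam_eq_linear x), fderiv_add_const, ContinuousLinearMap.fderiv]
  simp [affineParamLinear, Fintype.linearCombination_apply_single]

/-- The vertices of the corner simplex. -/
def cornerVertex (m : ℕ) (i : Fin (m + 1)) : Fin m → ℝ :=
  fun j => (stdSimplex.vertex i : stdSimplex ℝ (Fin (m + 1))) j.succ

lemma cornerVertex_mem (i : Fin (m + 1)) : cornerVertex m i ∈ cornerSimplex m := by
  have h := (stdSimplex.vertex i : stdSimplex ℝ (Fin (m + 1))).2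
  refine ⟨fun j => h.1 _, ?_⟩
  have h2 := h.2
  rw [Fin.sum_univ_succ] at h2
  have h0 := h.1 0
  change ∑ j : Fin m, (stdSimplex.vertex i : stdSimplex ℝ (Fin (m + 1))).1 j.succ ≤ 1
  linarith

lemma baryCoords_injective : Function.Injective (baryCoords (m := m)) := fun _ _ h =>
  funext fun j => congrFun h j.succ

lemma baryCoords_cornerVertex (i : Fin (m + 1)) :
    baryCoords (cornerVertex m i) = fun j => (stdSimplex.vertex i : stdSimplex ℝ (Fin (m + 1))) j :=
  baryCoords_tail (stdSimplex.vertex i : stdSimplex ℝ (Fin (m + 1))).2.2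

lemma faceMap_cornerVertex (i : Fin (m + 2)) (l : Fin (m + 1)) :
    faceMap i (cornerVertex m l) = cornerVertex (m + 1) (i.succAbove l) := by
  refine baryCoords_injective ?_
  rw [baryCoords_faceMap, baryCoords_cornerVertex, baryCoords_cornerVertex,
    ← stdSimplex.map_vertex]
  funext j
  rw [stdSimplex_map_succAbove]

lemma contDiff_faceMap (i : Fin (m + 2)) : ContDiff ℝ ∞ (faceMap (m := m) i) := by
  have h : faceMap (m := m) i = fun y => Fin.tail (prismFace i (Fin.cons 0 y)) := by
    funext y
    simp [prismFace]
  rw [h]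
  have h1 := (contDiff_prismFace i).comp (contDiff_cons_right (k := m) 0)
  exact contDiff_pi.2 fun j => contDiff_pi.1 h1 j.succ

/-! ### The singular chain of a smooth chain -/

/-- The faces of a smooth simplex. -/
def SmoothSimplex.face (f : SmoothSimplex n (m + 1)) (i : Fin (m + 2)) : SmoothSimplex n m :=
  ⟨f.1 ∘ faceMap i, f.2.comp (contDiff_faceMap i)⟩

variable {Γ : AddSubgroup (Fin n → ℂ)}

/-- The continuous simplex in `ℂⁿ` given by a smooth simplex. -/
def SmoothSimplex.toContinuous (f : SmoothSimplex n m) :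
    C(stdSimplex ℝ (Fin (m + 1)), Fin n → ℂ) where
  toFun t := f.1 fun j => t j.succ
  continuous_toFun := f.2.continuous.comp
    (continuous_pi fun j => continuous_stdSimplex_apply j.succ)

lemma toSingular_eq_project (f : SmoothSimplex n m) :
    f.toSingular Γ = project Γ (.op ⦋m⦌) f.toContinuous := rfl

lemma toChain_eq_simplexChain (f : SmoothSimplex n m) :
    f.toChain Γ = simplexChain (TopCat.toSSet.obj (Torus Γ)) (f.toSingular Γ) := rfl

lemma δ_toSingular (f : SmoothSimplex n (m + 1)) (i : Fin (m + 2)) :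
    (TopCat.toSSet.obj (Torus Γ)).δ i (f.toSingular Γ) = (f.face i).toSingular Γ := by
  rw [toSingular_eq_project, toSingular_eq_project]
  refine (map_project _ _).trans ?_
  congr 1
  ext1 t
  change f.1 (fun j => (stdSimplex.map i.succAbove t) j.succ) =
    f.1 (faceMap i fun j => t j.succ)
  refine congrArg f.1 ?_
  have h : ∀ j : Fin (m + 1), faceMap i (fun j => t j.succ) j =
      baryCoords (faceMap i fun j => t j.succ) j.succ := fun j => rfl
  funext j
  rw [h, baryCoords_faceMap, baryCoords_tail (t := fun j => t j) t.2.2, stdSimplex_map_succAbove]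

lemma exists_add_of_toSingular_eq [DiscreteTopology Γ] {f g : SmoothSimplex n m}
    (h : f.toSingular Γ = g.toSingular Γ) :
    ∃ γ ∈ Γ, ∀ y ∈ cornerSimplex m, g.1 y = f.1 y + γ := by
  rw [toSingular_eq_project, toSingular_eq_project] at h
  obtain ⟨γ, hγ, h⟩ := project_eq_iff.1 h
  exact ⟨γ, hγ, fun y hy => h (⟨baryCoords y, baryCoords_mem hy⟩ : stdSimplex ℝ (Fin (m + 1)))⟩

lemma SmoothChain.toSingular_eq_sum (c : SmoothChain n m) :
    c.toSingular Γ = ∑ f ∈ c.support, c f • f.toChain Γ := rfl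

/-- The chain is closed only as a singular chain: cancelling faces may come from different smooth
maps. As `K` sees only the underlying singular simplex, it descends to a cochain, extended by zero
to nonsmooth simplices, and this cochain is evaluated on `∂c = 0`. -/
lemma sum_face_eq_zero (K : SmoothSimplex n m → ℂ)
    (hK : ∀ f g : SmoothSimplex n m, f.toSingular Γ = g.toSingular Γ → K f = K g)
    {c : SmoothChain n (m + 1)} {S : singularHomology Γ (m + 1)} (hc : c.Represents Γ S) :
    c.sum (fun f a => (a : ℂ) * ∑ i : Fin (m + 2), (-1 : ℂ) ^ (i : ℕ) * K (f.face i)) = 0 := by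
  classical
  have hd := IsCycleIn.d_eq_zero (w := c.toSingular Γ) (S := S) hc m
  let κ : (singularChains Γ).X m →ₗ[ℤ] ℂ := chainDesc fun σ =>
    if h : ∃ f : SmoothSimplex n m, f.toSingular Γ = σ then K h.choose else 0
  have hκ : ∀ f : SmoothSimplex n m, κ (f.toChain Γ) = K f := by
    intro f
    have h : ∃ g : SmoothSimplex n m, g.toSingular Γ = f.toSingular Γ := ⟨f, rfl⟩
    refine (chainDesc_simplexChain _ _).trans ?_
    rw [dif_pos h]
    exact hK _ _ h.choose_spec
  have hκd : ∀ f : SmoothSimplex n (m + 1),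
      κ (((singularChains Γ).d (m + 1) m).hom (f.toChain Γ)) =
        ∑ i : Fin (m + 2), (-1 : ℂ) ^ (i : ℕ) * K (f.face i) := by
    intro f
    rw [toChain_eq_simplexChain, d_simplexChain, map_sum]
    refine Finset.sum_congr rfl fun i _ => ?_
    rw [map_zsmul, δ_toSingular, ← toChain_eq_simplexChain, hκ, zsmul_eq_mul]
    push_cast
    rfl
  have h := congrArg κ hd
  rw [SmoothChain.toSingular_eq_sum, map_sum, map_sum, map_zero] at h
  refine Eq.trans (Finset.sum_congr rfl fun f _ => ?_) h
  rw [map_zsmul, map_zsmul, hκd, zsmul_eq_mul]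

/-! ### Homotopy invariance of integrals of closed forms over cycles -/

/-- The maps are compared only over the closed simplex, so derivatives are controlled only over its
interior. This suffices because the boundary of a convex set is null. -/
lemma prismIntegral_congr {α : Form n (m + 1)} (hα : ∀ γ ∈ Γ, ∀ x, α (x + γ) = α x)
    {G G' : (Fin (m + 1) → ℝ) → Fin n → ℂ} {γ : Fin n → ℂ} (hγ : γ ∈ Γ)
    (h : ∀ s, ∀ y ∈ cornerSimplex m, G' (Fin.cons s y) = G (Fin.cons s y) + γ) :
    prismIntegral α G = prismIntegral α G' := by
  have hae : (interior (cornerSimplex m) : Set (Fin m → ℝ)) =ᵐ[volume] cornerSimplex m :=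
    interior_ae_eq_of_null_frontier ((convex_cornerSimplex m).addHaar_frontier volume)
  rw [prismIntegral, prismIntegral]
  congr 1
  funext s
  rw [← setIntegral_congr_set hae, ← setIntegral_congr_set hae]
  refine setIntegral_congr_fun measurableSet_interior fun y hy => ?_
  have hev : G' =ᶠ[nhds (Fin.cons s y)] fun u => G u + γ := by
    have hopen : IsOpen ((fun u : Fin (m + 1) → ℝ => (Fin.tail u : Fin m → ℝ)) ⁻¹'
        interior (cornerSimplex m)) :=
      isOpen_interior.preimage (continuous_pi fun j => continuous_apply j.succ)
    filter_upwards [hopen.mem_nhds (show (Fin.cons s y : Fin (m + 1) → ℝ) ∈ _ by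
      simpa using hy)] with u hu
    have := h (u 0) (Fin.tail u) (interior_subset hu)
    rwa [Fin.cons_self_tail] at this
  simp only [pullbackCoord, hev.fderiv_eq, fderiv_add_const, hev.eq_of_nhds, hα γ hγ]

/-- Integrals of closed forms over cycles are invariant under natural deformations of the smooth
simplices. -/
theorem integral_eq_of_deformation [DiscreteTopology Γ] {α : Form n (m + 1)}
    (hα : ContDiff ℝ ∞ α) (hd : extDeriv α = 0) (hΓ : ∀ γ ∈ Γ, ∀ x, α (x + γ) = α x)
    (H : ∀ k, SmoothSimplex n k → SmoothSimplex n (k + 1))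
    (hface : ∀ (f : SmoothSimplex n (m + 1)) (i : Fin (m + 2)),
      (H (m + 1) f).1 ∘ prismFace i = (H m (f.face i)).1)
    (hadd : ∀ f g : SmoothSimplex n m, ∀ γ ∈ Γ, (∀ y ∈ cornerSimplex m, g.1 y = f.1 y + γ) →
      ∀ s, ∀ y ∈ cornerSimplex m, (H m g).1 (Fin.cons s y) = (H m f).1 (Fin.cons s y) + γ)
    {c : SmoothChain n (m + 1)} {S : singularHomology Γ (m + 1)} (hc : c.Represents Γ S) :
    c.sum (fun f a => (a : ℂ) * simplexIntegral α fun x => (H (m + 1) f).1 (Fin.cons 1 x)) =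
      c.sum fun f a => (a : ℂ) * simplexIntegral α fun x => (H (m + 1) f).1 (Fin.cons 0 x) := by
  rw [← sub_eq_zero, ← Finsupp.sum_sub]
  refine Eq.trans (Finset.sum_congr rfl fun f _ => ?_)
    (sum_face_eq_zero (fun f => prismIntegral α (H m f).1) (fun f g h => ?_) hc)
  · simp only
    rw [← mul_sub, simplexIntegral_sub hα hd (H (m + 1) f).2]
    simp only [hface]
  · obtain ⟨γ, hγ, h⟩ := exists_add_of_toSingular_eq h
    exact prismIntegral_congr hΓ hγ (hadd f g γ hγ h)

lemma smooth_tail {f : (Fin m → ℝ) → Fin n → ℂ} (hf : ContDiff ℝ ∞ f) :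
    ContDiff ℝ ∞ fun u : Fin (m + 1) → ℝ => f (Fin.tail u) :=
  hf.comp (contDiff_pi.2 fun j => contDiff_apply ℝ ℝ j.succ)

/-- The integral of a closed form over a cycle does not change under translations. -/
theorem integral_translate [DiscreteTopology Γ] {α : Form n (m + 1)} (hα : ContDiff ℝ ∞ α)
    (hd : extDeriv α = 0) (hΓ : ∀ γ ∈ Γ, ∀ x, α (x + γ) = α x) (v : Fin n → ℂ)
    {c : SmoothChain n (m + 1)} {S : singularHomology Γ (m + 1)} (hc : c.Represents Γ S) :
    c.integral (fun x => α (x + v)) = c.integral α := by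
  have h := integral_eq_of_deformation hα hd hΓ
    -- Each simplex slides along `v`: at time `1` its integral is that of the translated form.
    (fun k f => ⟨fun u => f.1 (Fin.tail u) + u 0 • v,
      (smooth_tail f.2).add ((contDiff_apply ℝ ℝ 0).smul contDiff_const)⟩)
    (fun f i => by
      funext u
      simp [SmoothSimplex.face, prismFace])
    (fun f g γ _ h s y hy => by
      simp only [Fin.tail_cons, Fin.cons_zero, h y hy]
      abel) hc
  simp only [Fin.tail_cons, Fin.cons_zero, one_smul, zero_smul, add_zero] at h
  refine Eq.trans ?_ h
  refine Finset.sum_congr rfl fun f _ => ?_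
  simp only [SmoothSimplex.integral, simplexIntegral, pullbackCoord, fderiv_add_const, id]

/-- The affine smooth simplex with given vertices. -/
def affineSmooth (x : Fin (m + 1) → Fin n → ℂ) : SmoothSimplex n m :=
  ⟨affineParam x, contDiff_affineParam x⟩

lemma simplexIntegral_affineParam (w : (Fin n → ℂ) [⋀^Fin m]→L[ℝ] ℂ)
    (x : Fin (m + 1) → Fin n → ℂ) : simplexIntegral (fun _ => w) (affineParam x) =
      volume.real (cornerSimplex m) * w fun i => x i.succ - x i.castSucc := by
  have h := map_edges_eq w.toAlternatingMap x
  simp only [simplexIntegral, pullbackCoord, fderiv_affineParam, id, setIntegral_const]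
  rw [Complex.real_smul]
  congr 1
  exact h.symm

lemma periodCochain_toChain [DiscreteTopology Γ] (w : (Fin n → ℂ) [⋀^Fin m]→ₗ[ℝ] ℂ)
    (f : SmoothSimplex n m) : periodCochain Γ w (f.toChain Γ) =
      w fun i => f.1 (cornerVertex m i.succ) - f.1 (cornerVertex m i.castSucc) := by
  rw [toChain_eq_simplexChain, toSingular_eq_project, periodCochain_simplexChain]
  rfl

lemma extDeriv_const_form (w : (Fin n → ℂ) [⋀^Fin m]→L[ℝ] ℂ) :
    extDeriv (fun _ : Fin n → ℂ => w) = 0 := by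
  ext x v
  simp [extDeriv, ContinuousAlternatingMap.alternatizeUncurryFin_apply]

/-- The integral of a constant form over a cycle. -/
theorem integral_const_form [DiscreteTopology Γ] (w : (Fin n → ℂ) [⋀^Fin (m + 1)]→L[ℝ] ℂ)
    {c : SmoothChain n (m + 1)} {S : singularHomology Γ (m + 1)} (hc : c.Represents Γ S) :
    c.integral (fun _ => w) =
      volume.real (cornerSimplex (m + 1)) * period Γ w.toAlternatingMap S := by
  have h := integral_eq_of_deformation (Γ := Γ) (α := fun _ => w) contDiff_const
    (extDeriv_const_form w) (fun _ _ _ => rfl)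
    -- The linear homotopy to the affine simplex with the same vertices. At time `1` the integrand
    -- is constant, equal to the form on the edges.
    (fun k f => ⟨fun u => (1 - u 0) • f.1 (Fin.tail u) +
      u 0 • affineParam (f.1 ∘ cornerVertex k) (Fin.tail u),
      ((contDiff_const.sub (contDiff_apply ℝ ℝ 0)).smul (smooth_tail f.2)).add
        ((contDiff_apply ℝ ℝ 0).smul (smooth_tail (contDiff_affineParam _)))⟩)
    (fun f i => by
      funext u
      simp only [SmoothSimplex.face, prismFace, Function.comp_apply, Fin.cons_zero, Fin.tail_cons,
        affineParam_faceMap]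
      congr 3
      funext l
      simp [faceMap_cornerVertex])
    (fun f g γ _ h s y hy => by
      have hv : g.1 ∘ cornerVertex m = fun i => (f.1 ∘ cornerVertex m) i + γ :=
        funext fun i => h _ (cornerVertex_mem i)
      simp only [Fin.tail_cons, Fin.cons_zero, h y hy, hv, affineParam_add]
      module) hc
  simp only [Fin.tail_cons, Fin.cons_zero, one_smul, zero_smul, add_zero, zero_add, sub_zero,
    sub_self] at h
  rw [period_eq _ hc, SmoothChain.toSingular_eq_sum, map_sum, Finset.mul_sum]
  refine Eq.trans h.symm (Finset.sum_congr rfl fun f _ => ?_)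
  simp only
  rw [simplexIntegral_affineParam, map_zsmul, periodCochain_toChain, zsmul_eq_mul]
  simp only [Function.comp_apply]
  exact mul_left_comm _ _ _

/-! ### Smooth representatives -/

lemma affineSmooth_toChain (x : Fin (m + 1) → Fin n → ℂ) :
    (affineSmooth x).toChain Γ = affineChain Γ m (tuple x) := by
  rw [affineChain_tuple, toChain_eq_simplexChain, toSingular_eq_project]
  congr 2
  ext1 t
  change ∑ i, baryCoords (fun j => t j.succ) i • x i = ∑ i, t i • x i
  rw [baryCoords_tail (t := fun j => t j) t.2.2]

lemma exists_toSingular_eq_affineChain (g : TupleChain (Fin n → ℂ) (m + 1)) :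
    ∃ c : SmoothChain n m, c.toSingular Γ = affineChain Γ m g := by
  refine ⟨Finsupp.mapDomain affineSmooth g, ?_⟩
  refine Eq.trans (Finset.sum_congr rfl fun f _ => ?_)
    (Finsupp.linearCombination_mapDomain ℤ (v' := fun f : SmoothSimplex n m => f.toChain Γ)
    affineSmooth g |>.trans ?_)
  · exact (int_smul_eq_zsmul _ _ _).symm
  rw [affineChain]
  congr 2
  funext x
  exact (affineSmooth_toChain x).trans (affineChain_tuple x)

end

section

/-! ### Averages of periodic forms -/

section Average

variable {n m : ℕ} {Γ : AddSubgroup (Fin n → ℂ)} {D : Set (Fin n → ℂ)}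

lemma integrableOn_of_isBounded {E : Type*} [NormedAddCommGroup E] (hb : Bornology.IsBounded D)
    {g : (Fin n → ℂ) → E} (hg : Continuous g) : IntegrableOn g D :=
  (hg.continuousOn.integrableOn_compact hb.isCompact_closure).mono_set subset_closure

lemma countable_of_discrete [DiscreteTopology Γ] : Countable Γ :=
  TopologicalSpace.separableSpace_iff_countable.1 inferInstance

/-- The translate of a fundamental domain is again one, and a periodic function has the same
integral over both. -/
lemma setIntegral_add_right {E : Type*} [NormedAddCommGroup E] [NormedSpace ℝ E]
    [DiscreteTopology Γ] (hD : IsAddFundamentalDomain Γ D volume) {g : (Fin n → ℂ) → E}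
    (hg : ∀ γ ∈ Γ, ∀ x, g (x + γ) = g x) (a : Fin n → ℂ) :
    ∫ v in D, g (v + a) = ∫ v in D, g v := by
  have : Countable Γ := countable_of_discrete
  have h := (measurePreserving_add_left (volume : Measure (Fin n → ℂ)) a).setIntegral_preimage_emb
    (measurableEmbedding_addLeft a) g ((a +ᵥ ·) '' D)
  have hpre : (fun x => a + x) ⁻¹' ((a +ᵥ ·) '' D) = D := by
    ext x
    simp
  rw [hpre] at h
  simp only [add_comm _ a]
  rw [h]
  refine (hD.vadd_of_comm a).setIntegral_eq hD fun γ x => ?_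
  rw [AddSubgroup.vadd_def, vadd_eq_add, add_comm]
  exact hg γ γ.2 x

/-- The integral of a form over a fundamental domain, with constant coefficients. -/
def average (D : Set (Fin n → ℂ)) (α : Form n m) : (Fin n → ℂ) [⋀^Fin m]→L[ℝ] ℂ :=
  ∫ x in D, α x

lemma average_apply (hb : Bornology.IsBounded D) {α : Form n m} (hα : Continuous α)
    (v : Fin m → Fin n → ℂ) : average D α v = ∫ x in D, α x v := by
  let L : ((Fin n → ℂ) [⋀^Fin m]→L[ℝ] ℂ) →L[ℝ] ℂ :=
    ContinuousMultilinearMap.apply ℝ (fun _ : Fin m => Fin n → ℂ) ℂ v ∘L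
      ContinuousAlternatingMap.toContinuousMultilinearMapCLM ℝ
  exact (L.integral_comp_comm (integrableOn_of_isBounded hb hα)).symm

lemma average_sub (hb : Bornology.IsBounded D) {α β : Form n m} (hα : Continuous α)
    (hβ : Continuous β) : average D (α - β) = average D α - average D β :=
  integral_sub (integrableOn_of_isBounded hb hα) (integrableOn_of_isBounded hb hβ)

/-- The integral of `g (x + a) - g x` over `D` vanishes. Writing the difference as an integral of
the derivative along the segment and exchanging integrals, the inner integral does not depend on the
time, so it is zero. -/
lemma setIntegral_fderiv_eq_zero [DiscreteTopology Γ] (hD : IsAddFundamentalDomain Γ D volume)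
    (hb : Bornology.IsBounded D) {g : (Fin n → ℂ) → ℂ} (hg : ContDiff ℝ 1 g)
    (hp : ∀ γ ∈ Γ, ∀ x, g (x + γ) = g x) (a : Fin n → ℂ) : ∫ x in D, fderiv ℝ g x a = 0 := by
  have hc : Continuous fun x => fderiv ℝ g x a :=
    (hg.continuous_fderiv one_ne_zero).clm_apply continuous_const
  have hp' : ∀ γ ∈ Γ, ∀ x, fderiv ℝ g (x + γ) a = fderiv ℝ g x a := by
    intro γ hγ x
    rw [← fderiv_comp_add_right]
    simp only [hp γ hγ]
  have h2 : Continuous fun p : ℝ × (Fin n → ℂ) => fderiv ℝ g (p.2 + p.1 • a) a :=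
    hc.comp (continuous_snd.add (continuous_fst.smul continuous_const))
  have h1 : ∫ x in D, (∫ s in (0 : ℝ)..1, fderiv ℝ g (x + s • a) a) = 0 := by
    have : ∀ x, ∫ s in (0 : ℝ)..1, fderiv ℝ g (x + s • a) a = g (x + a) - g x := by
      intro x
      have h := intervalIntegral.integral_eq_sub_of_hasDerivAt (a := 0) (b := 1)
        (f := fun s : ℝ => g (x + s • a))
        (f' := fun s : ℝ => fderiv ℝ g (x + s • a) a)
        (fun s _ => ((hg.differentiable one_ne_zero _).hasFDerivAt).comp_hasDerivAt s
          (by simpa using ((hasDerivAt_id' s).smul_const a).const_add x))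
        ((h2.comp (continuous_id.prodMk continuous_const)).intervalIntegrable _ _)
      simpa using h
    simp only [this]
    rw [integral_sub (f := fun x => g (x + a)) (integrableOn_of_isBounded hb (hg.continuous.comp
      (continuous_add_const a))) (integrableOn_of_isBounded hb hg.continuous)]
    rw [setIntegral_add_right hD hp, sub_self]
  rw [← intervalIntegral_integral_swap] at h1
  · simpa [setIntegral_add_right hD (g := fun x => fderiv ℝ g x a) hp'] using h1
  · rw [Measure.prod_restrict, ← Measure.volume_eq_prod]
    exact (h2.continuousOn.integrableOn_compact (isCompact_uIcc.prod hb.isCompact_closure)).mono_set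
      (Set.prod_mono Set.uIoc_subset_uIcc subset_closure)

lemma average_extDeriv [DiscreteTopology Γ] (hD : IsAddFundamentalDomain Γ D volume)
    (hb : Bornology.IsBounded D) {u : Form n m} (hu : ContDiff ℝ ∞ u)
    (hp : ∀ γ ∈ Γ, ∀ x, u (x + γ) = u x) : average D (extDeriv u) = 0 := by
  have hdu : Continuous (extDeriv u) :=
    (ContinuousAlternatingMap.alternatizeUncurryFinCLM ℝ (Fin n → ℂ) ℂ).continuous.comp
      (hu.continuous_fderiv (by simp))
  ext v
  rw [average_apply hb hdu]
  have hg : ∀ i : Fin (m + 1), ContDiff ℝ 1 fun x => u x (i.removeNth v) := by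
    intro i
    exact contDiff_form_apply (r := 1) (hu.of_le (by simp)) fun _ => contDiff_const
  have h : ∀ x, extDeriv u x v = ∑ i : Fin (m + 1), (-1 : ℂ) ^ (i : ℕ) *
      fderiv ℝ (fun x => u x (i.removeNth v)) x (v i) := by
    intro x
    rw [extDeriv_apply (hu.differentiable (by simp) x)]
    refine Finset.sum_congr rfl fun i _ => ?_
    rw [zsmul_eq_mul]
    push_cast
    rfl
  simp only [h]
  rw [integral_finsetSum]
  · refine Finset.sum_eq_zero fun i _ => ?_
    rw [integral_const_mul, setIntegral_fderiv_eq_zero hD hb (hg i)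
      (fun γ hγ x => by simp only [hp γ hγ]), mul_zero]
  · exact fun i _ => (integrableOn_of_isBounded hb (((hg i).continuous_fderiv
      one_ne_zero).clm_apply continuous_const)).const_mul _

lemma isType_average (hb : Bornology.IsBounded D) {p q : ℕ} {α : Form n m} (hα : Continuous α)
    (h : IsType p q α) : IsType p q fun _ : Fin n → ℂ => average D α := by
  intro x c v
  rw [average_apply hb hα, average_apply hb hα, ← integral_const_mul]
  simp only [h _ c v]

/-- Since `du` has average zero, the average of `α` is of type `(p + 1, q)` as well as `(p, q + 1)`.
Multiplying the arguments by `i` scales the two types by opposite nonzero factors. -/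
lemma average_eq_zero_of_mem_delbarExact [DiscreteTopology Γ]
    (hD : IsAddFundamentalDomain Γ D volume) (hb : Bornology.IsBounded D) {p q : ℕ} {α : Form n m}
    (h : α ∈ delbarExact Γ p m q) : average D α = 0 := by
  have hbot : α ∈ (⊥ : Submodule ℂ (Form n m)) → average D α = 0 := fun h => by
    rw [(Submodule.mem_bot ℂ).1 h]
    exact integral_zero _ _
  cases m with
  | zero => exact hbot h
  | succ m =>
    cases q with
    | zero => exact hbot h
    | succ q =>
      obtain ⟨hα, u, hu, ht⟩ := h
      have hdu : Continuous (extDeriv u) :=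
        (ContinuousAlternatingMap.alternatizeUncurryFinCLM ℝ (Fin n → ℂ) ℂ).continuous.comp
          (hu.1.continuous_fderiv (by simp))
      have h1 := isType_average hb (hdu.sub hα.1.continuous) ht
      have h2 := isType_average hb hα.1.continuous hα.2.2
      ext v
      have h1' := h1 0 Complex.I v
      have h2' := h2 0 Complex.I v
      rw [average_sub hb hdu hα.1.continuous, average_extDeriv hD hb hu.1 hu.2.1, zero_sub,
        ContinuousAlternatingMap.neg_apply, ContinuousAlternatingMap.neg_apply, h2',
        Complex.conj_I] at h1'
      have h3 : 2 * (Complex.I ^ (p + 1) * (-Complex.I) ^ q) * average D α v = 0 := by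
        linear_combination h1'
      have h4 : 2 * (Complex.I ^ (p + 1) * (-Complex.I) ^ q) ≠ 0 := by simp
      simpa [h4] using h3

/-- The integral of a closed form over a cycle only depends on the average of the form. -/
theorem integral_eq_average [DiscreteTopology Γ] (hD : IsAddFundamentalDomain Γ D volume)
    (hb : Bornology.IsBounded D) {α : Form n (m + 1)} (hα : ContDiff ℝ ∞ α)
    (hd : extDeriv α = 0) (hp : ∀ γ ∈ Γ, ∀ x, α (x + γ) = α x)
    {c : SmoothChain n (m + 1)} {S : singularHomology Γ (m + 1)} (hc : c.Represents Γ S) :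
    volume.real D * c.integral α = volume.real (cornerSimplex (m + 1)) *
      period Γ (average D α).toAlternatingMap S := by
  rw [← integral_const_form _ hc]
  have h1 : ∀ f : SmoothSimplex n (m + 1), Continuous fun z : (Fin n → ℂ) × (Fin (m + 1) → ℝ) =>
      α (f.1 z.2 + z.1) fun j => fderiv ℝ f.1 z.2 (Pi.single j 1) := by
    intro f
    refine (contDiff_form_eval 0).continuous.comp (Continuous.prodMk ?_ (continuous_pi fun j => ?_))
    · exact hα.continuous.comp ((f.2.continuous.comp continuous_snd).add continuous_fst)
    · exact ((f.2.continuous_fderiv (by simp)).comp continuous_snd).clm_apply continuous_const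
  -- By Fubini, integrating the averaged form is averaging the integrals of the translated forms;
  -- over a cycle the latter all coincide.
  have h2 : ∀ f : SmoothSimplex n (m + 1), f.integral (fun _ => average D α) =
      ∫ v in D, f.integral fun x => α (x + v) := by
    intro f
    simp only [SmoothSimplex.integral]
    rw [integral_integral_swap]
    · refine setIntegral_congr_fun (measurableSet_cornerSimplex _) fun x _ => ?_
      simp only [average]
      rw [← setIntegral_add_right hD hp (f.1 x), ← average, average_apply hb
        (α := fun v => α (v + f.1 x)) (hα.continuous.comp (continuous_add_const (f.1 x)))]
      simp only [add_comm]
    · rw [Measure.prod_restrict, ← Measure.volume_eq_prod]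
      exact ((h1 f).continuousOn.integrableOn_compact
        (hb.isCompact_closure.prod (isCompact_cornerSimplex _))).mono_set
          (Set.prod_mono subset_closure subset_rfl)
  have h3 : ∀ f : SmoothSimplex n (m + 1), Continuous fun v => f.integral fun x => α (x + v) := by
    intro f
    exact continuous_parametric_integral_of_continuous (f := fun (v : Fin n → ℂ) x =>
      α (f.1 x + v) fun j => fderiv ℝ f.1 x (Pi.single j 1)) (h1 f) (isCompact_cornerSimplex _)
  have h4 : c.integral (fun _ => average D α) = ∫ v in D, c.integral fun x => α (x + v) := by
    simp only [SmoothChain.integral, Finsupp.sum, h2]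
    rw [integral_finsetSum]
    · simp only [integral_const_mul]
    · exact fun f _ => (integrableOn_of_isBounded hb (h3 f)).const_mul _
  rw [h4]
  simp only [integral_translate hα hd hp _ hc, setIntegral_const, Complex.real_smul]

end Average

end

section

/-! ### Constant forms in complex coordinates -/

section ConstantForms

variable {n m : ℕ}

/-- The functions `z_l` (for `(l, false)`) and `conj z_l` (for `(l, true)`). -/
def coordFn (τ : Fin n × Bool) : (Fin n → ℂ) →ₗ[ℝ] ℂ where
  toFun x := bif τ.2 then conj (x τ.1) else x τ.1
  map_add' x y := by cases τ.2 <;> simp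
  map_smul' a x := by cases τ.2 <;> simp

@[simp] lemma coordFn_false (l : Fin n) (x : Fin n → ℂ) : coordFn (l, false) x = x l := rfl

@[simp] lemma coordFn_true (l : Fin n) (x : Fin n → ℂ) : coordFn (l, true) x = conj (x l) := rfl

lemma coordFn_smul (τ : Fin n × Bool) (c : ℂ) (x : Fin n → ℂ) :
    coordFn τ (c • x) = (bif τ.2 then conj c else c) * coordFn τ x := by
  obtain ⟨l, b⟩ := τ
  cases b <;> simp

/-- The coefficients are the Wirtinger derivatives of `f` with respect to `z_l` and its conjugate.
-/
lemma apply_eq_sum_coordFn (f : (Fin n → ℂ) →ₗ[ℝ] ℂ) (x : Fin n → ℂ) :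
    f x = ∑ τ : Fin n × Bool, (f (Pi.single τ.1 1) +
      (bif τ.2 then Complex.I else -Complex.I) * f (Pi.single τ.1 Complex.I)) / 2 *
        coordFn τ x := by
  have hx : x = ∑ l, ((x l).re • (Pi.single l 1 : Fin n → ℂ) +
      (x l).im • (Pi.single l Complex.I : Fin n → ℂ)) := by
    funext i
    simp [Finset.sum_apply, Pi.single_apply, Finset.sum_add_distrib, Complex.re_add_im]
  conv_lhs => rw [hx]
  rw [map_sum, Fintype.sum_prod_type]
  refine Finset.sum_congr rfl fun l _ => ?_
  rw [map_add, map_smul, map_smul, Fintype.sum_bool]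
  simp only [coordFn_true, coordFn_false, cond_true, cond_false, Complex.real_smul]
  have h1 := Complex.re_add_im (x l)
  have h2 : ((x l).re : ℂ) - (x l).im * Complex.I = conj (x l) := by
    apply Complex.ext <;> simp
  linear_combination ((x l).im : ℂ) * f (Pi.single l Complex.I) * Complex.I_mul_I +
    (f (Pi.single l 1) + Complex.I * f (Pi.single l Complex.I)) / 2 * h2 +
    (f (Pi.single l 1) - Complex.I * f (Pi.single l Complex.I)) / 2 * h1

lemma exists_coeff (w : (Fin n → ℂ) [⋀^Fin m]→ₗ[ℝ] ℂ) :
    ∃ W : (Fin m → Fin n × Bool) → ℂ, ∀ v : Fin m → Fin n → ℂ,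
      w v = ∑ t, W t * ∏ r, coordFn (t r) (v r) := by
  induction m with
  | zero =>
    refine ⟨fun _ => w 0, fun v => ?_⟩
    simp [Subsingleton.elim v 0]
  | succ m ih =>
    have h : ∀ τ : Fin n × Bool, ∃ W : (Fin m → Fin n × Bool) → ℂ, ∀ v : Fin m → Fin n → ℂ,
        (w (Fin.cons (Pi.single τ.1 1) v) + (bif τ.2 then Complex.I else -Complex.I) *
          w (Fin.cons (Pi.single τ.1 Complex.I) v)) / 2 =
            ∑ t, W t * ∏ r, coordFn (t r) (v r) := by
      intro τ
      obtain ⟨W, hW⟩ := ih ((1 / 2 : ℂ) • (w.curryLeft (Pi.single τ.1 1) +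
        (bif τ.2 then Complex.I else -Complex.I) • w.curryLeft (Pi.single τ.1 Complex.I)))
      refine ⟨W, fun v => (hW v).symm ▸ ?_⟩
      simp only [AlternatingMap.smul_apply, AlternatingMap.add_apply, smul_eq_mul,
        AlternatingMap.curryLeft_apply_apply]
      rw [div_eq_inv_mul, one_div]
      rfl
    choose W hW using h
    refine ⟨fun t => W (t 0) (Fin.tail t), fun v => ?_⟩
    have hupd : ∀ y, Function.update v 0 y = Fin.cons y (Fin.tail v) := fun y => by
      conv_lhs => rw [← Fin.cons_self_tail v, Fin.update_cons_zero]
    have h1 := apply_eq_sum_coordFn (w.toMultilinearMap.toLinearMap v 0) (v 0)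
    simp only [MultilinearMap.toLinearMap_apply, AlternatingMap.coe_multilinearMap, hupd,
      Fin.cons_self_tail] at h1
    rw [h1, ← Equiv.sum_comp (Fin.consEquiv fun _ : Fin (m + 1) => Fin n × Bool)]
    refine Eq.trans ?_ (Fintype.sum_prod_type _).symm
    refine Finset.sum_congr rfl fun τ _ => ?_
    refine (congrArg (· * coordFn τ (v 0)) (hW τ (Fin.tail v))).trans ?_
    simp only [Finset.sum_mul]
    refine Finset.sum_congr rfl fun t _ => ?_
    simp only [Fin.consEquiv, Equiv.coe_fn_mk, Fin.cons_zero, Fin.tail_cons, Fin.prod_univ_succ,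
      Fin.cons_succ]
    rw [mul_assoc, mul_comm (coordFn τ (v 0))]
    rfl

/-- The number of conjugated coordinates. -/
def conjCount (t : Fin m → Fin n × Bool) : ℕ := (Finset.univ.filter fun r => (t r).2 = true).card

lemma prod_coordFn_smul (t : Fin m → Fin n × Bool) (c : ℂ) (v : Fin m → Fin n → ℂ) :
    ∏ r, coordFn (t r) (c • v r) =
      c ^ (m - conjCount t) * conj c ^ conjCount t * ∏ r, coordFn (t r) (v r) := by
  simp only [coordFn_smul, Finset.prod_mul_distrib]
  congr 1
  have : ∀ r, (bif (t r).2 then conj c else c) = if (t r).2 = true then conj c else c := by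
    intro r; cases (t r).2 <;> rfl
  simp only [this]
  rw [Finset.prod_ite, Finset.prod_const, Finset.prod_const, mul_comm, conjCount]
  congr 2
  have := Finset.card_filter_add_card_filter_not (s := (Finset.univ : Finset (Fin m)))
    (fun r => (t r).2 = true)
  rw [Finset.card_fin] at this
  omega

lemma conjCount_le (t : Fin m → Fin n × Bool) : conjCount t ≤ m :=
  (Finset.card_le_univ _).trans (by simp)

/-- A constant form of type `(p, q)` only involves the coordinate monomials with `q` conjugated
factors. -/
lemma eq_sum_conjCount_eq {p q : ℕ} (hpq : p + q = m) {w : (Fin m → Fin n → ℂ) → ℂ}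
    (hw : ∀ (c : ℂ) v, w (fun j => c • v j) = c ^ p * conj c ^ q * w v)
    {W : (Fin m → Fin n × Bool) → ℂ} (hW : ∀ v, w v = ∑ t, W t * ∏ r, coordFn (t r) (v r))
    (v : Fin m → Fin n → ℂ) :
    w v = ∑ t with conjCount t = q, W t * ∏ r, coordFn (t r) (v r) := by
  open Polynomial in
  -- Dividing the homogeneity relation by `c ^ m` makes it polynomial in `conj c / c`. The choice `c
  -- = 1 + x i` with `x` real gives infinitely many ratios, so coefficients can be compared in
  -- degree `q`.
  let P : ℂ[X] := ∑ t, C (W t * ∏ r, coordFn (t r) (v r)) * X ^ conjCount t - C (w v) * X ^ q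
  have hP : P = 0 := by
    refine Polynomial.eq_zero_of_infinite_isRoot P ?_
    have hne : ∀ x : ℝ, (1 + x * Complex.I : ℂ) ≠ 0 := fun x hx => by
      simpa using congrArg Complex.re hx
    refine Set.infinite_of_injective_forall_mem
      (f := fun x : ℝ => (1 - x * Complex.I) / (1 + x * Complex.I)) (fun x y hxy => ?_)
      (fun x => ?_)
    · rw [div_eq_div_iff (hne x) (hne y)] at hxy
      have h := congrArg Complex.im hxy
      simp at h
      linarith
    · have hc : conj (1 + x * Complex.I : ℂ) = 1 - x * Complex.I := by simp [sub_eq_add_neg]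
      have h1 := hw (1 + x * Complex.I) v
      rw [hW, hc] at h1
      simp only [prod_coordFn_smul, hc] at h1
      have h2 : ∀ j ≤ m, ((1 - x * Complex.I) / (1 + x * Complex.I)) ^ j =
          (1 + x * Complex.I) ^ (m - j) * (1 - x * Complex.I) ^ j / (1 + x * Complex.I) ^ m := by
        intro j hj
        rw [div_pow, div_eq_div_iff (pow_ne_zero _ (hne x)) (pow_ne_zero _ (hne x)),
          ← Nat.sub_add_cancel hj, pow_add]
        simp only [Nat.add_sub_cancel]
        ring
      have hp : m - q = p := by omega
      change Polynomial.eval _ P = 0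
      simp only [P, Polynomial.eval_sub, Polynomial.eval_finsetSum, Polynomial.eval_mul,
        Polynomial.eval_C, Polynomial.eval_pow, Polynomial.eval_X]
      rw [h2 q (by omega), hp, sub_eq_zero, mul_div_assoc', mul_comm (w v), ← h1, Finset.sum_div]
      refine Finset.sum_congr rfl fun t _ => ?_
      rw [h2 _ (conjCount_le t)]
      ring
  have hcoeff := congrArg (fun R => Polynomial.coeff R q) hP
  simp only [P, Polynomial.coeff_sub, Polynomial.finsetSum_coeff, Polynomial.coeff_C_mul_X_pow,
    if_true, Polynomial.coeff_zero] at hcoeff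
  rw [sub_eq_zero] at hcoeff
  rw [← hcoeff, Finset.sum_filter]
  exact Finset.sum_congr rfl fun t _ => by simp only [eq_comm]

/-- Antisymmetrizing over all permutations multiplies the alternating `w` by `m!` and turns each
monomial into a determinant. -/
lemma factorial_mul_eq_sum_det (w : (Fin n → ℂ) [⋀^Fin m]→ₗ[ℝ] ℂ)
    (s : Finset (Fin m → Fin n × Bool)) {W : (Fin m → Fin n × Bool) → ℂ}
    (hW : ∀ v, w v = ∑ t ∈ s, W t * ∏ r, coordFn (t r) (v r)) (v : Fin m → Fin n → ℂ) :
    (m.factorial : ℂ) * w v =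
      ∑ t ∈ s, W t * Matrix.det (Matrix.of fun r c => coordFn (t c) (v r)) := by
  have h1 : ∑ σ : Equiv.Perm (Fin m), Equiv.Perm.sign σ • w (v ∘ σ) = (m.factorial : ℂ) * w v := by
    have : ∀ σ : Equiv.Perm (Fin m), Equiv.Perm.sign σ • w (v ∘ σ) = w v := fun σ => by
      rw [AlternatingMap.map_perm, smul_smul, Int.units_mul_self, one_smul]
    simp only [this, Finset.sum_const, Finset.card_univ, Fintype.card_perm, Fintype.card_fin,
      nsmul_eq_mul]
  rw [← h1]
  simp only [hW, Finset.smul_sum]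
  rw [Finset.sum_comm]
  refine Finset.sum_congr rfl fun t _ => ?_
  rw [Matrix.det_apply, Finset.mul_sum]
  refine Finset.sum_congr rfl fun σ _ => ?_
  simp only [Matrix.of_apply, Function.comp_apply]
  rw [mul_smul_comm]

end ConstantForms

/-! ### Constant forms of type `(p, q)` and the determinants `C^i_{P,Q}`. -/

section LatticeDet

variable {n k p q : ℕ}

/-- The multi-index `(P, Q)` as a sequence of coordinate functions. -/
def joinIndex (h : p + q = 2 * k) (P : Fin p ↪o Fin n) (Q : Fin q ↪o Fin n) :
    Fin (2 * k) → Fin n × Bool := fun s =>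
  Fin.append (fun a => (P a, false)) (fun b => (Q b, true)) (Fin.cast h.symm s)

lemma latticeDet_eq (e : Fin (2 * n) → Fin n → ℂ) (h : p + q = 2 * k)
    (i : Fin (2 * k) ↪o Fin (2 * n)) (P : Fin p ↪o Fin n) (Q : Fin q ↪o Fin n) :
    latticeDet e h i P Q = Matrix.det (Matrix.of fun r c => coordFn (joinIndex h P Q c) (e (i r))) := by
  rw [latticeDet]
  congr 2
  funext r c
  rw [joinIndex]
  generalize Fin.cast h.symm c = s
  refine Fin.addCases (fun a => ?_) (fun b => ?_) s <;> simp

lemma exists_joinIndex_perm (h : p + q = 2 * k) {t : Fin (2 * k) → Fin n × Bool}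
    (ht : Function.Injective t) (hq : conjCount t = q) :
    ∃ (P : Fin p ↪o Fin n) (Q : Fin q ↪o Fin n) (σ : Equiv.Perm (Fin (2 * k))),
      t = joinIndex h P Q ∘ σ := by
  classical
  have hcard := Finset.card_filter_add_card_filter_not (s := (Finset.univ : Finset (Fin (2 * k))))
    (fun r => (t r).2 = true)
  rw [Finset.card_fin] at hcard
  have hinj : ∀ b : Bool, Set.InjOn (fun r => (t r).1)
      (Finset.univ.filter fun r => (t r).2 = b : Finset (Fin (2 * k))) := by
    intro b r hr s hs hrs
    simp only [Finset.coe_filter, Finset.mem_univ, true_and, Set.mem_ofPred_eq] at hr hs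
    exact ht (Prod.ext hrs (hr.trans hs.symm))
  let A : Bool → Finset (Fin n) := fun b =>
    (Finset.univ.filter fun r => (t r).2 = b).image fun r => (t r).1
  have hAcard : ∀ b, (A b).card = (Finset.univ.filter fun r => (t r).2 = b).card := fun b =>
    Finset.card_image_of_injOn (hinj b)
  have hQ : (A true).card = q := (hAcard true).trans hq
  have hP : (A false).card = p := by
    rw [hAcard]
    simp only [conjCount] at hq
    simp only [Bool.not_eq_true] at hcard
    omega
  let P := (A false).orderEmbOfFin hP
  let Q := (A true).orderEmbOfFin hQ
  have hsub : ∀ r, t r ∈ Set.range (joinIndex h P Q) := by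
    intro r
    have hm : (t r).1 ∈ A (t r).2 := Finset.mem_image.2 ⟨r, by simp, rfl⟩
    rcases hb : (t r).2 with _ | _
    · rw [hb] at hm
      have : (t r).1 ∈ Set.range P := by rw [Finset.range_orderEmbOfFin]; exact hm
      obtain ⟨a, ha⟩ := this
      refine ⟨Fin.cast h (Fin.castAdd q a), ?_⟩
      rw [joinIndex]
      refine Eq.trans (Fin.append_left _ _ a) ?_
      exact Prod.ext ha hb.symm
    · rw [hb] at hm
      have : (t r).1 ∈ Set.range Q := by rw [Finset.range_orderEmbOfFin]; exact hm
      obtain ⟨a, ha⟩ := this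
      refine ⟨Fin.cast h (Fin.natAdd p a), ?_⟩
      rw [joinIndex]
      refine Eq.trans (Fin.append_right _ _ a) ?_
      exact Prod.ext ha hb.symm
  choose σ hσ using hsub
  have hσinj : Function.Injective σ := fun r s hrs => ht (by rw [← hσ r, ← hσ s, hrs])
  refine ⟨P, Q, Equiv.ofBijective σ (Finite.injective_iff_bijective.1 hσinj), ?_⟩
  funext r
  exact (hσ r).symm

/-- A relation between the determinants of all multi-indices of type `(p, q)` is a relation between
the values of all constant forms of type `(p, q)`. -/
theorem sum_mul_apply_eq_zero {e : Fin (2 * n) → Fin n → ℂ} (h : p + q = 2 * k)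
    {a : (Fin (2 * k) ↪o Fin (2 * n)) → ℤ}
    (ha : ∀ (P : Fin p ↪o Fin n) (Q : Fin q ↪o Fin n), ∑ i, (a i : ℂ) * latticeDet e h i P Q = 0)
    {w : (Fin n → ℂ) [⋀^Fin (2 * k)]→ₗ[ℝ] ℂ}
    (hw : ∀ (c : ℂ) v, w (fun j => c • v j) = c ^ p * conj c ^ q * w v) :
    ∑ i, (a i : ℂ) * w (e ∘ i) = 0 := by
  obtain ⟨W, hW⟩ := exists_coeff w
  have hW2 := eq_sum_conjCount_eq h hw hW
  have hdet : ∀ t ∈ Finset.univ.filter (fun t : Fin (2 * k) → Fin n × Bool => conjCount t = q),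
      ∑ i, (a i : ℂ) * Matrix.det (Matrix.of fun r c => coordFn (t c) ((e ∘ i) r)) = 0 := by
    intro t ht
    -- An injective sequence of coordinates is a sorted pair `(P, Q)` up to a permutation, which
    -- gives `C^i_{P,Q}` up to sign; otherwise two columns coincide.
    by_cases hinj : Function.Injective t
    · obtain ⟨P, Q, σ, rfl⟩ := exists_joinIndex_perm h hinj (Finset.mem_filter.1 ht).2
      have : ∀ i : Fin (2 * k) ↪o Fin (2 * n),
          Matrix.det (Matrix.of fun r c => coordFn ((joinIndex h P Q ∘ σ) c) ((e ∘ i) r)) =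
            Equiv.Perm.sign σ * latticeDet e h i P Q := by
        intro i
        rw [latticeDet_eq, ← Matrix.det_permute']
        rfl
      simp only [this, mul_left_comm _ ((Equiv.Perm.sign σ : ℤ) : ℂ), ← Finset.mul_sum, ha,
        mul_zero]
    · rw [Function.not_injective_iff] at hinj
      obtain ⟨r, s, hrs, hne⟩ := hinj
      refine Finset.sum_eq_zero fun i _ => ?_
      rw [Matrix.det_zero_of_column_eq hne (fun l => by simp [hrs]), mul_zero]
  have hfac : ((2 * k).factorial : ℂ) ≠ 0 := Nat.cast_ne_zero.2 (Nat.factorial_ne_zero _)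
  refine (mul_eq_zero.1 ?_).resolve_left hfac
  rw [Finset.mul_sum]
  simp only [mul_left_comm ((2 * k).factorial : ℂ), factorial_mul_eq_sum_det w _ hW2,
    Finset.mul_sum]
  rw [Finset.sum_comm]
  refine Finset.sum_eq_zero fun t ht => ?_
  simp only [mul_left_comm _ (W t), ← Finset.mul_sum, hdet t ht, mul_zero]

end LatticeDet

end

section

/-! ### Determinants of linear forms -/

section DetForm

variable {n m : ℕ}

lemma of_update (ℓ : Fin m → (Fin n → ℂ) →ₗ[ℝ] ℂ) (v : Fin m → Fin n → ℂ) (i : Fin m)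
    (x : Fin n → ℂ) : (Matrix.of fun r c => ℓ c (Function.update v i x r)) =
      (Matrix.of fun r c => ℓ c (v r)).updateRow i fun c => ℓ c x := by
  ext r c
  rcases eq_or_ne r i with rfl | h
  · simp
  · simp [h]

/-- The exterior product of linear forms. -/
def detForm (ℓ : Fin m → (Fin n → ℂ) →ₗ[ℝ] ℂ) : (Fin n → ℂ) [⋀^Fin m]→L[ℝ] ℂ where
  toFun v := Matrix.det (Matrix.of fun r c => ℓ c (v r))
  map_update_add' {inst} v i x y := by
    obtain rfl : inst = instDecidableEqFin m := Subsingleton.elim _ _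
    simp only [of_update, map_add]
    exact Matrix.det_updateRow_add _ _ _ _
  map_update_smul' {inst} v i c x := by
    obtain rfl : inst = instDecidableEqFin m := Subsingleton.elim _ _
    simp only [of_update, map_smul, Complex.real_smul]
    exact Matrix.det_updateRow_smul _ _ (c : ℂ) _
  map_eq_zero_of_eq' v i j hv hij := Matrix.det_zero_of_row_eq hij (by ext c; simp [hv])
  cont := by
    refine Continuous.matrix_det (continuous_matrix fun r c => ?_)
    exact ((ℓ c).continuous_of_finiteDimensional).comp (continuous_apply r)

lemma detForm_apply (ℓ : Fin m → (Fin n → ℂ) →ₗ[ℝ] ℂ) (v : Fin m → Fin n → ℂ) :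
    detForm ℓ v = Matrix.det (Matrix.of fun r c => ℓ c (v r)) := rfl

/-- Multiplication by `c` scales `p` columns by `c` and `q` columns by its conjugate. -/
lemma isType_detForm {k p q : ℕ} (h : p + q = 2 * k) (P : Fin p ↪o Fin n) (Q : Fin q ↪o Fin n) :
    IsType p q fun _ : Fin n → ℂ => detForm fun c => coordFn (joinIndex h P Q c) := by
  intro x c v
  simp only [detForm_apply, coordFn_smul]
  refine (Matrix.det_mul_row (fun s => bif (joinIndex h P Q s).2 then conj c else c)
    (Matrix.of fun r s => coordFn (joinIndex h P Q s) (v r))).trans (congrArg (· * _) ?_)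
  rw [← (finCongr h).prod_comp, Fin.prod_univ_add]
  simp [joinIndex]

end DetForm

/-! ### The kernel of the period map -/

section Kernel

variable {n : ℕ} {e : Fin (2 * n) → Fin n → ℂ}

lemma lattice_eq_span (b : Module.Basis (Fin (2 * n)) ℝ (Fin n → ℂ)) :
    lattice b = (Submodule.span ℤ (Set.range b)).toAddSubgroup := by
  rw [lattice, Submodule.span_int_eq_addSubgroupClosure]

lemma exists_basis (he : LinearIndependent ℝ e) :
    ∃ b : Module.Basis (Fin (2 * n)) ℝ (Fin n → ℂ), ⇑b = e := by
  refine ⟨Module.Basis.mk he (he.span_eq_top_of_card_eq_finrank' ?_).ge, Module.Basis.coe_mk _ _⟩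
  rw [Fintype.card_fin, Module.finrank_pi_fintype]
  simp [mul_comm]

lemma discreteTopology_lattice (b : Module.Basis (Fin (2 * n)) ℝ (Fin n → ℂ)) :
    DiscreteTopology (lattice b) := by
  rw [lattice_eq_span]
  infer_instance

lemma exists_fundamentalDomain (b : Module.Basis (Fin (2 * n)) ℝ (Fin n → ℂ)) :
    ∃ D : Set (Fin n → ℂ), IsAddFundamentalDomain (lattice b) D volume ∧
      Bornology.IsBounded D ∧ volume.real D ≠ 0 := by
  refine ⟨ZSpan.fundamentalDomain b, ?_, ZSpan.fundamentalDomain_isBounded b, ?_⟩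
  · rw [lattice_eq_span]
    exact ZSpan.isAddFundamentalDomain' b volume
  · rw [Measure.real, ENNReal.toReal_ne_zero]
    exact ⟨ZSpan.measure_fundamentalDomain_ne_zero b,
      (ZSpan.fundamentalDomain_isBounded b).measure_lt_top.ne⟩

lemma linearIndependent_int (b : Module.Basis (Fin (2 * n)) ℝ (Fin n → ℂ)) :
    LinearIndependent ℤ b :=
  b.linearIndependent.restrict_scalars (by simpa using Int.cast_injective (α := ℝ))

lemma volume_real_cornerSimplex_ne_zero (m : ℕ) : volume.real (cornerSimplex m) ≠ 0 := by
  rw [Measure.real, ENNReal.toReal_ne_zero]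
  exact ⟨(volume_cornerSimplex_pos m).ne', (volume_cornerSimplex_lt_top m).ne⟩

variable {Γ : AddSubgroup (Fin n → ℂ)} {D : Set (Fin n → ℂ)} {m p q : ℕ}

lemma const_mem_torusForms {w : (Fin n → ℂ) [⋀^Fin m]→L[ℝ] ℂ}
    (hw : IsType p q fun _ : Fin n → ℂ => w) : (fun _ => w) ∈ torusForms Γ m p q :=
  ⟨contDiff_const, fun _ _ _ => rfl, hw⟩

lemma const_mem_delbarClosed {w : (Fin n → ℂ) [⋀^Fin m]→L[ℝ] ℂ}
    (hw : IsType p q fun _ : Fin n → ℂ => w) : (fun _ => w) ∈ delbarClosed Γ m p q :=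
  ⟨const_mem_torusForms hw, by rw [extDeriv_const_form]; exact IsType.zero _ _⟩

variable [DiscreteTopology Γ]

/-- The integral is defined by a choice of cycle and closed form; this determines its value. Two
representatives of a class differ by a `∂̄`-exact form, whose average vanishes, so `α` itself need
not be closed. -/
lemma isIntegral_eq (hm : m ≠ 0) (hD : IsAddFundamentalDomain Γ D volume)
    (hb : Bornology.IsBounded D) {S : singularHomology Γ m} {ξ : Dolbeault Γ m p q} {v : ℂ}
    (hv : IsIntegral Γ S ξ v) {α : Form n m} (hα : α ∈ torusForms Γ m p q)
    (hξ : (delbarExact Γ p m q).mkQ α = ξ) :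
    volume.real D * v = volume.real (cornerSimplex m) *
      period Γ (average D α).toAlternatingMap S := by
  obtain ⟨m, rfl⟩ := Nat.exists_eq_succ_of_ne_zero hm
  obtain ⟨c, hc, β, hβ, hd, hβξ, rfl⟩ := hv
  have h : β - α ∈ delbarExact Γ p (m + 1) q := by
    rw [← Submodule.Quotient.eq]
    exact hβξ.trans hξ.symm
  have havg := average_eq_zero_of_mem_delbarExact hD hb h
  rw [average_sub hb hβ.1.continuous hα.1.continuous, sub_eq_zero] at havg
  rw [← havg]
  exact integral_eq_average hD hb hβ.1 hd hβ.2.1 hc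

/-- All integrals of Dolbeault classes of type `(p, q)` over a homology class vanish if and only if
all periods of constant forms of type `(p, q)` vanish. -/
lemma integral_eq_zero_iff (hm : m ≠ 0) (hD : IsAddFundamentalDomain Γ D volume)
    (hb : Bornology.IsBounded D) (hD0 : volume.real D ≠ 0) {S : singularHomology Γ m}
    (hS : ∃ c : SmoothChain n m, c.Represents Γ S) :
    (∀ ξ : Dolbeault Γ m p q, integral Γ S ξ = 0) ↔
      ∀ w : (Fin n → ℂ) [⋀^Fin m]→L[ℝ] ℂ, (IsType p q fun _ : Fin n → ℂ => w) →
        period Γ w.toAlternatingMap S = 0 := by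
  have hD0' : (volume.real D : ℂ) ≠ 0 := Complex.ofReal_ne_zero.2 hD0
  constructor
  · intro h w hw
    obtain ⟨c, hc⟩ := hS
    let ξ : Dolbeault Γ m p q := ⟨(delbarExact Γ p m q).mkQ fun _ => w,
      Submodule.mem_map_of_mem (const_mem_delbarClosed hw)⟩
    have hint : IsIntegral Γ S ξ (c.integral fun _ => w) :=
      ⟨c, hc, _, const_mem_torusForms hw, extDeriv_const_form w, rfl, rfl⟩
    have hex : ∃ v, IsIntegral Γ S ξ v := ⟨_, hint⟩
    have h0 : hex.choose = 0 := by
      have := h ξ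
      rwa [integral, dif_pos hex] at this
    have h1 := isIntegral_eq hm hD hb hint (const_mem_torusForms hw) rfl
    have h2 := isIntegral_eq hm hD hb hex.choose_spec (const_mem_torusForms hw) rfl
    rw [← h1, h0, mul_zero, eq_comm, mul_eq_zero, or_iff_right hD0'] at h2
    obtain ⟨m, rfl⟩ := Nat.exists_eq_succ_of_ne_zero hm
    rw [integral_const_form w hc, mul_eq_zero] at h2
    exact h2.resolve_left (Complex.ofReal_ne_zero.2 (volume_real_cornerSimplex_ne_zero _))
  · intro h ξ
    rw [integral]
    -- The default value is `0`, as required, so it is never needed that every Dolbeault class has a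
    -- `d`-closed representative.
    split_ifs with hex
    · obtain ⟨c, hc, α, hα, hd, hξ, hv⟩ := hex.choose_spec
      have h1 := isIntegral_eq hm hD hb hex.choose_spec hα hξ
      rw [h _ (isType_average hb hα.1.continuous hα.2.2), mul_zero, mul_eq_zero] at h1
      exact h1.resolve_left hD0'
    · rfl

lemma period_boxSum {e : Fin (2 * n) → Fin n → ℂ} {a : (Fin m ↪o Fin (2 * n)) → ℤ}
    {S : singularHomology Γ m} (hS : IsCycleIn (affineChain Γ m (boxSum e a)) S)
    (w : (Fin n → ℂ) [⋀^Fin m]→ₗ[ℝ] ℂ) :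
    period Γ w S = 0 ↔ ∑ i, (a i : ℂ) * w (e ∘ i) = 0 := by
  rw [period_eq w hS, periodCochain_affineChain, edgeCochain_boxSum, mul_eq_zero,
    or_iff_right]
  exact mul_ne_zero (Nat.cast_ne_zero.2 (Nat.factorial_ne_zero _)) (by simp)

lemma exists_represents {e : Fin (2 * n) → Fin n → ℂ} (he : LinearIndependent ℤ e)
    (hΓ : Γ = lattice e) (S : singularHomology Γ m) :
    ∃ c : SmoothChain n m, c.Represents Γ S := by
  obtain ⟨a, ha⟩ := exists_boxSum_isCycleIn he hΓ S
  obtain ⟨c, hc⟩ := exists_toSingular_eq_affineChain (Γ := Γ) (boxSum e a)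
  refine ⟨c, ?_⟩
  rw [← hc] at ha
  exact ha

lemma mem_kerInt_iff {e : Fin (2 * n) → Fin n → ℂ} (he : LinearIndependent ℤ e)
    (hΓ : Γ = lattice e) (hD : IsAddFundamentalDomain Γ D volume)
    (hb : Bornology.IsBounded D) (hD0 : volume.real D ≠ 0)
    {S : ⨁ k : {k : ℕ // 1 ≤ k ∧ k < n}, singularHomology Γ (2 * k.1)} :
    S ∈ kerInt Γ ↔ ∀ (k : {k : ℕ // 1 ≤ k ∧ k < n}) (p q : ℕ), p + q = 2 * k.1 → q < p →
      ∀ w : (Fin n → ℂ) [⋀^Fin (2 * k.1)]→L[ℝ] ℂ, (IsType p q fun _ : Fin n → ℂ => w) →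
        period Γ w.toAlternatingMap (S k) = 0 := by
  have hm : ∀ k : {k : ℕ // 1 ≤ k ∧ k < n}, 2 * k.1 ≠ 0 := fun k => by
    have := k.2.1
    omega
  constructor
  · intro h k p q hpq hlt
    refine (integral_eq_zero_iff (hm k) hD hb hD0 (exists_represents he hΓ (S k))).1 fun ξ => ?_
    exact congrFun (congrFun (congrFun h k) ⟨(p, q), hpq, hlt⟩) ξ
  · intro h
    funext k t ξ
    exact (integral_eq_zero_iff (hm k) hD hb hD0 (exists_represents he hΓ (S k))).2
      (h k _ _ t.2.1 t.2.2) ξ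

/-- Products of dual coordinates form the basis dual to the parallelepipeds. For `i ≠ I` some index
of `i` lies outside `I`, because both have `m` elements, and it gives a zero row. -/
lemma sum_mul_detForm_coord (b : Module.Basis (Fin (2 * n)) ℝ (Fin n → ℂ))
    (a : (Fin m ↪o Fin (2 * n)) → ℤ) (I : Fin m ↪o Fin (2 * n)) :
    ∑ i, (a i : ℂ) * detForm (fun c => Complex.ofRealCLM.toLinearMap ∘ₗ b.coord (I c)) (b ∘ i) = a I := by
  rw [Finset.sum_eq_single I]
  · have h1 : (Matrix.of fun r c => (Complex.ofRealCLM.toLinearMap ∘ₗ b.coord (I c)) ((b ∘ I) r)) =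
        (1 : Matrix (Fin m) (Fin m) ℂ) := by
      ext r c
      simp only [Matrix.of_apply, Function.comp_apply, LinearMap.comp_apply, Module.Basis.coord_apply,
        Module.Basis.repr_self, Finsupp.single_apply, I.injective.eq_iff, Matrix.one_apply]
      split_ifs <;> simp
    rw [detForm_apply, h1, Matrix.det_one, mul_one]
  · intro i _ hi
    obtain ⟨r, hr⟩ : ∃ r, i r ∉ Set.range I := by
      by_contra! h
      refine hi ?_
      have hsub : Set.range i ⊆ Set.range I := Set.range_subset_iff.2 h
      have heq : Set.range i = Set.range I := by
        refine Set.eq_of_subset_of_ncard_le hsub ?_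
        rw [Set.ncard_range_of_injective I.injective, Set.ncard_range_of_injective i.injective]
      exact OrderEmbedding.range_inj.1 heq
    rw [detForm_apply, Matrix.det_eq_zero_of_row_eq_zero r, mul_zero]
    intro c
    have hne : i r ≠ I c := fun h => hr ⟨c, h.symm⟩
    simp [hne]
  · simp

end Kernel

end

end ComplexTorus

end

/-! ### Relations between determinants and the kernel. -/

theorem lemma6p3 (n : ℕ) (e : Fin (2 * n) → Fin n → ℂ) (he : LinearIndependent ℝ e) :
    ComplexTorus.kerInt (ComplexTorus.lattice e) = {0} ↔
      ∀ k : ℕ, 0 < k → k < n →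
        ¬ ∃ a : (Fin (2 * k) ↪o Fin (2 * n)) → ℤ, a ≠ 0 ∧
          ∀ (p q : ℕ) (h : p + q = 2 * k), q < p →
            ∀ (P : Fin p ↪o Fin n) (Q : Fin q ↪o Fin n),
              ∑ i, (a i : ℂ) * ComplexTorus.latticeDet e h i P Q = 0 := by
  open ComplexTorus in
  obtain ⟨b, rfl⟩ := exists_basis he
  have := discreteTopology_lattice b
  obtain ⟨D, hD, hb, hD0⟩ := exists_fundamentalDomain b
  have hind := linearIndependent_int b
  constructor
  · rintro hker k hk hkn ⟨a, ha0, ha⟩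
    obtain ⟨S, hS⟩ := exists_isCycleIn_boxSum (Γ := lattice b) (e := b)
      (fun i => AddSubgroup.subset_closure ⟨i, rfl⟩) a
    let T := DirectSum.of (fun k : {k : ℕ // 1 ≤ k ∧ k < n} =>
      singularHomology (lattice b) (2 * k.1)) ⟨k, hk, hkn⟩ S
    have hT : T ∈ kerInt (lattice b) := by
      rw [mem_kerInt_iff hind rfl hD hb hD0]
      intro k' p q hpq hlt w hw
      by_cases hk' : k' = ⟨k, hk, hkn⟩
      · subst hk'
        rw [DirectSum.of_eq_same, period_boxSum hS]
        exact sum_mul_apply_eq_zero hpq (ha p q hpq hlt) (hw 0)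
      · rw [DirectSum.of_eq_of_ne _ _ _ hk', map_zero]
    rw [hker, Set.mem_singleton_iff] at hT
    have hS0 : S = 0 := by
      rw [← DirectSum.of_eq_same (β := fun k : {k : ℕ // 1 ≤ k ∧ k < n} =>
        singularHomology (lattice b) (2 * k.1)) ⟨k, hk, hkn⟩ S]
      exact congrArg (fun T => T ⟨k, hk, hkn⟩) hT
    -- A zero class has zero periods against all constant forms, not only those of type `(p, q)`
    -- with `p > q`; the dual real forms then read off each coefficient.
    refine ha0 (funext fun I => ?_)
    have h := (period_boxSum hS (detForm fun c =>
      Complex.ofRealCLM.toLinearMap ∘ₗ b.coord (I c)).toAlternatingMap).1 (by rw [hS0, map_zero])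
    have h2 := (sum_mul_detForm_coord b a I).symm.trans h
    exact_mod_cast h2
  · intro h
    refine Set.eq_singleton_iff_unique_mem.2 ⟨?_, fun S hS => ?_⟩
    · rw [mem_kerInt_iff hind rfl hD hb hD0]
      intro k p q _ _ w _
      exact map_zero _
    · rw [mem_kerInt_iff hind rfl hD hb hD0] at hS
      refine DFinsupp.ext fun k => ?_
      -- The coefficients of any parallelepiped representative of a kernel class satisfy the
      -- determinant relations, so they vanish by hypothesis and the class is that of the zero
      -- cycle.
      obtain ⟨a, ha⟩ := exists_boxSum_isCycleIn (Γ := lattice b) hind rfl (S k)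
      have ha0 : a = 0 := by
        by_contra hne
        refine h k.1 k.2.1 k.2.2 ⟨a, hne, fun p q hpq hlt P Q => ?_⟩
        have := (period_boxSum ha _).1 (hS k p q hpq hlt _ (isType_detForm hpq P Q))
        simp only [latticeDet_eq]
        exact this
      refine ha.eq_of_sub_eq_d (IsCycleIn.zero) 0 ?_
      rw [ha0]
      simp [boxSum]
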